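/- Let $\omega=\sqrt{-1}$, $d_4=\mathrm{diag}(1,\omega,\omega^2,\omega^3)$, $\Omega=(\omega^{ij})_{0\le i,j\le 3}$, and $e(\zeta,x)=\exp\!\big(x^2\zeta\, d_4+\zeta^{-1}d_4^{-1}\big)$. Let $s_1^{\mathbb R},s_2^{\mathbb R}\in\mathbb R$, put $p=\omega^{3/2}s_1^{\mathbb R}$, $q=\omega^{1/2}s_1^{\mathbb R}$, $r=\omega^3 s_2^{\mathbb R}$ (with $\omega^t=e^{\pi\sqrt{-1}\,t/2}$), let $E_{ij}$ ($1\le i,j\le 4$) be the matrix units, and define $Q_k$ for $k\in\frac14\mathbb Z$ by $Q_{k+2}=Q_k$ and $$Q_1=I+pE_{21}+qE_{34},\quad Q_{5/4}=I+rE_{24},\quad Q_{3/2}=I+pE_{14}+qE_{23},\quad Q_{7/4}=I+rE_{13},$$ $$Q_2=I+qE_{12}+pE_{43},\quad Q_{9/4}=I+rE_{42},\quad Q_{5/2}=I+pE_{32}+qE_{41},\quad Q_{11/4}=I+rE_{31}.$$ For $x>0$, a solution of the Riemann–Hilbert problem (2)$'$ at $x$ is a family $Y=\{Y_k : k\in\frac14\mathbb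 Z\}$, $Y_{k+2}=Y_k$, of holomorphic functions with values in the invertible complex $4\times4$ matrices such that (1) $Y_k(\zeta)\to I$ as $\zeta\to\infty$ in the sector $(k-1)\pi\le\arg\zeta\le(k-\frac34)\pi$; (2) the domain of $Y_k$ is an open subset of $\mathbb C^*$ containing that sector; (3) on some open subset of $\mathbb C^*$ containing the ray $\arg\zeta=(k-1)\pi$ we have $Y_k(\zeta)=Y_{k-\frac14}(\zeta)\,e(\zeta,x)\,Q_{k-\frac14}\,e(\zeta,x)^{-1}$. We say that $Y(0)$ exists if the limit of $Y_k(\zeta)$ as $\zeta\to0$ in its sector exists for every $k$ and is independent of $k$; $Y(0)$ is then this limit. Let $X\subseteq(0,\infty)$ be open, and suppose that for each $x\in X$ there is given a solution $Y=Y(\cdot,x)$ of the Riemann–Hilbert problem (2)$'$ at $x$ for which $Y(0)$ exists and $$Y(0)=\Omega\,\mathrm{diag}(a,b,b^{-1},a^{-1})\,\Omega^{-1}\quad\text{with } a=a(x)>0,\ b=b(x)>0 .$$ Define real functions on $X$ by $a=e^{-2w_0}$, $b=e^{-2w_1}$, $w_2=-w_1$, $w_3=-w_0$. Then the functions $w_i=w_i(|z|)$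 are smooth on the open set $\{z\in\mathbb C: |z|\in X\}$ and satisfy there the tt*-Toda equations $$2(w_i)_{z\bar z}=-e^{2(w_{i+1}-w_i)}+e^{2(w_i-w_{i-1})}\qquad(i \bmod 4),$$ with $w_0+w_1+w_2+w_3=0$ and the anti-symmetry condition $w_0+w_3=0$, $w_1+w_2=0$. -/

import Mathlib

open scoped ContDiff

noncomputable section

namespace TtStar

/-! ### The tt*-Toda equations -/

/-- The Wirtinger derivative `∂f/∂z = (∂f/∂x - i ∂f/∂y) / 2`. -/
def wirtinger (f : ℂ → ℂ) (z : ℂ) : ℂ :=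
  (fderiv ℝ f z 1 - Complex.I * fderiv ℝ f z Complex.I) / 2

/-- The Wirtinger derivative `∂f/∂z̄ = (∂f/∂x + i ∂f/∂y) / 2`. -/
def wirtingerBar (f : ℂ → ℂ) (z : ℂ) : ℂ :=
  (fderiv ℝ f z 1 + Complex.I * fderiv ℝ f z Complex.I) / 2

/-- `w 0, …, w n` is a smooth radial solution on the open set `U ⊆ ℂ` of the tt*-Toda equations
`2 (w_i)_{z z̄} = - exp (2 (w_{i+1} - w_i)) + exp (2 (w_i - w_{i-1}))` (indices modulo `n + 1`),
normalised by `w_0 + ⋯ + w_n = 0`, with the anti-symmetry condition of type `l`: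
`w_i + w_j = 0` if `0 ≤ i, j ≤ l - 1` and `i + j = l - 1`, or `l ≤ i, j ≤ n` and `i + j = n + l`. -/
structure IsTodaSolution (n l : ℕ) (U : Set ℂ) (w : Fin (n + 1) → ℂ → ℝ) : Prop where
  isOpen : IsOpen U
  smooth : ∀ i, ContDiffOn ℝ ∞ (w i) U
  /-- Addition and subtraction on `Fin (n + 1)` are modulo `n + 1`. -/
  equation : ∀ i, ∀ z ∈ U,
    2 * wirtinger (wirtingerBar (fun z' => (w i z' : ℂ))) z =
      ((-Real.exp (2 * (w (i + 1) z - w i z)) + Real.exp (2 * (w i z - w (i - 1) z)) : ℝ) : ℂ)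
  sum_eq_zero : ∀ z ∈ U, ∑ i, w i z = 0
  antisymm : ∀ i j : Fin (n + 1), (i : ℕ) + j + 1 = l ∨ (i : ℕ) + j = n + l →
    ∀ z ∈ U, w i z + w j z = 0
  radial : ∀ i, ∀ z ∈ U, ∀ z' ∈ U, ‖z‖ = ‖z'‖ → w i z = w i z'

/-! ### The Riemann–Hilbert problem -/

/-- `ω ^ t` for real `t`, where `ω = exp (2πi/4)`. -/
def omegaPow (t : ℝ) : ℂ := Complex.exp (t * (Real.pi / 2) * Complex.I)

/-- The matrix `Ω = (ω ^ (i j))`, `0 ≤ i, j ≤ 3`, where `ω = √-1`. -/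
def Omega : Matrix (Fin 4) (Fin 4) ℂ :=
  Matrix.of fun i j => Complex.I ^ ((i : ℕ) * (j : ℕ))

/-- The diagonal entries of `d₄ = diag (1, ω, ω², ω³)`. -/
def d4 (i : Fin 4) : ℂ := Complex.I ^ (i : ℕ)

/-- `e(ζ, x) = exp (x² ζ d₄ + ζ⁻¹ d₄⁻¹)`. -/
def expMat (x : ℝ) (ζ : ℂ) : Matrix (Fin 4) (Fin 4) ℂ :=
  Matrix.diagonal fun i => Complex.exp ((x : ℂ) ^ 2 * ζ * d4 i + ζ⁻¹ * (d4 i)⁻¹)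

/-- The Stokes factor `Q_k` at infinity with `k = m / 4`; it depends only on `k` modulo `2`. -/
def stokesQ (s₁ s₂ : ℝ) (m : ℤ) : Matrix (Fin 4) (Fin 4) ℂ :=
  let p : ℂ := omegaPow (3 / 2) * s₁
  let q : ℂ := omegaPow (1 / 2) * s₁
  let r : ℂ := omegaPow 3 * s₂
  match (m % 8).toNat with
  | 4 => !![1, 0, 0, 0; p, 1, 0, 0; 0, 0, 1, q; 0, 0, 0, 1]
  | 5 => !![1, 0, 0, 0; 0, 1, 0, r; 0, 0, 1, 0; 0, 0, 0, 1]
  | 6 => !![1, 0, 0, p; 0, 1, q, 0; 0, 0, 1, 0; 0, 0, 0, 1]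
  | 7 => !![1, 0, r, 0; 0, 1, 0, 0; 0, 0, 1, 0; 0, 0, 0, 1]
  | 0 => !![1, q, 0, 0; 0, 1, 0, 0; 0, 0, 1, 0; 0, 0, p, 1]
  | 1 => !![1, 0, 0, 0; 0, 1, 0, 0; 0, 0, 1, 0; 0, r, 0, 1]
  | 2 => !![1, 0, 0, 0; 0, 1, 0, 0; 0, p, 1, 0; q, 0, 0, 1]
  | _ => !![1, 0, 0, 0; 0, 1, 0, 0; r, 0, 1, 0; 0, 0, 0, 1]

/-- The closed sector `(k - 1) π ≤ arg ζ ≤ (k - 3/4) π` of `ℂ ∖ {0}`, with `k = m / 4`. -/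
def sector (m : ℤ) : Set ℂ :=
  {ζ | ∃ r θ : ℝ, 0 < r ∧ ((m : ℝ) / 4 - 1) * Real.pi ≤ θ ∧ θ ≤ ((m : ℝ) / 4 - 3 / 4) * Real.pi ∧
    ζ = r * Complex.exp (θ * Complex.I)}

/-- The ray `arg ζ = (k - 1) π` of `ℂ ∖ {0}`, with `k = m / 4`. -/
def ray (m : ℤ) : Set ℂ :=
  {ζ | ∃ r : ℝ, 0 < r ∧ ζ = r * Complex.exp ((((m : ℝ) / 4 - 1) * Real.pi : ℝ) * Complex.I)}

/-- `Y = {Y_k}`, where `Y m` stands for `Y_k` with `k = m / 4`, solves the Riemann–Hilbert problem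
with Stokes parameters `s₁`, `s₂` at the parameter value `x`: the `Y_k` are holomorphic functions
with values in the invertible matrices, each on an open subset of `ℂ ∖ {0}` that contains the
closed sector of index `k`. -/
structure IsRHSolution (s₁ s₂ x : ℝ) (Y : ℤ → ℂ → Matrix (Fin 4) (Fin 4) ℂ) : Prop where
  periodic : ∀ m, Y (m + 8) = Y m
  tendsto_infty : ∀ m,
    Filter.Tendsto (Y m) (Bornology.cobounded ℂ ⊓ Filter.principal (sector m)) (nhds 1)
  holomorphic_jump : ∃ D : ℤ → Set ℂ,
    (∀ m, IsOpen (D m) ∧ (0 : ℂ) ∉ D m ∧ sector m ⊆ D m ∧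
      (∀ i j, DifferentiableOn ℂ (fun ζ => Y m ζ i j) (D m)) ∧
      ∀ ζ ∈ D m, IsUnit (Y m ζ)) ∧
    ∀ m, ∃ N : Set ℂ, IsOpen N ∧ ray m ⊆ N ∧ N ⊆ D m ∩ D (m - 1) ∧
      ∀ ζ ∈ N, Y m ζ = Y (m - 1) ζ * (expMat x ζ * stokesQ s₁ s₂ (m - 1) * (expMat x ζ)⁻¹)

/-- `Y(0)` exists and equals `M`: every `Y_k(ζ)` tends to `M` as `ζ → 0` in its sector. -/
def HasValueAtZero (Y : ℤ → ℂ → Matrix (Fin 4) (Fin 4) ℂ) (M : Matrix (Fin 4) (Fin 4) ℂ) : Prop :=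
  ∀ m, Filter.Tendsto (Y m) (nhdsWithin 0 (sector m)) (nhds M)

end TtStar

end

/-! The Riemann–Hilbert problem is traded for a ∂̄-problem on the whole plane. Each jump matrix is 1
+ E N, where N has square zero and E is a scalar exponential that decays at 0 and ∞ throughout the
closed sector that starts at its ray (`nilPart_eq_single`, `expMat_conj`, `norm_jumpExp_le`). Let χ
be a cutoff that is 1 near the lower edge of a sector and 0 near the upper edge. Then the matrices
Y_k (1 - χ E N) fit together across the rays to a continuous F with F(∞) = 1, F(0) = Y(0) and ∂F/∂z̄
= F R off 0, where R = -(∂χ/∂z̄) E N is explicit and decays exponentially at both ends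
(`exists_isDbarSolution`).

For two such solutions and a constant c, the function F₁ c F⁻¹ has ∂̄-derivative F₁ (R₁ c - c R)
F⁻¹, so the Cauchy–Pompeiu formula writes it as c plus a solid Cauchy transform
(`IsDbarSolution.mul_mul_eq_add`). With c = 1 this compares solutions at nearby parameters, and
shows that F and the coefficient y in F = 1 + y/ζ + o(1/ζ) are differentiable in t = x². Solutions
are given on an open set of parameters, so neither existence nor uniqueness has to be proved.

With F₁ = F and c = d or d⁻¹, where d = d₄, the same formula evaluates the derivatives. Since ∂R/∂t
= ζ [d, R], one gets F(0)' = [y, d] F(0) (`hasDerivAt_value`). Rescaling ζ moves the parameter to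
the ζ⁻¹ term of the exponent, where the derivative of R is ζ⁻¹ [d⁻¹, R]; this gives (t y)' = F(0)
d⁻¹ F(0)⁻¹ - d⁻¹ (`hasDerivAt_smul_leadingCoeff`).

Conjugation by Ω makes F(0) diagonal with entries exp(-2 w_i) and turns d into the cyclic shift. If
c_i are the diagonal entries of Ω⁻¹ [y, d] Ω, then -2 w_i' = c_i and (t c_i)' = exp(2(w_{i+1} -
w_i)) - exp(2(w_i - w_{i-1})). This first order system bootstraps to smoothness, and it is the
tt*-Toda system because ∂_z ∂_z̄ acts on functions of t = |z|² as (d/dt) t (d/dt). -/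

noncomputable section

namespace TtStar

open MeasureTheory Filter Topology Set

/-! ### The solid Cauchy transform on weighted sup-norm spaces -/

section CauchyTransform

variable {E : Type*} [NormedAddCommGroup E] [NormedSpace ℂ E]

/-- `H` is real differentiable at `z`, and `∂H/∂z̄ = a` there. -/
def HasDbarAt (H : ℂ → E) (a : E) (z : ℂ) : Prop :=
  ∃ L : ℂ →L[ℝ] E, HasFDerivAt H L z ∧ L 1 + Complex.I • L Complex.I = (2 : ℂ) • a

/-- The solid Cauchy transform `ζ ↦ π⁻¹ ∫ h(s) / (ζ - s)` of `h`. -/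
def cauchyTransform (h : ℂ → E) (ζ : ℂ) : E :=
  (Real.pi : ℂ)⁻¹ • ∫ s : ℂ, (ζ - s)⁻¹ • h s

/-- The total mass `π⁻¹ ∫ h(s)` of `h`. -/
def planarMean (h : ℂ → E) : E :=
  (Real.pi : ℂ)⁻¹ • ∫ s : ℂ, h s

/-- The weight `(1 + ‖s‖) ^ (-n)`. -/
def decay (n : ℕ) (s : ℂ) : ℝ := ((1 + ‖s‖) ^ n)⁻¹

lemma decay_pos (n : ℕ) (s : ℂ) : 0 < decay n s := by unfold decay; positivity

lemma decay_le_one (n : ℕ) (s : ℂ) : decay n s ≤ 1 :=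
  inv_le_one_of_one_le₀ (one_le_pow₀ (by linarith [norm_nonneg s]))

lemma measurable_decay (n : ℕ) : Measurable (decay n) := by unfold decay; fun_prop

lemma norm_mul_decay_le (n : ℕ) (s : ℂ) : ‖s‖ * decay (n + 1) s ≤ decay n s := by
  unfold decay
  rw [pow_succ, mul_inv]
  have h1 : ‖s‖ * (1 + ‖s‖)⁻¹ ≤ 1 := by
    rw [← div_eq_mul_inv, div_le_one (by positivity)]; linarith
  calc ‖s‖ * (((1 + ‖s‖) ^ n)⁻¹ * (1 + ‖s‖)⁻¹) = ((1 + ‖s‖) ^ n)⁻¹ * (‖s‖ * (1 + ‖s‖)⁻¹) := by ring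
    _ ≤ ((1 + ‖s‖) ^ n)⁻¹ * 1 := by gcongr
    _ = _ := mul_one _

lemma integrable_decay {n : ℕ} (hn : 3 ≤ n) : Integrable (decay n) := by
  have h := integrable_one_add_norm (E := ℂ) (μ := volume) (r := n) (by
    rw [Complex.finrank_real_complex]; exact_mod_cast hn)
  refine h.congr (ae_of_all _ fun s => ?_)
  simp only [decay]
  rw [Real.rpow_neg (by positivity), Real.rpow_natCast]

/-- The singularity has order 1, below the real dimension 2. -/
lemma integrableOn_ball_norm_inv : IntegrableOn (fun s : ℂ => ‖s‖⁻¹) (Metric.ball 0 1) := by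
  refine integrableOn_ball_of_norm_le_rpow (C := 1) (α := 1) ?_ ?_ (ae_of_all _ fun s => ?_) ?_
  · rw [Complex.finrank_real_complex]; norm_num
  · rw [Complex.finrank_real_complex]; norm_num
  · rw [one_mul, Real.rpow_neg_one, norm_inv, norm_norm]
  · exact (measurable_norm.inv).aestronglyMeasurable

/-- The kernel `1 / ‖ζ - s‖` is uniformly integrable against the weight `decay n`, `n ≥ 3`. -/
lemma exists_kernel_bound {n : ℕ} (hn : 3 ≤ n) : ∃ K : ℝ, 0 < K ∧ ∀ ζ : ℂ,
    Integrable (fun s : ℂ => ‖(ζ - s)⁻¹‖ * decay n s) ∧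
      ∫ s : ℂ, ‖(ζ - s)⁻¹‖ * decay n s ≤ K := by
  -- Near the pole the kernel is dominated by a translate of the fixed function `g`, because the
  -- weight is at most 1; elsewhere it is dominated by the weight alone. This makes the bound
  -- uniform in `ζ`.
  set g : ℂ → ℝ := (Metric.ball (0 : ℂ) 1).indicator fun s => ‖s‖⁻¹ with hg
  have hgi : Integrable g :=
    (integrable_indicator_iff Metric.isOpen_ball.measurableSet).2 integrableOn_ball_norm_inv
  have hg0 : ∀ s, 0 ≤ g s := fun s => indicator_nonneg (fun _ _ => by positivity) _
  refine ⟨(∫ s, g s) + (∫ s, decay n s) + 1, ?_, fun ζ => ?_⟩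
  · have h1 : 0 ≤ ∫ s, g s := integral_nonneg fun s => hg0 s
    have h2 : 0 ≤ ∫ s, decay n s := integral_nonneg fun s => (decay_pos n s).le
    linarith
  have hgζ : Integrable fun s => g (ζ - s) := hgi.comp_sub_left ζ
  have hle : ∀ s, ‖(ζ - s)⁻¹‖ * decay n s ≤ g (ζ - s) + decay n s := by
    intro s
    by_cases hs : ζ - s ∈ Metric.ball (0 : ℂ) 1
    · rw [hg, indicator_of_mem hs, norm_inv]
      have := decay_le_one n s
      have := decay_pos n s
      nlinarith [inv_nonneg.2 (norm_nonneg (ζ - s))]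
    · have h1 : 1 ≤ ‖ζ - s‖ := by simpa using hs
      have h2 : ‖(ζ - s)⁻¹‖ ≤ 1 := by rw [norm_inv]; exact inv_le_one_of_one_le₀ h1
      have := hg0 (ζ - s)
      have := decay_pos n s
      nlinarith
  have hintg : Integrable (fun s : ℂ => ‖(ζ - s)⁻¹‖ * decay n s) := by
    refine (hgζ.add (integrable_decay hn)).mono' ?_ (ae_of_all _ fun s => ?_)
    · have := measurable_decay n
      exact (by fun_prop : Measurable _).aestronglyMeasurable
    · rw [Real.norm_of_nonneg (mul_nonneg (norm_nonneg _) (decay_pos n s).le)]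
      exact hle s
  refine ⟨hintg, ?_⟩
  calc ∫ s : ℂ, ‖(ζ - s)⁻¹‖ * decay n s ≤ ∫ s, (g (ζ - s) + decay n s) :=
        integral_mono hintg (hgζ.add (integrable_decay hn)) hle
    _ = (∫ s, g s) + ∫ s, decay n s := by
        rw [integral_add hgζ (integrable_decay hn), integral_sub_left_eq_self g volume ζ]
    _ ≤ _ := by linarith

variable {h : ℂ → E} {C : ℝ} {n : ℕ}

lemma integrable_of_decay {E : Type*} [NormedAddCommGroup E] {h : ℂ → E} {C : ℝ} {n : ℕ}
    (hn : 3 ≤ n) (hm : StronglyMeasurable h) (hb : ∀ s, ‖h s‖ ≤ C * decay n s) : Integrable h :=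
  ((integrable_decay hn).const_mul C).mono' hm.aestronglyMeasurable (ae_of_all _ hb)

lemma stronglyMeasurable_kernel (hm : StronglyMeasurable h) (ζ : ℂ) :
    StronglyMeasurable fun s => (ζ - s)⁻¹ • h s :=
  (by fun_prop : Measurable fun s : ℂ => (ζ - s)⁻¹).stronglyMeasurable.smul hm

lemma norm_kernel_le (hb : ∀ s, ‖h s‖ ≤ C * decay n s) (ζ s : ℂ) :
    ‖(ζ - s)⁻¹ • h s‖ ≤ C * (‖(ζ - s)⁻¹‖ * decay n s) := by
  rw [norm_smul]
  nlinarith [hb s, norm_nonneg (ζ - s)⁻¹]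

lemma integrable_kernel (hn : 3 ≤ n) (hm : StronglyMeasurable h)
    (hb : ∀ s, ‖h s‖ ≤ C * decay n s) (ζ : ℂ) : Integrable fun s => (ζ - s)⁻¹ • h s := by
  obtain ⟨K, -, hK⟩ := exists_kernel_bound hn
  exact ((hK ζ).1.const_mul C).mono' (stronglyMeasurable_kernel hm ζ).aestronglyMeasurable
    (ae_of_all _ (norm_kernel_le hb ζ))

/-- The Cauchy transform is bounded from the weighted sup norm to the sup norm. -/
lemma exists_norm_cauchyTransform_le (E : Type*) [NormedAddCommGroup E] [NormedSpace ℂ E]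
    {n : ℕ} (hn : 3 ≤ n) : ∃ K : ℝ, 0 < K ∧
    ∀ (h : ℂ → E) (C : ℝ), 0 ≤ C → (∀ s, ‖h s‖ ≤ C * decay n s) →
      ∀ ζ, ‖cauchyTransform h ζ‖ ≤ K * C := by
  obtain ⟨K, hK0, hK⟩ := exists_kernel_bound hn
  refine ⟨Real.pi⁻¹ * K, by positivity, fun h C hC hb ζ => ?_⟩
  rw [cauchyTransform, norm_smul, norm_inv, Complex.norm_real, Real.norm_of_nonneg Real.pi_pos.le,
    mul_assoc]
  gcongr
  calc ‖∫ s : ℂ, (ζ - s)⁻¹ • h s‖ ≤ ∫ s : ℂ, C * (‖(ζ - s)⁻¹‖ * decay n s) :=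
        norm_integral_le_of_norm_le ((hK ζ).1.const_mul C) (ae_of_all _ (norm_kernel_le hb ζ))
    _ = C * ∫ s : ℂ, ‖(ζ - s)⁻¹‖ * decay n s := integral_const_mul _ _
    _ ≤ C * K := by gcongr; exact (hK ζ).2
    _ = K * C := mul_comm _ _

lemma norm_smul_le_decay (hC : 0 ≤ C) (hb : ∀ s, ‖h s‖ ≤ C * decay (n + 1) s) (s : ℂ) :
    ‖s • h s‖ ≤ C * decay n s := by
  rw [norm_smul]
  calc ‖s‖ * ‖h s‖ ≤ ‖s‖ * (C * decay (n + 1) s) := by gcongr; exact hb s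
    _ = C * (‖s‖ * decay (n + 1) s) := by ring
    _ ≤ _ := by gcongr; exact norm_mul_decay_le n s

/-- Expansion of the Cauchy transform at infinity, exact form. -/
lemma smul_cauchyTransform (hn : 3 ≤ n) (hm : StronglyMeasurable h)
    (hb : ∀ s, ‖h s‖ ≤ C * decay (n + 1) s) (hC : 0 ≤ C) (ζ : ℂ) :
    ζ • cauchyTransform h ζ = planarMean h + cauchyTransform (fun s => s • h s) ζ := by
  have hm' : StronglyMeasurable fun s : ℂ => s • h s := stronglyMeasurable_id.smul hm
  rw [cauchyTransform, planarMean, cauchyTransform, ← smul_add,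
    ← integral_add (integrable_of_decay (by omega) hm hb)
      (integrable_kernel hn hm' (norm_smul_le_decay hC hb) ζ),
    smul_comm, ← integral_smul]
  congr 1
  refine integral_congr_ae ?_
  -- The identity ζ/(ζ - s) = 1 + s/(ζ - s) fails at s = ζ, where the inverse takes the default
  -- value 0, so this null set is removed.
  filter_upwards [compl_mem_ae_iff.2 (measure_singleton (μ := volume) ζ)] with s hs
  have hs' : ζ - s ≠ 0 := sub_ne_zero.2 (Ne.symm hs)
  rw [smul_smul, smul_smul]
  nth_rewrite 2 [← one_smul ℂ (h s)]
  rw [← add_smul]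
  congr 1
  field_simp
  ring

/-- By `smul_cauchyTransform`, ζ times the transform is bounded. Weight 4 is needed because the
factor s costs one power and the kernel bound uses three; the next lemma costs one more, which is
why weight 5 is used throughout. -/
lemma tendsto_cauchyTransform (hm : StronglyMeasurable h)
    (hb : ∀ s, ‖h s‖ ≤ C * decay 4 s) (hC : 0 ≤ C) :
    Tendsto (cauchyTransform h) (Bornology.cobounded ℂ) (𝓝 0) := by
  obtain ⟨K, hK0, hK⟩ := exists_norm_cauchyTransform_le E le_rfl
  have h1 := smul_cauchyTransform le_rfl hm hb hC
  set B : ℝ := ‖planarMean h‖ + K * C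
  have h2 : ∀ᶠ ζ in Bornology.cobounded ℂ, ‖cauchyTransform h ζ‖ ≤ B * ‖ζ‖⁻¹ := by
    filter_upwards [Bornology.eventually_ne_cobounded (0 : ℂ)] with ζ hζ
    have h3 : ‖ζ • cauchyTransform h ζ‖ ≤ B := by
      rw [h1]
      exact (norm_add_le _ _).trans
        (add_le_add le_rfl (hK _ C hC (norm_smul_le_decay hC hb) ζ))
    rw [norm_smul] at h3
    rw [← div_eq_mul_inv, le_div_iff₀ (norm_pos_iff.2 hζ)]
    linarith
  refine squeeze_zero_norm' h2 ?_
  simpa using (tendsto_inv_atTop_zero.comp (tendsto_norm_cobounded_atTop (E := ℂ))).const_mul B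

/-- Expansion of the Cauchy transform at infinity. -/
lemma tendsto_smul_cauchyTransform (hm : StronglyMeasurable h)
    (hb : ∀ s, ‖h s‖ ≤ C * decay 5 s) (hC : 0 ≤ C) :
    Tendsto (fun ζ => ζ • cauchyTransform h ζ) (Bornology.cobounded ℂ) (𝓝 (planarMean h)) := by
  have h1 : ∀ ζ, ζ • cauchyTransform h ζ = planarMean h + cauchyTransform (fun s => s • h s) ζ :=
    smul_cauchyTransform (n := 4) (by norm_num) hm hb hC
  simp_rw [h1]
  have hm' : StronglyMeasurable fun s : ℂ => s • h s := stronglyMeasurable_id.smul hm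
  simpa using (tendsto_cauchyTransform hm' (norm_smul_le_decay hC hb) hC).const_add
    (planarMean h)

/-- At ζ = 0 the kernel is -1/s and cancels the factor s. This lets a derivative of F(0) be read off
from the behaviour of F at infinity. -/
lemma cauchyTransform_smul_zero (h : ℂ → E) :
    cauchyTransform (fun s => s • h s) 0 = -planarMean h := by
  rw [cauchyTransform, planarMean, ← smul_neg, ← integral_neg]
  congr 1
  refine integral_congr_ae ?_
  filter_upwards [compl_mem_ae_iff.2 (measure_singleton (μ := volume) (0 : ℂ))] with s hs
  have hs' : s ≠ 0 := hs
  rw [smul_smul, zero_sub, inv_neg, neg_mul, inv_mul_cancel₀ hs', neg_one_smul]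

lemma cauchyTransform_zero (h : ℂ → E) :
    cauchyTransform h 0 = -planarMean (fun s => s⁻¹ • h s) := by
  rw [cauchyTransform, planarMean, ← smul_neg, ← integral_neg]
  congr 2
  ext s
  rw [zero_sub, inv_neg, neg_smul]

end CauchyTransform

/-! ### The Cauchy–Pompeiu formula, by the divergence theorem in polar coordinates -/

section CauchyPompeiu

variable {E : Type*} [NormedAddCommGroup E] [NormedSpace ℂ E]

/-- An improper fundamental theorem of calculus on `(0, ∞)`. -/
lemma integral_Ioi_eq_sub_of_tendsto {j Φ : ℝ → E} {A B : E} (hj : IntegrableOn j (Ioi 0))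
    (hΦ : ∀ a b : ℝ, 0 < a → a < b → ∫ r in a..b, j r = Φ b - Φ a)
    (h0 : Tendsto Φ (𝓝[>] 0) (𝓝 A)) (hinf : Tendsto Φ atTop (𝓝 B)) :
    ∫ r in Ioi 0, j r = B - A := by
  have ha : Tendsto (fun n : ℕ => ((n : ℝ) + 2)⁻¹) atTop (𝓝 0) :=
    tendsto_inv_atTop_zero.comp
      (tendsto_atTop_add_const_right _ _ tendsto_natCast_atTop_atTop)
  have ha' : Tendsto (fun n : ℕ => ((n : ℝ) + 2)⁻¹) atTop (𝓝[>] 0) :=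
    tendsto_nhdsWithin_iff.2 ⟨ha, Eventually.of_forall fun n => by
      simp only [mem_Ioi]; positivity⟩
  have hb : Tendsto (fun n : ℕ => (n : ℝ) + 2) atTop atTop :=
    tendsto_atTop_add_const_right _ _ tendsto_natCast_atTop_atTop
  have hcov : AECover ((volume : Measure ℝ).restrict (Ioi 0)) atTop
      fun n : ℕ => Ioi ((n : ℝ) + 2)⁻¹ ∩ Iic ((n : ℝ) + 2) :=
    (aecover_Ioi_of_Ioi ha).inter (aecover_Iic hb)
  have h1 := hcov.integral_tendsto_of_countably_generated hj
  refine tendsto_nhds_unique h1 (((hinf.comp hb).sub (h0.comp ha')).congr fun n => ?_)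
  have hn : (0 : ℝ) < ((n : ℝ) + 2)⁻¹ := by positivity
  have hlt : ((n : ℝ) + 2)⁻¹ < (n : ℝ) + 2 := by
    have : ((n : ℝ) + 2)⁻¹ ≤ 1 := inv_le_one_of_one_le₀ (by linarith [n.cast_nonneg (α := ℝ)])
    linarith [n.cast_nonneg (α := ℝ)]
  rw [Measure.restrict_restrict (measurableSet_Ioi.inter measurableSet_Iic),
    show (Ioi ((n : ℝ) + 2)⁻¹ ∩ Iic ((n : ℝ) + 2)) ∩ Ioi 0 = Ioc ((n : ℝ) + 2)⁻¹ ((n : ℝ) + 2) by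
      ext r; simp only [mem_inter_iff, mem_Ioi, mem_Iic, mem_Ioc]
      exact ⟨fun h => h.1, fun h => ⟨h, hn.trans h.1⟩⟩,
    ← intervalIntegral.integral_of_le hlt.le, hΦ _ _ hn hlt]
  rfl

/-- The point with polar coordinates `(r, θ)` around `z`. -/
def polarPoint (z : ℂ) (p : ℝ × ℝ) : ℂ := z + p.1 * Complex.exp (p.2 * Complex.I)

lemma continuous_polarPoint (z : ℂ) : Continuous (polarPoint z) := by
  unfold polarPoint; fun_prop

lemma hasFDerivAt_polarPoint (z : ℂ) (p : ℝ × ℝ) : ∃ L : ℝ × ℝ →L[ℝ] ℂ,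
    HasFDerivAt (polarPoint z) L p ∧ L (1, 0) = Complex.exp (p.2 * Complex.I) ∧
      L (0, 1) = (p.1 * Complex.exp (p.2 * Complex.I)) * Complex.I := by
  have h1 : HasFDerivAt (fun p : ℝ × ℝ => (p.1 : ℂ))
      (Complex.ofRealCLM.comp (ContinuousLinearMap.fst ℝ ℝ ℝ)) p :=
    Complex.ofRealCLM.hasFDerivAt.comp p hasFDerivAt_fst
  have h2 : HasFDerivAt (fun p : ℝ × ℝ => (p.2 : ℂ))
      (Complex.ofRealCLM.comp (ContinuousLinearMap.snd ℝ ℝ ℝ)) p :=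
    Complex.ofRealCLM.hasFDerivAt.comp p hasFDerivAt_snd
  have h3 := (h1.mul ((h2.mul_const Complex.I).cexp)).const_add z
  refine ⟨_, h3, ?_, ?_⟩ 
  · simp
  · simp; ring

lemma complexPolarCoord_symm_eq (p : ℝ × ℝ) :
    Complex.polarCoord.symm p = p.1 * Complex.exp (p.2 * Complex.I) := by
  rw [Complex.polarCoord_symm_apply, Complex.exp_mul_I, Complex.ofReal_cos, Complex.ofReal_sin]

/-- Polar coordinates are injective, so the origin, the only point where H may fail to be
differentiable, is met at most once. The divergence theorem tolerates a countable exceptional set.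
-/
lemma countable_polarPoint_eq_zero (z : ℂ) :
    (Ioi (0 : ℝ) ×ˢ Ioo (-Real.pi) Real.pi ∩ {p | polarPoint z p = 0}).Countable := by
  refine (Set.Subsingleton.finite fun p hp q hq => ?_).countable
  have h : Complex.polarCoord.symm p = Complex.polarCoord.symm q := by
    rw [complexPolarCoord_symm_eq, complexPolarCoord_symm_eq]
    exact add_left_cancel (hp.2.trans hq.2.symm)
  exact Complex.polarCoord.symm.injOn hp.1 hq.1 h

variable {H h : ℂ → E} {z : ℂ} {C : ℝ}

/-- The difference of the integrals of `H` over two concentric circles in terms of `∂H/∂z̄`. -/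
lemma integral_polar_dbar [CompleteSpace E] (hc : Continuous H)
    (hd : ∀ s, s ≠ 0 → HasDbarAt H (h s) s) (hm : StronglyMeasurable h)
    (hb : ∀ s, ‖h s‖ ≤ C) {a b : ℝ} (ha : 0 < a) (hab : a < b) :
    ∫ r in a..b, ∫ θ in (-Real.pi)..Real.pi,
        (2 * Complex.exp (-(θ * Complex.I))) • h (polarPoint z (r, θ)) =
      (∫ θ in (-Real.pi)..Real.pi, H (polarPoint z (b, θ))) -
        ∫ θ in (-Real.pi)..Real.pi, H (polarPoint z (a, θ)) := by
  classical
  have hpi : (-Real.pi) < Real.pi := by linarith [Real.pi_pos]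
  set D : Set (ℝ × ℝ) := Ioi (0 : ℝ) ×ˢ Ioo (-Real.pi) Real.pi ∩ {p | polarPoint z p = 0} with hD
  set f : ℝ × ℝ → E := fun p => H (polarPoint z p) with hf
  -- In polar coordinates ∂_r H + (i/r) ∂_θ H = 2 exp(-iθ) ∂H/∂z̄, so the integrand is the
  -- divergence of the field (f, g).
  set g : ℝ × ℝ → E := fun p => ((p.1 : ℂ)⁻¹ * Complex.I) • f p with hg
  have hfc : Continuous f := hc.comp (continuous_polarPoint z)
  -- derivatives off the exceptional set, with the divergence identity
  have key : ∀ p : ℝ × ℝ, ∃ f' g' : ℝ × ℝ →L[ℝ] E,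
      (0 < p.1 → polarPoint z p ≠ 0 → HasFDerivAt f f' p ∧ HasFDerivAt g g' p) ∧
      f' (1, 0) + g' (0, 1) =
        (2 * Complex.exp (-(p.2 * Complex.I))) • h (polarPoint z p) := by
    intro p
    by_cases hp : 0 < p.1 ∧ polarPoint z p ≠ 0
    · obtain ⟨hp1, hp2⟩ := hp
      obtain ⟨L, hL, hLe⟩ := hd _ hp2
      obtain ⟨P, hP, hP1, hP2⟩ := hasFDerivAt_polarPoint z p
      have hf' : HasFDerivAt f (L.comp P) p := hL.comp p hP
      have hp1' : (p.1 : ℂ) ≠ 0 := by exact_mod_cast hp1.ne'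
      have hi : HasFDerivAt (fun p : ℝ × ℝ => (p.1 : ℂ)⁻¹ * Complex.I) _ p :=
        ((hasDerivAt_inv hp1').comp_ofReal.hasFDerivAt.comp p hasFDerivAt_fst).mul_const Complex.I
      have hg' := hi.smul hf'
      refine ⟨_, _, fun _ _ => ⟨hf', hg'⟩, ?_⟩
      simp only [ContinuousLinearMap.comp_apply, hP1, add_apply, smul_apply,
        ContinuousLinearMap.smulRight_apply,
        ContinuousLinearMap.coe_fst', hP2]
      set e := Complex.exp (p.2 * Complex.I) with he
      -- decompose a real-linear map along `1` and `I`
      have hdec : ∀ w : ℂ, L w = (w.re : ℂ) • L 1 + (w.im : ℂ) • L Complex.I := by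
        intro w
        conv_lhs => rw [show w = w.re • (1 : ℂ) + w.im • Complex.I by simp]
        rw [map_add, map_smul, map_smul]
        simp
      have hinv : Complex.exp (-(p.2 * Complex.I)) = (e.re : ℂ) - e.im * Complex.I := by
        rw [he, Complex.exp_ofReal_mul_I_re, Complex.exp_ofReal_mul_I_im, ← neg_mul,
          ← Complex.ofReal_neg, Complex.exp_mul_I]
        push_cast
        rw [Complex.cos_neg, Complex.sin_neg]
        ring
      rw [mul_comm (2 : ℂ), mul_smul _ (2 : ℂ), ← hLe, hinv, map_zero, smul_zero, zero_smul,
        add_zero,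
        hdec e, hdec (_ * Complex.I)]
      have e1 : (((p.1 : ℂ) * e * Complex.I).re : ℂ) = -(p.1 * e.im) := by simp
      have e2 : (((p.1 : ℂ) * e * Complex.I).im : ℂ) = p.1 * e.re := by simp
      rw [e1, e2]
      have e3 : (p.1 : ℂ)⁻¹ * Complex.I * -(↑p.1 * ↑e.im) = -(e.im * Complex.I) := by
        field_simp
      have e4 : (p.1 : ℂ)⁻¹ * Complex.I * (↑p.1 * ↑e.re) = e.re * Complex.I := by
        field_simp
      have e5 : (e.im : ℂ) * Complex.I * Complex.I = -e.im := by
        rw [mul_assoc, Complex.I_mul_I]; ring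
      simp only [smul_add, smul_smul, sub_smul, sub_mul, e3, e4, e5]
      module
    -- Where no derivative is claimed, dummy derivatives are chosen that still satisfy the
    -- divergence identity, so that it can be rewritten at every point.
    · set w := (2 * Complex.exp (-(p.2 * Complex.I))) • h (polarPoint z p)
      refine ⟨(ContinuousLinearMap.fst ℝ ℝ ℝ).smulRight w, 0,
        fun h1 h2 => absurd ⟨h1, h2⟩ hp, by simp⟩
  choose f' g' hder hdiv using key
  have hdiv' : (fun p => f' p (1, 0) + g' p (0, 1)) =
      fun p : ℝ × ℝ => (2 * Complex.exp (-(p.2 * Complex.I))) • h (polarPoint z p) :=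
    funext hdiv
  have hmem : ∀ p ∈ Ioo (min a b) (max a b) ×ˢ Ioo (min (-Real.pi) Real.pi)
      (max (-Real.pi) Real.pi) \ D, 0 < p.1 ∧ polarPoint z p ≠ 0 := by
    rintro p ⟨⟨h1, h2⟩, h3⟩
    rw [min_eq_left hab.le, max_eq_right hab.le] at h1
    rw [min_eq_left hpi.le, max_eq_right hpi.le] at h2
    have h4 : 0 < p.1 := ha.trans h1.1
    exact ⟨h4, fun h5 => h3 ⟨⟨h4, h2⟩, h5⟩⟩
  have hgc : ContinuousOn g (uIcc a b ×ˢ uIcc (-Real.pi) Real.pi) := by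
    refine ContinuousOn.smul (ContinuousOn.mul (ContinuousOn.inv₀ (by fun_prop) ?_)
      continuousOn_const) hfc.continuousOn
    rintro p ⟨h1, -⟩
    rw [uIcc_of_le hab.le] at h1
    exact_mod_cast (ha.trans_le h1.1).ne'
  have hintg : IntegrableOn (fun p => f' p (1, 0) + g' p (0, 1))
      (uIcc a b ×ˢ uIcc (-Real.pi) Real.pi) := by
    rw [hdiv']
    refine Measure.integrableOn_of_bounded (M := 2 * C) ?_ ?_ (ae_of_all _ fun p => ?_)
    · exact (isCompact_uIcc.prod isCompact_uIcc).measure_lt_top.ne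
    · exact ((by fun_prop : Measurable fun p : ℝ × ℝ =>
        2 * Complex.exp (-(p.2 * Complex.I))).stronglyMeasurable.smul
        (hm.comp_measurable (continuous_polarPoint z).measurable)).aestronglyMeasurable
    · rw [norm_smul, norm_mul, ← neg_mul, ← Complex.ofReal_neg, Complex.norm_exp_ofReal_mul_I]
      simpa using hb (polarPoint z p)
  have h := integral2_divergence_prod_of_hasFDerivAt_off_countable f g f' g' a (-Real.pi) b Real.pi
    D (countable_polarPoint_eq_zero z) hfc.continuousOn hgc
    (fun p hp => (hder p (hmem p hp).1 (hmem p hp).2).1)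
    (fun p hp => (hder p (hmem p hp).1 (hmem p hp).2).2) hintg
  simp only [hdiv] at h
  rw [h]
  -- The edges θ = π and θ = -π contribute equal terms and cancel.
  have hper : ∀ r : ℝ, g (r, Real.pi) = g (r, -Real.pi) := by
    intro r
    have : polarPoint z (r, Real.pi) = polarPoint z (r, -Real.pi) := by
      simp [polarPoint, Complex.exp_neg]
    simp only [hg, hf, this]
  simp only [hper, sub_self, zero_add, hf]

/-- The Cauchy–Pompeiu formula on the whole plane. -/
theorem eq_add_cauchyTransform [CompleteSpace E] {n : ℕ} (hn : 3 ≤ n) {c : E} (hc : Continuous H)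
    (hlim : Tendsto H (Bornology.cobounded ℂ) (𝓝 c))
    (hd : ∀ s, s ≠ 0 → HasDbarAt H (h s) s) (hm : StronglyMeasurable h)
    (hC : 0 ≤ C) (hb : ∀ s, ‖h s‖ ≤ C * decay n s) (z : ℂ) :
    H z = c + cauchyTransform h z := by
  have hpi : (-Real.pi) ≤ Real.pi := by linarith [Real.pi_pos]
  have hb' : ∀ s, ‖h s‖ ≤ C := fun s =>
    (hb s).trans (mul_le_of_le_one_right hC (decay_le_one n s))
  set q : ℝ × ℝ → E := fun p =>
    (2 * Complex.exp (-(p.2 * Complex.I))) • h (polarPoint z p) with hq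
  -- the integrand in polar coordinates
  set k : ℂ → E := fun s => (2 * s⁻¹) • h (z + s) with hk
  have hki : Integrable k := by
    have h1 := ((integrable_kernel hn hm hb z).comp_add_left z).smul (-2 : ℂ)
    refine h1.congr (ae_of_all _ fun s => ?_)
    simp only [hk, Pi.smul_apply]
    rw [smul_smul, sub_add_cancel_left, inv_neg]
    ring_nf
  have hqk : ∀ p ∈ polarCoord.target, p.1 • k (Complex.polarCoord.symm p) = q p := by
    rintro p ⟨hp, -⟩
    have hp' : (p.1 : ℂ) ≠ 0 := by exact_mod_cast (ne_of_gt hp)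
    rw [complexPolarCoord_symm_eq]
    simp only [hk, hq, polarPoint]
    rw [← Complex.coe_smul, smul_smul, mul_inv, Complex.exp_neg]
    congr 1
    field_simp
  have hqm : StronglyMeasurable q := (by fun_prop : Measurable fun p : ℝ × ℝ =>
        2 * Complex.exp (-(p.2 * Complex.I))).stronglyMeasurable.smul
        (hm.comp_measurable (continuous_polarPoint z).measurable)
  have htm : MeasurableSet polarCoord.target := polarCoord.open_target.measurableSet
  have hqi : IntegrableOn q polarCoord.target := by
    refine ⟨hqm.aestronglyMeasurable, ?_⟩
    have h1 := Complex.lintegral_comp_polarCoord_symm fun s => ‖k s‖ₑ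
    rw [hasFiniteIntegral_iff_enorm]
    refine lt_of_eq_of_lt ?_ (hasFiniteIntegral_iff_enorm.1 hki.2)
    rw [← h1]
    refine setLIntegral_congr_fun htm fun p hp => ?_
    rw [← hqk p hp, enorm_smul, smul_eq_mul]
    congr 1
    rw [Real.enorm_of_nonneg (le_of_lt hp.1)]
  have hqint : ∫ p in polarCoord.target, q p = ∫ s, k s := by
    rw [← Complex.integral_comp_polarCoord_symm]
    exact setIntegral_congr_fun htm fun p hp => (hqk p hp).symm
  have htgt : polarCoord.target = Ioi (0 : ℝ) ×ˢ Ioo (-Real.pi) Real.pi := rfl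
  rw [htgt, Measure.volume_eq_prod] at hqint hqi
  rw [setIntegral_prod _ hqi] at hqint
  have hji : IntegrableOn (fun r => ∫ θ in Ioo (-Real.pi) Real.pi, q (r, θ)) (Ioi 0) := by
    rw [IntegrableOn, ← Measure.prod_restrict] at hqi
    exact hqi.integral_prod_left
  have hIoo : ∀ r, ∫ θ in Ioo (-Real.pi) Real.pi, q (r, θ) =
      ∫ θ in (-Real.pi)..Real.pi, q (r, θ) := fun r => by
    rw [intervalIntegral.integral_of_le hpi, integral_Ioc_eq_integral_Ioo]
  simp only [hIoo] at hqint hji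
  set Φ : ℝ → E := fun r => ∫ θ in (-Real.pi)..Real.pi, H (polarPoint z (r, θ)) with hΦ
  have hΦc : Continuous Φ :=
    intervalIntegral.continuous_parametric_intervalIntegral_of_continuous'
      (f := fun r θ => H (polarPoint z (r, θ))) (hc.comp (continuous_polarPoint z)) _ _
  have hΦ0 : Φ 0 = (2 * Real.pi) • H z := by
    simp [hΦ, polarPoint, two_mul]
  have hΦi : Tendsto Φ atTop (𝓝 ((2 * Real.pi) • c)) := by
    rw [Metric.tendsto_nhds]
    intro ε hε
    have hδ : 0 < ε / (4 * Real.pi) := by positivity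
    have h1 := (Metric.tendsto_nhds.1 hlim) _ hδ
    rw [← comap_norm_atTop, eventually_comap, eventually_atTop] at h1
    obtain ⟨ρ, hρ⟩ := h1
    filter_upwards [eventually_ge_atTop (|ρ| + ‖z‖)] with r hr
    have hr0 : 0 ≤ r := le_trans (by positivity) hr
    have h2 : ∀ θ : ℝ, ‖H (polarPoint z (r, θ)) - c‖ ≤ ε / (4 * Real.pi) := by
      intro θ
      rw [← dist_eq_norm]
      refine (hρ _ ?_ _ rfl).le
      have h3 : ‖(r : ℂ) * Complex.exp (θ * Complex.I)‖ = r := by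
        rw [norm_mul, Complex.norm_exp_ofReal_mul_I, mul_one, Complex.norm_real,
          Real.norm_of_nonneg hr0]
      have h4 : (r : ℂ) * Complex.exp (θ * Complex.I) = polarPoint z (r, θ) - z := by
        simp [polarPoint]
      rw [h4] at h3
      have h5 := norm_sub_le (polarPoint z (r, θ)) z
      linarith [le_abs_self ρ]
    have hHc : Continuous fun θ : ℝ => H (polarPoint z (r, θ)) :=
      (hc.comp (continuous_polarPoint z)).comp (by fun_prop)
    have h6 : Φ r - (2 * Real.pi) • c =
        ∫ θ in (-Real.pi)..Real.pi, (H (polarPoint z (r, θ)) - c) := by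
      rw [intervalIntegral.integral_sub (hHc.intervalIntegrable _ _) (by simp)]
      simp [hΦ, two_mul]
    rw [dist_eq_norm, h6]
    refine (intervalIntegral.norm_integral_le_of_norm_le_const fun θ _ => h2 θ).trans_lt ?_
    rw [sub_neg_eq_add, abs_of_pos (by linarith [Real.pi_pos])]
    have : ε / (4 * Real.pi) * (Real.pi + Real.pi) = ε / 2 := by
      field_simp; ring
    linarith
  have hfinal := integral_Ioi_eq_sub_of_tendsto hji
    (fun a b ha hab => integral_polar_dbar (z := z) hc hd hm hb' ha hab)
    ((hΦc.tendsto 0).mono_left nhdsWithin_le_nhds) hΦi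
  rw [hqint, hΦ0] at hfinal
  have hkC : ∫ s, k s = -(2 * Real.pi : ℂ) • cauchyTransform h z := by
    rw [cauchyTransform, smul_smul,
      ← integral_add_left_eq_self (fun s => (z - s)⁻¹ • h s) z, ← integral_smul]
    refine integral_congr_ae (ae_of_all _ fun s => ?_)
    have : (Real.pi : ℂ) ≠ 0 := by exact_mod_cast Real.pi_ne_zero
    simp only [hk]
    rw [smul_smul, sub_add_cancel_left, inv_neg]
    congr 1
    field_simp
  have h7 : (2 * Real.pi) • (H z - (c + cauchyTransform h z)) = 0 := by
    rw [hkC, neg_smul, neg_eq_iff_eq_neg] at hfinal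
    have : (2 * Real.pi : ℂ) • cauchyTransform h z = (2 * Real.pi) • cauchyTransform h z := by
      rw [← Complex.coe_smul]; push_cast; rfl
    rw [this] at hfinal
    rw [smul_sub, smul_add, hfinal]
    abel
  rw [smul_eq_zero] at h7
  exact sub_eq_zero.1 (h7.resolve_left (by positivity))

end CauchyPompeiu

/-! ### Solutions of ∂F/∂z̄ = F R and their comparison -/

section DbarProblem

variable {𝔸 : Type*} [NormedRing 𝔸] [NormedAlgebra ℂ 𝔸]

lemma hasDbarAt_const (c : 𝔸) (z : ℂ) : HasDbarAt (fun _ => c) 0 z :=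
  ⟨0, hasFDerivAt_const c z, by simp⟩

lemma HasDbarAt.mul {A B : ℂ → 𝔸} {a b : 𝔸} {z : ℂ} (hA : HasDbarAt A a z)
    (hB : HasDbarAt B b z) : HasDbarAt (fun ζ => A ζ * B ζ) (a * B z + A z * b) z := by
  obtain ⟨L, hL, hLe⟩ := hA
  obtain ⟨M, hM, hMe⟩ := hB
  refine ⟨_, hL.mul' hM, ?_⟩
  have h1 : (2 : ℂ) • (a * B z + A z * b) = ((2 : ℂ) • a) * B z + A z * ((2 : ℂ) • b) := by
    rw [smul_add, smul_mul_assoc, mul_smul_comm]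
  rw [h1, ← hLe, ← hMe]
  simp [add_mul, mul_add]
  abel

lemma HasDbarAt.congr_of_eventuallyEq {E : Type*} [NormedAddCommGroup E] [NormedSpace ℂ E]
    {A B : ℂ → E} {a : E} {z : ℂ} (hA : HasDbarAt A a z) (h : B =ᶠ[𝓝 z] A) : HasDbarAt B a z := by
  obtain ⟨L, hL, hLe⟩ := hA
  exact ⟨L, hL.congr_of_eventuallyEq h, hLe⟩

lemma hasDbarAt_of_hasDerivAt {E : Type*} [NormedAddCommGroup E] [NormedSpace ℂ E]
    {A : ℂ → E} {a : E} {z : ℂ} (hA : HasDerivAt A a z) : HasDbarAt A 0 z := by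
  refine ⟨_, hA.hasFDerivAt.restrictScalars ℝ, ?_⟩
  simp [smul_smul]

lemma norm_mul_mul_le {𝔸 : Type*} [NormedRing 𝔸] {a r b : 𝔸} {α ρ β : ℝ}
    (ha : ‖a‖ ≤ α) (hr : ‖r‖ ≤ ρ) (hb : ‖b‖ ≤ β) :
    ‖a * r * b‖ ≤ α * ρ * β := by
  have h0 : 0 ≤ α := (norm_nonneg _).trans ha
  have h1 : 0 ≤ ρ := (norm_nonneg _).trans hr
  exact (norm_mul_le _ _).trans (mul_le_mul ((norm_mul_le _ _).trans
    (mul_le_mul ha hr (norm_nonneg _) h0)) hb (norm_nonneg _) (mul_nonneg h0 h1))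

/-- `F` solves `∂F/∂z̄ = F R` off the origin and is normalised at infinity; `G` is its inverse. -/
structure IsDbarSolution (R F G : ℂ → 𝔸) : Prop where
  continuous : Continuous F
  continuous_inv : Continuous G
  mul_inv : ∀ ζ, F ζ * G ζ = 1
  inv_mul : ∀ ζ, G ζ * F ζ = 1
  tendsto : Tendsto F (Bornology.cobounded ℂ) (𝓝 1)
  dbar : ∀ ζ, ζ ≠ 0 → HasDbarAt F (F ζ * R ζ) ζ

/-- `F = 1 + y / ζ + o(1 / ζ)` as `ζ → ∞`. -/
def HasLeadingCoeff (F : ℂ → 𝔸) (y : 𝔸) : Prop :=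
  Tendsto (fun ζ => ζ • (F ζ - 1)) (Bornology.cobounded ℂ) (𝓝 y)

lemma exists_bound_of_tendsto_cobounded {E : Type*} [SeminormedAddCommGroup E] {F : ℂ → E} {c : E}
    (hF : Continuous F) (hl : Tendsto F (Bornology.cobounded ℂ) (𝓝 c)) :
    ∃ B : ℝ, 0 < B ∧ ∀ ζ, ‖F ζ‖ ≤ B := by
  have h1 : ∀ᶠ ζ in Bornology.cobounded ℂ, ‖F ζ‖ < ‖c‖ + 1 :=
    hl.norm.eventually (gt_mem_nhds (by linarith))
  rw [Metric.cobounded_eq_cocompact] at h1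
  obtain ⟨K, hK, hKs⟩ := mem_cocompact.1 h1
  obtain ⟨B, hB⟩ := hK.exists_bound_of_continuousOn hF.continuousOn
  refine ⟨max (max B (‖c‖ + 1)) 1, by positivity, fun ζ => ?_⟩
  by_cases hζ : ζ ∈ K
  · exact (hB ζ hζ).trans (le_max_of_le_left (le_max_left _ _))
  · exact (le_of_lt (hKs hζ)).trans (le_max_of_le_left (le_max_right _ _))

namespace IsDbarSolution

variable {R F G R₁ F₁ G₁ : ℂ → 𝔸} {C C₁ : ℝ}

lemma inv_eq (S : IsDbarSolution R F G) : G = fun ζ => Ring.inverse (F ζ) := by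
  ext ζ
  exact (Ring.inverse_unit ⟨F ζ, G ζ, S.mul_inv ζ, S.inv_mul ζ⟩).symm

lemma tendsto_inv [CompleteSpace 𝔸] (S : IsDbarSolution R F G) :
    Tendsto G (Bornology.cobounded ℂ) (𝓝 1) := by
  have h := (NormedRing.inverse_continuousAt (1 : 𝔸ˣ)).tendsto
  rw [Units.val_one, Ring.inverse_one] at h
  rw [S.inv_eq]
  exact h.comp S.tendsto

lemma dbar_inv [CompleteSpace 𝔸] (S : IsDbarSolution R F G) {ζ : ℂ} (hζ : ζ ≠ 0) :
    HasDbarAt G (-(R ζ * G ζ)) ζ := by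
  obtain ⟨L, hL, hLe⟩ := S.dbar ζ hζ
  have h1 := hasFDerivAt_ringInverse (𝕜 := ℝ)
    (⟨F ζ, G ζ, S.mul_inv ζ, S.inv_mul ζ⟩ : 𝔸ˣ)
  have h2 := HasFDerivAt.comp ζ (f := F) h1 hL
  rw [S.inv_eq]
  refine ⟨_, h2, ?_⟩
  have h3 : Ring.inverse (F ζ) = G ζ := congrFun S.inv_eq.symm ζ
  simp only [h3, ContinuousLinearMap.comp_apply, neg_apply,
    ContinuousLinearMap.mulLeftRight_apply, Units.inv_mk]
  calc _ = -(G ζ * (L 1 + Complex.I • L Complex.I) * G ζ) := by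
        simp [mul_add, add_mul]; abel
    _ = -((2 : ℂ) • ((G ζ * F ζ) * R ζ * G ζ)) := by
        rw [hLe]; simp [mul_assoc]
    _ = _ := by rw [S.inv_mul, one_mul, smul_neg]

lemma one : IsDbarSolution (fun _ => 0) (fun _ => (1 : 𝔸)) fun _ => 1 where
  continuous := continuous_const
  continuous_inv := continuous_const
  mul_inv _ := mul_one 1
  inv_mul _ := mul_one 1
  tendsto := tendsto_const_nhds
  dbar ζ _ := by simpa using hasDbarAt_const (1 : 𝔸) ζ

lemma exists_bound [CompleteSpace 𝔸] (S : IsDbarSolution R F G) :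
    ∃ B : ℝ, 0 < B ∧ (∀ ζ, ‖F ζ‖ ≤ B) ∧ ∀ ζ, ‖G ζ‖ ≤ B := by
  obtain ⟨B, hB, h⟩ := exists_bound_of_tendsto_cobounded S.continuous S.tendsto
  obtain ⟨B', hB', h'⟩ := exists_bound_of_tendsto_cobounded S.continuous_inv S.tendsto_inv
  exact ⟨max B B', by positivity, fun ζ => (h ζ).trans (le_max_left _ _),
    fun ζ => (h' ζ).trans (le_max_right _ _)⟩

lemma stronglyMeasurable_mul_mul (S : IsDbarSolution R F G) (S₁ : IsDbarSolution R₁ F₁ G₁)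
    {h : ℂ → 𝔸} (hh : StronglyMeasurable h) :
    StronglyMeasurable fun s => F₁ s * h s * G s :=
  (S₁.continuous.stronglyMeasurable.mul hh).mul S.continuous_inv.stronglyMeasurable

/-- Conjugates of constants: `F₁ c G` for two solutions `F₁`, `F = G⁻¹`. -/
lemma mul_mul_eq_add [CompleteSpace 𝔸] (S : IsDbarSolution R F G) (S₁ : IsDbarSolution R₁ F₁ G₁)
    (hR : StronglyMeasurable R) (hR₁ : StronglyMeasurable R₁)
    (hb : ∀ s, ‖R s‖ ≤ C * decay 5 s) (hb₁ : ∀ s, ‖R₁ s‖ ≤ C₁ * decay 5 s) (c : 𝔸) :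
    (∀ ζ, F₁ ζ * c * G ζ = c + cauchyTransform (fun s => F₁ s * (R₁ s * c - c * R s) * G s) ζ) ∧
      Tendsto (fun ζ => ζ • (F₁ ζ * c * G ζ - c)) (Bornology.cobounded ℂ)
        (𝓝 (planarMean fun s => F₁ s * (R₁ s * c - c * R s) * G s)) := by
  obtain ⟨B, hB0, -, hB⟩ := S.exists_bound
  obtain ⟨B₁, hB₁0, hB₁, -⟩ := S₁.exists_bound
  have hC : 0 ≤ C := nonneg_of_mul_nonneg_left ((norm_nonneg _).trans (hb 0)) (decay_pos 5 0)
  have hC₁ : 0 ≤ C₁ := nonneg_of_mul_nonneg_left ((norm_nonneg _).trans (hb₁ 0)) (decay_pos 5 0)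
  set h : ℂ → 𝔸 := fun s => F₁ s * (R₁ s * c - c * R s) * G s
  have hm : StronglyMeasurable h := stronglyMeasurable_mul_mul S S₁
    ((hR₁.mul stronglyMeasurable_const).sub (stronglyMeasurable_const.mul hR))
  set D := B₁ * ((C₁ + C) * ‖c‖) * B
  have hD : 0 ≤ D := by positivity
  have hbd : ∀ s, ‖h s‖ ≤ D * decay 5 s := by
    intro s
    have h1 : ‖R₁ s * c - c * R s‖ ≤ (C₁ + C) * ‖c‖ * decay 5 s := by
      refine (norm_sub_le _ _).trans ?_
      have h2 := norm_mul_le (R₁ s) c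
      have h3 := norm_mul_le c (R s)
      have h4 := mul_le_mul_of_nonneg_right (hb₁ s) (norm_nonneg c)
      have h5 := mul_le_mul_of_nonneg_left (hb s) (norm_nonneg c)
      linarith
    refine (norm_mul_mul_le (hB₁ s) h1 (hB s)).trans (le_of_eq ?_)
    simp only [D]
    ring
  have hlim : Tendsto (fun ζ => F₁ ζ * c * G ζ) (Bornology.cobounded ℂ) (𝓝 c) := by
    simpa using (S₁.tendsto.mul_const c).mul S.tendsto_inv
  -- The Leibniz rule with ∂F₁/∂z̄ = F₁ R₁ and ∂G/∂z̄ = -R G. The limit at infinity is c, so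
  -- Cauchy–Pompeiu applies.
  have hdb : ∀ s, s ≠ 0 → HasDbarAt (fun ζ => F₁ ζ * c * G ζ) (h s) s := by
    intro s hs
    have h1 := ((S₁.dbar s hs).mul (hasDbarAt_const c s)).mul (S.dbar_inv hs)
    convert h1 using 1
    simp only [h]
    noncomm_ring
  have heq : ∀ ζ, F₁ ζ * c * G ζ = c + cauchyTransform h ζ :=
    eq_add_cauchyTransform (by norm_num) ((S₁.continuous.mul continuous_const).mul
      S.continuous_inv) hlim hdb hm hD hbd
  refine ⟨heq, ?_⟩
  simp_rw [heq, add_sub_cancel_left]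
  exact tendsto_smul_cauchyTransform hm hbd hD

lemma exists_hasLeadingCoeff [CompleteSpace 𝔸] (S : IsDbarSolution R F G)
    (hR : StronglyMeasurable R) (hb : ∀ s, ‖R s‖ ≤ C * decay 5 s) : ∃ y, HasLeadingCoeff F y := by
  have h := (mul_mul_eq_add one S stronglyMeasurable_const hR (C := 0) (by simp) hb 1).2
  refine ⟨_, h.congr fun ζ => ?_⟩
  simp

/-- The case c = 1 of `mul_mul_eq_add`, multiplied on the right by F. It plays the role of a
resolvent identity: the difference of two solutions is controlled by the difference of their
coefficients, with no smallness of R. -/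
lemma sub_eq_cauchyTransform_mul [CompleteSpace 𝔸] (S : IsDbarSolution R F G)
    (S₁ : IsDbarSolution R₁ F₁ G₁)
    (hR : StronglyMeasurable R) (hR₁ : StronglyMeasurable R₁)
    (hb : ∀ s, ‖R s‖ ≤ C * decay 5 s) (hb₁ : ∀ s, ‖R₁ s‖ ≤ C₁ * decay 5 s) (ζ : ℂ) :
    F₁ ζ - F ζ = cauchyTransform (fun s => F₁ s * (R₁ s - R s) * G s) ζ * F ζ := by
  have h := (mul_mul_eq_add S S₁ hR hR₁ hb hb₁ 1).1 ζ
  simp only [mul_one, one_mul] at h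
  rw [← sub_eq_iff_eq_add'] at h
  rw [← h, sub_mul, mul_assoc, S.inv_mul, mul_one, one_mul]

lemma leadingCoeff_sub [CompleteSpace 𝔸] (S : IsDbarSolution R F G)
    (S₁ : IsDbarSolution R₁ F₁ G₁)
    (hR : StronglyMeasurable R) (hR₁ : StronglyMeasurable R₁)
    (hb : ∀ s, ‖R s‖ ≤ C * decay 5 s) (hb₁ : ∀ s, ‖R₁ s‖ ≤ C₁ * decay 5 s)
    {y y₁ : 𝔸} (hy : HasLeadingCoeff F y) (hy₁ : HasLeadingCoeff F₁ y₁) :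
    y₁ - y = planarMean (fun s => F₁ s * (R₁ s - R s) * G s) := by
  have h := (mul_mul_eq_add S S₁ hR hR₁ hb hb₁ 1).2
  simp only [mul_one, one_mul] at h
  refine tendsto_nhds_unique ?_ h
  have h2 := (hy₁.sub hy).mul S.tendsto_inv
  rw [mul_one] at h2
  refine h2.congr fun ζ => ?_
  rw [← smul_sub, smul_mul_assoc, sub_sub_sub_cancel_right, sub_mul, S.mul_inv]

/-- At infinity F d F⁻¹ = d + [y, d]/ζ + o(1/ζ), and `mul_mul_eq_add` gives the same coefficient of
1/ζ as a planar mean. -/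
lemma planarMean_commutator [CompleteSpace 𝔸] (S : IsDbarSolution R F G)
    (hR : StronglyMeasurable R) (hb : ∀ s, ‖R s‖ ≤ C * decay 5 s)
    {y : 𝔸} (hy : HasLeadingCoeff F y) (d : 𝔸) :
    planarMean (fun s => F s * (R s * d - d * R s) * G s) = y * d - d * y := by
  refine tendsto_nhds_unique (mul_mul_eq_add S S hR hR hb hb d).2 ?_
  have h2 := ((hy.mul_const d).sub (hy.const_mul d)).mul S.tendsto_inv
  rw [mul_one] at h2
  refine h2.congr fun ζ => ?_
  rw [smul_mul_assoc, mul_smul_comm, ← smul_sub, smul_mul_assoc]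
  congr 1
  have := S.mul_inv ζ
  calc ((F ζ - 1) * d - d * (F ζ - 1)) * G ζ = F ζ * d * G ζ - d * (F ζ * G ζ) := by noncomm_ring
    _ = _ := by rw [this, mul_one]

end IsDbarSolution

end DbarProblem

/-! ### Differentiability of solutions in a parameter -/

section Family

variable {𝔸 : Type*} [NormedRing 𝔸] [NormedAlgebra ℂ 𝔸]

lemma hasDerivAt_of_norm_sub_le_sq {E : Type*} [NormedAddCommGroup E] [NormedSpace ℝ E]
    {f : ℝ → E} {f' : E} {τ₀ K : ℝ}
    (h : ∀ᶠ τ in 𝓝 τ₀, ‖f τ - f τ₀ - (τ - τ₀) • f'‖ ≤ K * (τ - τ₀) ^ 2) : HasDerivAt f f' τ₀ := by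
  rw [hasDerivAt_iff_isLittleO]
  have h1 : (fun τ => f τ - f τ₀ - (τ - τ₀) • f') =O[𝓝 τ₀] fun τ => (τ - τ₀) ^ 2 :=
    Asymptotics.IsBigO.of_bound K (h.mono fun τ hτ => by
      rwa [Real.norm_of_nonneg (sq_nonneg (τ - τ₀))])
  refine h1.trans_isLittleO ?_
  have h2 := Asymptotics.isLittleO_pow_sub_sub τ₀ (m := 2) (by norm_num)
  simpa only [Real.norm_eq_abs, sq_abs] using h2

/-- A differentiable family of `∂̄`-problems: the coefficients `R τ` are differentiable at `τ₀`,
with derivative `R'`, in the weighted sup norm, and are solved by `F τ` for `τ` near `τ₀`. -/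
structure DbarFamily (τ₀ : ℝ) (R F G : ℝ → ℂ → 𝔸) (R' : ℂ → 𝔸) (K : ℝ) : Prop where
  measurable : ∀ τ, StronglyMeasurable (R τ)
  measurable' : StronglyMeasurable R'
  bound : ∀ s, ‖R τ₀ s‖ ≤ K * decay 5 s
  bound' : ∀ s, ‖R' s‖ ≤ K * decay 5 s
  differentiable : ∀ᶠ τ in 𝓝 τ₀, ∀ s,
    ‖R τ s - R τ₀ s - (τ - τ₀) • R' s‖ ≤ K * (τ - τ₀) ^ 2 * decay 5 s
  solution : ∀ᶠ τ in 𝓝 τ₀, IsDbarSolution (R τ) (F τ) (G τ)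

namespace DbarFamily

variable {τ₀ K : ℝ} {R F G : ℝ → ℂ → 𝔸} {R' : ℂ → 𝔸}

lemma nonneg (D : DbarFamily τ₀ R F G R' K) : 0 ≤ K :=
  nonneg_of_mul_nonneg_left ((norm_nonneg _).trans (D.bound 0)) (decay_pos 5 0)

lemma measurable_conj (D : DbarFamily τ₀ R F G R' K) :
    StronglyMeasurable fun s => F τ₀ s * R' s * G τ₀ s :=
  IsDbarSolution.stronglyMeasurable_mul_mul D.solution.self_of_nhds D.solution.self_of_nhds
    D.measurable'

lemma norm_sub_le (D : DbarFamily τ₀ R F G R' K) : ∀ᶠ τ in 𝓝 τ₀, ∀ s,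
    ‖R τ s - R τ₀ s‖ ≤ 2 * K * |τ - τ₀| * decay 5 s := by
  have hK := D.nonneg
  filter_upwards [D.differentiable, Metric.ball_mem_nhds τ₀ one_pos] with τ hτ hτ1 s
  rw [Metric.mem_ball, Real.dist_eq] at hτ1
  have h1 : ‖(τ - τ₀) • R' s‖ ≤ |τ - τ₀| * (K * decay 5 s) := by
    rw [norm_smul, Real.norm_eq_abs]
    exact mul_le_mul_of_nonneg_left (D.bound' s) (abs_nonneg _)
  have h2 : (τ - τ₀) ^ 2 ≤ |τ - τ₀| := by
    rw [← sq_abs]; nlinarith [abs_nonneg (τ - τ₀)]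
  have h3 : K * (τ - τ₀) ^ 2 * decay 5 s ≤ K * |τ - τ₀| * decay 5 s := by
    gcongr; exact (decay_pos 5 s).le
  have h4 := norm_add_le (R τ s - R τ₀ s - (τ - τ₀) • R' s) ((τ - τ₀) • R' s)
  rw [sub_add_cancel] at h4
  linarith [hτ s]

lemma bound_eventually (D : DbarFamily τ₀ R F G R' K) : ∀ᶠ τ in 𝓝 τ₀, ∀ s,
    ‖R τ s‖ ≤ 3 * K * decay 5 s := by
  have hK := D.nonneg
  filter_upwards [D.norm_sub_le, Metric.ball_mem_nhds τ₀ one_pos] with τ hτ hτ1 s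
  rw [Metric.mem_ball, Real.dist_eq] at hτ1
  have h4 := norm_add_le (R τ s - R τ₀ s) (R τ₀ s)
  rw [sub_add_cancel] at h4
  have h3 : 2 * K * |τ - τ₀| * decay 5 s ≤ 2 * K * 1 * decay 5 s := by
    gcongr; exact (decay_pos 5 s).le
  linarith [hτ s, D.bound s]

variable [CompleteSpace 𝔸]

/-- The coefficient of the relative problem `F τ (F τ₀)⁻¹` is differentiable at `τ₀`. -/
lemma exists_quadratic_bound (D : DbarFamily τ₀ R F G R' K) : ∃ K₁ : ℝ, 0 ≤ K₁ ∧
    ∀ᶠ τ in 𝓝 τ₀, ∀ s, ‖F τ s * (R τ s - R τ₀ s) * G τ₀ s -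
      (τ - τ₀) • (F τ₀ s * R' s * G τ₀ s)‖ ≤ K₁ * (τ - τ₀) ^ 2 * decay 5 s := by
  have hK := D.nonneg
  have S := D.solution.self_of_nhds
  obtain ⟨B, hB0, hBF, hBG⟩ := S.exists_bound
  obtain ⟨A, hA0, hA⟩ := exists_norm_cauchyTransform_le 𝔸 (n := 5) (by norm_num)
  -- The summand 1 only keeps `θ` positive, so that one may divide by it.
  set θ : ℝ := 2 * K * A * B * B + 1 with hθ
  have hθ1 : 0 < θ := by positivity
  have hsmall : ∀ᶠ τ in 𝓝 τ₀, θ * |τ - τ₀| ≤ 1 / 2 := by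
    filter_upwards [Metric.ball_mem_nhds τ₀ (show 0 < 1 / (2 * θ) by positivity)] with τ hτ
    rw [Metric.mem_ball, Real.dist_eq, lt_div_iff₀ (by positivity)] at hτ
    linarith
  refine ⟨2 * B * θ * (2 * K) * B + B * K * B, by positivity, ?_⟩
  filter_upwards [D.differentiable, D.norm_sub_le, D.bound_eventually, D.solution, hsmall]
    with τ hτ hsub hbd Sτ hsm s
  have hstep : ∀ b : ℝ, (∀ ζ, ‖F τ ζ‖ ≤ b) → ∀ ζ, ‖F τ ζ - F τ₀ ζ‖ ≤ θ * |τ - τ₀| * b := by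
    intro b hb ζ
    have hb0 : 0 ≤ b := (norm_nonneg _).trans (hb 0)
    rw [S.sub_eq_cauchyTransform_mul Sτ (D.measurable _) (D.measurable _) D.bound hbd ζ]
    have h1 := hA (fun s => F τ s * (R τ s - R τ₀ s) * G τ₀ s) (b * (2 * K * |τ - τ₀|) * B)
      (by positivity) (fun s => (norm_mul_mul_le (hb s) (hsub s) (hBG s)).trans
        (le_of_eq (by ring))) ζ
    calc _ ≤ (A * (b * (2 * K * |τ - τ₀|) * B)) * B :=
          (norm_mul_le _ _).trans (mul_le_mul h1 (hBF ζ) (norm_nonneg _) (by positivity))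
      _ = (2 * K * A * B * B) * |τ - τ₀| * b := by ring
      _ ≤ θ * |τ - τ₀| * b := by gcongr; linarith
  -- A bound uniform in `τ`: each solution has a finite supremum b, and `hstep` gives b ≤ B + b/2,
  -- so the last term can be absorbed.
  have hF2 : ∀ ζ, ‖F τ ζ‖ ≤ 2 * B := by
    obtain ⟨b₀, -, hb₀, -⟩ := Sτ.exists_bound
    have hbdd : BddAbove (range fun ζ => ‖F τ ζ‖) := ⟨b₀, by rintro _ ⟨ζ, rfl⟩; exact hb₀ ζ⟩
    set b := ⨆ ζ, ‖F τ ζ‖ with hbdef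
    have hle : ∀ ζ, ‖F τ ζ‖ ≤ b := fun ζ => le_ciSup hbdd ζ
    have hb0 : 0 ≤ b := (norm_nonneg _).trans (hle 0)
    have h2 : b ≤ B + 1 / 2 * b := by
      refine ciSup_le fun ζ => ?_
      have h3 := hstep b hle ζ
      have h4 : θ * |τ - τ₀| * b ≤ 1 / 2 * b := by gcongr
      have h5 := norm_add_le (F τ ζ - F τ₀ ζ) (F τ₀ ζ)
      rw [sub_add_cancel] at h5
      linarith [hBF ζ]
    intro ζ
    linarith [hle ζ]
  -- In the first summand both differences are O(|τ - τ₀|); in the second the middle factor is the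
  -- Taylor remainder of the coefficient. Both are quadratic.
  have e : F τ s * (R τ s - R τ₀ s) * G τ₀ s - (τ - τ₀) • (F τ₀ s * R' s * G τ₀ s) =
      (F τ s - F τ₀ s) * (R τ s - R τ₀ s) * G τ₀ s +
        F τ₀ s * (R τ s - R τ₀ s - (τ - τ₀) • R' s) * G τ₀ s := by
    rw [mul_sub (F τ₀ s) _ ((τ - τ₀) • R' s), mul_smul_comm, sub_mul (_ * _) _ (G τ₀ s),
      smul_mul_assoc]
    noncomm_ring
  rw [e]
  have h1 := norm_mul_mul_le (hstep _ hF2 s) (hsub s) (hBG s)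
  have h2 := norm_mul_mul_le (hBF s) (hτ s) (hBG s)
  refine ((norm_add_le _ _).trans (add_le_add h1 h2)).trans (le_of_eq ?_)
  rw [← sq_abs (τ - τ₀)]
  ring

lemma exists_bound_deriv (D : DbarFamily τ₀ R F G R' K) : ∃ K₁ : ℝ, 0 ≤ K₁ ∧
    (∀ s, ‖F τ₀ s * R' s * G τ₀ s‖ ≤ K₁ * decay 5 s) ∧
    ∀ᶠ τ in 𝓝 τ₀, ∀ s, ‖F τ s * (R τ s - R τ₀ s) * G τ₀ s‖ ≤ K₁ * decay 5 s := by
  have hK := D.nonneg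
  obtain ⟨K₁, hK₁, h⟩ := D.exists_quadratic_bound
  obtain ⟨B, hB0, hBF, hBG⟩ := D.solution.self_of_nhds.exists_bound
  have h1 : ∀ s, ‖F τ₀ s * R' s * G τ₀ s‖ ≤ B * K * B * decay 5 s := fun s =>
    (norm_mul_mul_le (hBF s) (D.bound' s) (hBG s)).trans (le_of_eq (by ring))
  refine ⟨K₁ + B * K * B, by positivity, fun s => (h1 s).trans ?_, ?_⟩
  · have := decay_pos 5 s
    gcongr
    linarith
  filter_upwards [h, Metric.ball_mem_nhds τ₀ one_pos] with τ hτ hτ1 s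
  rw [Metric.mem_ball, Real.dist_eq] at hτ1
  have hd := decay_pos 5 s
  have h2 : K₁ * (τ - τ₀) ^ 2 * decay 5 s ≤ K₁ * 1 * decay 5 s := by
    rw [← sq_abs]
    gcongr
    exact pow_le_one₀ (abs_nonneg _) hτ1.le
  have h3 : ‖(τ - τ₀) • (F τ₀ s * R' s * G τ₀ s)‖ ≤ 1 * (B * K * B * decay 5 s) := by
    rw [norm_smul, Real.norm_eq_abs]
    exact mul_le_mul hτ1.le (h1 s) (norm_nonneg _) zero_le_one
  have h4 := norm_add_le (F τ s * (R τ s - R τ₀ s) * G τ₀ s -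
    (τ - τ₀) • (F τ₀ s * R' s * G τ₀ s)) ((τ - τ₀) • (F τ₀ s * R' s * G τ₀ s))
  rw [sub_add_cancel] at h4
  linarith [hτ s]

/-- The solutions are differentiable in the parameter. -/
theorem hasDerivAt_apply (D : DbarFamily τ₀ R F G R' K) (ζ : ℂ) :
    HasDerivAt (fun τ => F τ ζ)
      (cauchyTransform (fun s => F τ₀ s * R' s * G τ₀ s) ζ * F τ₀ ζ) τ₀ := by
  have hK := D.nonneg
  have S := D.solution.self_of_nhds
  obtain ⟨A, hA0, hA⟩ := exists_norm_cauchyTransform_le 𝔸 (n := 5) (by norm_num)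
  obtain ⟨K₁, hK₁, hq⟩ := D.exists_quadratic_bound
  obtain ⟨K₂, hK₂, hb, hb'⟩ := D.exists_bound_deriv
  refine hasDerivAt_of_norm_sub_le_sq (K := A * K₁ * ‖F τ₀ ζ‖) ?_
  filter_upwards [hq, hb', D.solution, D.bound_eventually] with τ hτ hbτ Sτ hbd
  rw [S.sub_eq_cauchyTransform_mul Sτ (D.measurable _) (D.measurable _) D.bound hbd ζ,
    ← smul_mul_assoc, ← sub_mul]
  have hm : StronglyMeasurable fun s => F τ s * (R τ s - R τ₀ s) * G τ₀ s :=
    IsDbarSolution.stronglyMeasurable_mul_mul S Sτ ((D.measurable τ).sub (D.measurable τ₀))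
  have e : cauchyTransform (fun s => F τ s * (R τ s - R τ₀ s) * G τ₀ s) ζ -
      (τ - τ₀) • cauchyTransform (fun s => F τ₀ s * R' s * G τ₀ s) ζ =
      cauchyTransform (fun s => F τ s * (R τ s - R τ₀ s) * G τ₀ s -
        (τ - τ₀) • (F τ₀ s * R' s * G τ₀ s)) ζ := by
    simp only [cauchyTransform, smul_sub]
    rw [integral_sub (integrable_kernel (by norm_num) hm hbτ ζ), smul_sub]
    · congr 1
      rw [smul_comm, ← integral_smul]
      congr 2
      ext s
      rw [smul_comm]
    · simp_rw [fun s : ℂ => smul_comm (ζ - s)⁻¹ (τ - τ₀) (F τ₀ s * R' s * G τ₀ s)]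
      exact (integrable_kernel (by norm_num) D.measurable_conj hb ζ).smul _
  rw [e]
  have h1 := hA _ (K₁ * (τ - τ₀) ^ 2) (by positivity) hτ ζ
  calc _ ≤ (A * (K₁ * (τ - τ₀) ^ 2)) * ‖F τ₀ ζ‖ :=
        (norm_mul_le _ _).trans (mul_le_mul_of_nonneg_right h1 (norm_nonneg _))
    _ = _ := by ring

/-- The leading coefficient at infinity is differentiable in the parameter. -/
theorem hasDerivAt_leadingCoeff (D : DbarFamily τ₀ R F G R' K) {y : ℝ → 𝔸}
    (hy : ∀ᶠ τ in 𝓝 τ₀, HasLeadingCoeff (F τ) (y τ)) :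
    HasDerivAt y (planarMean fun s => F τ₀ s * R' s * G τ₀ s) τ₀ := by
  have hK := D.nonneg
  have S := D.solution.self_of_nhds
  obtain ⟨K₁, hK₁, hq⟩ := D.exists_quadratic_bound
  obtain ⟨K₂, hK₂, hb, hb'⟩ := D.exists_bound_deriv
  refine hasDerivAt_of_norm_sub_le_sq
    (K := ‖(Real.pi : ℂ)⁻¹‖ * (K₁ * ∫ s, decay 5 s)) ?_
  filter_upwards [hq, hb', D.solution, D.bound_eventually, hy] with τ hτ hbτ Sτ hbd hyτ
  rw [S.leadingCoeff_sub Sτ (D.measurable _) (D.measurable _) D.bound hbd hy.self_of_nhds hyτ]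
  have hm : StronglyMeasurable fun s => F τ s * (R τ s - R τ₀ s) * G τ₀ s :=
    IsDbarSolution.stronglyMeasurable_mul_mul S Sτ ((D.measurable τ).sub (D.measurable τ₀))
  have e : planarMean (fun s => F τ s * (R τ s - R τ₀ s) * G τ₀ s) -
      (τ - τ₀) • planarMean (fun s => F τ₀ s * R' s * G τ₀ s) =
      planarMean (fun s => F τ s * (R τ s - R τ₀ s) * G τ₀ s -
        (τ - τ₀) • (F τ₀ s * R' s * G τ₀ s)) := by
    simp only [planarMean]
    have hi : Integrable fun s => (τ - τ₀) • (F τ₀ s * R' s * G τ₀ s) :=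
      (integrable_of_decay (by norm_num) D.measurable_conj hb).smul (τ - τ₀)
    rw [integral_sub (integrable_of_decay (by norm_num) hm hbτ) hi, smul_sub, integral_smul,
      smul_comm]
  rw [e, planarMean, norm_smul, mul_assoc]
  gcongr
  calc _ ≤ ∫ s, K₁ * (τ - τ₀) ^ 2 * decay 5 s :=
        norm_integral_le_of_norm_le ((integrable_decay (by norm_num)).const_mul _)
          (ae_of_all _ hτ)
    _ = _ := by rw [integral_const_mul]; ring

/-- Deformation in the direction `s [d, R]`. -/
theorem hasDerivAt_apply_zero {d : 𝔸}
    (D : DbarFamily τ₀ R F G (fun s => s • (d * R τ₀ s - R τ₀ s * d)) K) {y : 𝔸}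
    (hy : HasLeadingCoeff (F τ₀) y) :
    HasDerivAt (fun τ => F τ 0) ((y * d - d * y) * F τ₀ 0) τ₀ := by
  have S := D.solution.self_of_nhds
  convert D.hasDerivAt_apply 0 using 2
  rw [← S.planarMean_commutator (D.measurable _) D.bound hy d]
  -- The factor s cancels the kernel at 0 and leaves the planar mean of F [R, d] F⁻¹, which is [y,
  -- d].
  have h := cauchyTransform_smul_zero
    fun s => F τ₀ s * (d * R τ₀ s - R τ₀ s * d) * G τ₀ s
  simp only [mul_smul_comm, smul_mul_assoc]
  rw [h, planarMean, planarMean, ← smul_neg, ← integral_neg]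
  congr 2
  ext s
  noncomm_ring

/-- Deformation in the direction `s⁻¹ [J, R]`. -/
theorem hasDerivAt_leadingCoeff' {J : 𝔸}
    (D : DbarFamily τ₀ R F G (fun s => s⁻¹ • (J * R τ₀ s - R τ₀ s * J)) K) {y : ℝ → 𝔸}
    (hy : ∀ᶠ τ in 𝓝 τ₀, HasLeadingCoeff (F τ) (y τ)) :
    HasDerivAt y (F τ₀ 0 * J * G τ₀ 0 - J) τ₀ := by
  have S := D.solution.self_of_nhds
  convert D.hasDerivAt_leadingCoeff hy using 1
  -- The planar mean of s⁻¹ F [J, R] F⁻¹ is a Cauchy transform evaluated at 0, namely the one that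
  -- represents F J F⁻¹ - J.
  rw [(S.mul_mul_eq_add S (D.measurable _) (D.measurable _) D.bound D.bound J).1 0,
    add_sub_cancel_left, cauchyTransform_zero, planarMean, planarMean, ← smul_neg, ← integral_neg]
  congr 2
  ext s
  rw [mul_smul_comm, smul_mul_assoc, ← smul_neg]
  congr 1
  noncomm_ring

end DbarFamily

end Family

/-! ### Sectors, rays and gluing -/

section Sectors

/-- The unit vector on the ray of index `m`. -/
def rayDir (m : ℤ) : ℂ := Complex.exp ((((m : ℝ) / 4 - 1) * Real.pi : ℝ) * Complex.I)

/-- The closed cone `0 ≤ arg v ≤ π / 4` without its vertex. -/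
def cone : Set ℂ := {v | 0 < v.re ∧ 0 ≤ v.im ∧ v.im ≤ v.re}

lemma rayDir_ne_zero (m : ℤ) : rayDir m ≠ 0 := Complex.exp_ne_zero _

lemma norm_rayDir (m : ℤ) : ‖rayDir m‖ = 1 := Complex.norm_exp_ofReal_mul_I _

lemma norm_div_rayDir (m : ℤ) (ζ : ℂ) : ‖ζ / rayDir m‖ = ‖ζ‖ := by
  rw [norm_div, norm_rayDir, div_one]

lemma rayDir_add_eight_mul (m n : ℤ) : rayDir (m + 8 * n) = rayDir m := by
  unfold rayDir
  rw [Complex.exp_eq_exp_iff_exists_int]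
  refine ⟨n, ?_⟩
  push_cast
  ring

lemma exp_pi_div_four_mul_I : Complex.exp (((Real.pi / 4 : ℝ) : ℂ) * Complex.I) =
    (Real.sqrt 2 / 2 : ℝ) * (1 + Complex.I) := by
  rw [Complex.exp_mul_I, ← Complex.ofReal_cos, ← Complex.ofReal_sin, Real.cos_pi_div_four,
    Real.sin_pi_div_four]
  ring

lemma rayDir_succ (m : ℤ) :
    rayDir (m + 1) = rayDir m * ((Real.sqrt 2 / 2 : ℝ) * (1 + Complex.I)) := by
  rw [← exp_pi_div_four_mul_I, rayDir, rayDir, ← Complex.exp_add]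
  congr 1
  push_cast
  ring

lemma rayDir_add_two (m : ℤ) : rayDir (m + 2) = rayDir m * Complex.I := by
  rw [← Complex.exp_pi_div_two_mul_I, rayDir, rayDir, ← Complex.exp_add]
  congr 1
  push_cast
  ring

lemma rayDir_four : rayDir 4 = 1 := by simp [rayDir]

/-- Rotating by `rayDir m` turns every sector into the same cone, described by linear inequalities,
so that arguments modulo 2π need not be handled again. -/
lemma mem_sector_iff (m : ℤ) (ζ : ℂ) : ζ ∈ sector m ↔ ζ / rayDir m ∈ cone := by
  constructor
  · rintro ⟨r, θ, hr, h1, h2, rfl⟩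
    set φ : ℝ := θ - ((m : ℝ) / 4 - 1) * Real.pi with hφ
    have h0 : 0 ≤ φ := by linarith
    have h4 : φ ≤ Real.pi / 4 := by
      have : ((m : ℝ) / 4 - 3 / 4) * Real.pi = ((m : ℝ) / 4 - 1) * Real.pi + Real.pi / 4 := by ring
      linarith
    have hv : (r : ℂ) * Complex.exp (θ * Complex.I) / rayDir m =
        r * Complex.exp (φ * Complex.I) := by
      rw [mul_div_assoc, rayDir, ← Complex.exp_sub, ← sub_mul, hφ, Complex.ofReal_sub]
    have hpi := Real.pi_pos
    have hcos : Real.sqrt 2 / 2 ≤ Real.cos φ := by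
      rw [← Real.cos_pi_div_four]
      exact Real.cos_le_cos_of_nonneg_of_le_pi h0 (by linarith) h4
    have hsin : Real.sin φ ≤ Real.sqrt 2 / 2 := by
      rw [← Real.sin_pi_div_four]
      exact Real.sin_le_sin_of_le_of_le_pi_div_two (by linarith) (by linarith) h4
    have hsin0 : 0 ≤ Real.sin φ := Real.sin_nonneg_of_nonneg_of_le_pi h0 (by linarith)
    have hs2 : 0 < Real.sqrt 2 := by positivity
    rw [hv]
    refine ⟨?_, ?_, ?_⟩
    · rw [Complex.re_ofReal_mul, Complex.exp_ofReal_mul_I_re]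
      exact mul_pos hr (by linarith)
    · rw [Complex.im_ofReal_mul, Complex.exp_ofReal_mul_I_im]
      positivity
    · rw [Complex.re_ofReal_mul, Complex.exp_ofReal_mul_I_re, Complex.im_ofReal_mul,
        Complex.exp_ofReal_mul_I_im]
      exact mul_le_mul_of_nonneg_left (by linarith) hr.le
  · rintro ⟨h1, h2, h3⟩
    set v := ζ / rayDir m with hv
    have hv0 : v ≠ 0 := fun h => by rw [h] at h1; simp at h1
    have hn : 0 < ‖v‖ := norm_pos_iff.2 hv0
    refine ⟨‖v‖, ((m : ℝ) / 4 - 1) * Real.pi + v.arg, hn, ?_, ?_, ?_⟩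
    · linarith [Complex.arg_nonneg_iff.2 h2]
    · have : v.arg ≤ Real.pi / 4 := by
        rw [Complex.arg_of_re_nonneg h1.le, Real.arcsin_le_iff_le_sin' ⟨by
          linarith [Real.pi_pos], by linarith [Real.pi_pos]⟩, Real.sin_pi_div_four,
          div_le_iff₀ hn]
        have hsq : ‖v‖ ^ 2 = v.re ^ 2 + v.im ^ 2 := by
          rw [← Complex.normSq_eq_norm_sq, Complex.normSq_apply]; ring
        refine le_of_sq_le_sq ?_ (by positivity)
        rw [mul_pow, div_pow, Real.sq_sqrt (by norm_num), hsq]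
        nlinarith
      linarith
    · rw [Complex.ofReal_add, add_mul, Complex.exp_add]
      have h4 := Complex.norm_mul_exp_arg_mul_I v
      have h5 : ζ = v * rayDir m := by rw [hv, div_mul_cancel₀ _ (rayDir_ne_zero m)]
      conv_lhs => rw [h5, ← h4]
      rw [rayDir]
      ring

lemma mem_ray_iff (m : ℤ) (ζ : ℂ) :
    ζ ∈ ray m ↔ 0 < (ζ / rayDir m).re ∧ (ζ / rayDir m).im = 0 := by
  constructor
  · rintro ⟨r, hr, rfl⟩
    rw [← rayDir, mul_div_assoc, div_self (rayDir_ne_zero m), mul_one]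
    exact ⟨hr, rfl⟩
  · rintro ⟨h1, h2⟩
    refine ⟨(ζ / rayDir m).re, h1, ?_⟩
    rw [← rayDir]
    have : (((ζ / rayDir m).re : ℝ) : ℂ) = ζ / rayDir m := Complex.ext rfl (by simp [h2])
    rw [this, div_mul_cancel₀ _ (rayDir_ne_zero m)]

lemma ne_zero_of_mem_sector {m : ℤ} {ζ : ℂ} (h : ζ ∈ sector m) : ζ ≠ 0 := by
  rintro rfl
  rw [mem_sector_iff, zero_div] at h
  exact lt_irrefl _ h.1

/-- The index of the sector that contains `ζ ≠ 0`. -/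
def sectorIndex (ζ : ℂ) : ℤ := ⌊4 * ζ.arg / Real.pi⌋ + 4

lemma measurable_sectorIndex : Measurable sectorIndex := by
  have : Measurable fun ζ : ℂ => 4 * ζ.arg / Real.pi := by fun_prop
  exact (this.floor).add_const 4

lemma sectorIndex_mem (ζ : ℂ) : 0 ≤ sectorIndex ζ ∧ sectorIndex ζ < 9 := by
  have hpi := Real.pi_pos
  have h1 := Complex.neg_pi_lt_arg ζ
  have h2 := Complex.arg_le_pi ζ
  unfold sectorIndex
  constructor
  · have : (-4 : ℤ) ≤ ⌊4 * ζ.arg / Real.pi⌋ := by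
      rw [Int.le_floor, le_div_iff₀ hpi]; push_cast; linarith
    omega
  · have : ⌊4 * ζ.arg / Real.pi⌋ < 5 := by
      rw [Int.floor_lt, div_lt_iff₀ hpi]; push_cast; linarith
    omega

lemma mem_sector_sectorIndex {ζ : ℂ} (hζ : ζ ≠ 0) : ζ ∈ sector (sectorIndex ζ) := by
  have hpi := Real.pi_pos
  have h1 := Int.floor_le (4 * ζ.arg / Real.pi)
  have h2 := (Int.lt_floor_add_one (4 * ζ.arg / Real.pi)).le
  rw [le_div_iff₀ hpi] at h1
  rw [div_le_iff₀ hpi] at h2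
  refine ⟨‖ζ‖, ζ.arg, norm_pos_iff.2 hζ, ?_, ?_, (Complex.norm_mul_exp_arg_mul_I ζ).symm⟩ <;>
  · unfold sectorIndex
    push_cast
    linarith

/-- The floor assigns the upper edge of a sector to the next sector. Apart from multiples of 8 in
the index this is the only ambiguity, so gluing requires agreement on the rays only. -/
lemma sectorIndex_eq_of_mem_sector {m : ℤ} {ζ : ℂ} (h : ζ ∈ sector m) :
    (∃ n : ℤ, sectorIndex ζ = m + 8 * n) ∨
      (∃ n : ℤ, sectorIndex ζ = m + 1 + 8 * n) ∧ ζ ∈ ray (m + 1) := by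
  have hpi := Real.pi_pos
  obtain ⟨r, θ, hr, h1, h2, rfl⟩ := h
  set ζ : ℂ := r * Complex.exp (θ * Complex.I) with hζ
  have h0 : ζ ≠ 0 := mul_ne_zero (by exact_mod_cast hr.ne') (Complex.exp_ne_zero _)
  have hn : ‖ζ‖ = r := by
    rw [hζ, norm_mul, Complex.norm_exp_ofReal_mul_I, mul_one, Complex.norm_real,
      Real.norm_of_nonneg hr.le]
  have h3 := Complex.norm_mul_exp_arg_mul_I ζ
  rw [hn, hζ] at h3
  have h4 := mul_left_cancel₀ (by exact_mod_cast hr.ne') h3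
  rw [Complex.exp_eq_exp_iff_exists_int, ← hζ] at h4
  obtain ⟨n, hn'⟩ := h4
  have harg : ζ.arg = θ + n * (2 * Real.pi) := by
    have h5 : ((ζ.arg : ℝ) : ℂ) = ((θ + n * (2 * Real.pi) : ℝ) : ℂ) := by
      apply mul_right_cancel₀ Complex.I_ne_zero
      rw [hn']; push_cast; ring
    exact_mod_cast h5
  have hlow : ((m - 4 + 8 * n : ℤ) : ℝ) ≤ 4 * ζ.arg / Real.pi := by
    rw [le_div_iff₀ hpi, harg]; push_cast; linarith
  have hup : 4 * ζ.arg / Real.pi ≤ ((m - 3 + 8 * n : ℤ) : ℝ) := by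
    rw [div_le_iff₀ hpi, harg]; push_cast; linarith
  rcases hup.lt_or_eq with hlt | heq
  · left
    refine ⟨n, ?_⟩
    have : ⌊4 * ζ.arg / Real.pi⌋ = m - 4 + 8 * n := by
      rw [Int.floor_eq_iff]
      refine ⟨hlow, hlt.trans_le (le_of_eq ?_)⟩
      push_cast; ring
    rw [sectorIndex, this]; ring
  · right
    refine ⟨⟨n, ?_⟩, r, hr, ?_⟩
    · rw [sectorIndex, heq, Int.floor_intCast]; ring
    · have : θ = (((m + 1 : ℤ) : ℝ) / 4 - 1) * Real.pi := by
        rw [div_eq_iff hpi.ne', harg] at heq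
        push_cast at heq ⊢
        linarith
      rw [hζ, this]

variable {E : Type*}

/-- The function that agrees with `f m` on the sector of index `m`, and has value `c` at `0`. -/
def glue (f : ℤ → ℂ → E) (c : E) (ζ : ℂ) : E := if ζ = 0 then c else f (sectorIndex ζ) ζ

lemma glue_zero (f : ℤ → ℂ → E) (c : E) : glue f c 0 = c := if_pos rfl

lemma apply_add_eight_mul {α : Type*} {f : ℤ → α} (hper : ∀ m, f (m + 8) = f m) (m n : ℤ) :
    f (m + 8 * n) = f m := by
  have h : Function.Periodic f 8 := hper
  simpa [mul_comm] using h.int_mul n m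

lemma glue_eq {f : ℤ → ℂ → E} {c : E} (hper : ∀ m, f (m + 8) = f m)
    (hray : ∀ m, ∀ ζ ∈ ray (m + 1), f (m + 1) ζ = f m ζ) {m : ℤ} {ζ : ℂ} (h : ζ ∈ sector m) :
    glue f c ζ = f m ζ := by
  rw [glue, if_neg (ne_zero_of_mem_sector h)]
  rcases sectorIndex_eq_of_mem_sector h with ⟨n, hn⟩ | ⟨⟨n, hn⟩, hr⟩
  · rw [hn, apply_add_eight_mul hper]
  · rw [hn, apply_add_eight_mul hper, hray m ζ hr]

lemma stronglyMeasurable_glue {E : Type*} [NormedAddCommGroup E] {f : ℤ → ℂ → E} {c : E}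
    (hf : ∀ m, StronglyMeasurable (f m)) : StronglyMeasurable (glue f c) := by
  have h1 : (fun ζ => f (sectorIndex ζ) ζ) = fun ζ => ∑ m ∈ Finset.range 9,
      ({ζ | sectorIndex ζ = (m : ℤ)}.indicator (f m)) ζ := by
    ext ζ
    obtain ⟨h0, h9⟩ := sectorIndex_mem ζ
    rw [Finset.sum_eq_single (sectorIndex ζ).toNat]
    · have : (((sectorIndex ζ).toNat : ℕ) : ℤ) = sectorIndex ζ := Int.toNat_of_nonneg h0
      rw [this, indicator_of_mem]
      rfl
    · intro b _ hb
      rw [indicator_of_notMem]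
      simp only [mem_ofPred_eq]
      omega
    · intro h
      rw [Finset.mem_range] at h
      omega
  refine StronglyMeasurable.ite (measurableSet_singleton (0 : ℂ)) stronglyMeasurable_const ?_
  rw [h1]
  exact Finset.stronglyMeasurable_fun_sum _ fun m _ =>
    (hf m).indicator (measurable_sectorIndex (measurableSet_singleton (m : ℤ)))

end Sectors

/-! ### Algebra of the Stokes factors -/

section Stokes

/-- The matrix `d₄`. -/
def dMat : Matrix (Fin 4) (Fin 4) ℂ := Matrix.diagonal d4

/-- The matrix `d₄⁻¹`. -/
def dInvMat : Matrix (Fin 4) (Fin 4) ℂ := Matrix.diagonal fun i => (d4 i)⁻¹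

/-- The nilpotent part of the jump matrix on the ray of index `m`. -/
def nilPart (s₁ s₂ : ℝ) (m : ℤ) : Matrix (Fin 4) (Fin 4) ℂ := stokesQ s₁ s₂ (m - 1) - 1

/-- The modulus of the difference of eigenvalues of `d₄` attached to the ray of index `m`. -/
def rayRate (m : ℤ) : ℝ := if Even m then 2 else Real.sqrt 2

lemma nilPart_add_eight (s₁ s₂ : ℝ) (m : ℤ) : nilPart s₁ s₂ (m + 8) = nilPart s₁ s₂ m := by
  unfold nilPart stokesQ
  rw [show (m + 8 - 1) % 8 = (m - 1) % 8 by omega]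

lemma rayRate_add_eight (m : ℤ) : rayRate (m + 8) = rayRate m := by
  have : Even (m + 8) ↔ Even m := by rw [Int.even_add]; simp [show Even (8 : ℤ) by decide]
  simp only [rayRate, this]

lemma sqrt_two_le_rayRate (m : ℤ) : Real.sqrt 2 ≤ rayRate m := by
  unfold rayRate
  split_ifs
  · rw [Real.sqrt_le_left (by norm_num)]; norm_num
  · exact le_rfl

lemma rayRate_le_two (m : ℤ) : rayRate m ≤ 2 := by
  unfold rayRate
  split_ifs
  · exact le_rfl
  · rw [Real.sqrt_le_left (by norm_num)]; norm_num

lemma rayRate_pos (m : ℤ) : 0 < rayRate m :=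
  lt_of_lt_of_le (by positivity) (sqrt_two_le_rayRate m)

/-- An eightfold case distinction for periodic statements. -/
lemma int_periodic_eight {P : ℤ → Prop} (hP : ∀ m, P (m + 8) ↔ P m)
    (h : ∀ m ∈ Finset.Ico (4 : ℤ) 12, P m) (m : ℤ) : P m := by
  have h1 : ∀ m n : ℤ, P (m + 8 * n) ↔ P m := fun m n => by
    have := apply_add_eight_mul (f := P) (fun m => propext (hP m)) m n
    rw [this]
  have h2 := h1 (4 + (m - 4) % 8) ((m - 4) / 8)
  rw [show 4 + (m - 4) % 8 + 8 * ((m - 4) / 8) = m by omega] at h2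
  exact h2.2 (h _ (Finset.mem_Ico.2 ⟨by omega, by omega⟩))

lemma rayRate_mul_rayDir :
    rayRate 4 * rayDir 4 = 2 ∧ rayRate 5 * rayDir 5 = 1 + Complex.I ∧
    rayRate 6 * rayDir 6 = 2 * Complex.I ∧ rayRate 7 * rayDir 7 = -1 + Complex.I ∧
    rayRate 8 * rayDir 8 = -2 ∧ rayRate 9 * rayDir 9 = -1 - Complex.I ∧
    rayRate 10 * rayDir 10 = -2 * Complex.I ∧ rayRate 11 * rayDir 11 = 1 - Complex.I := by
  have e4 := rayDir_four
  have e5 : (Real.sqrt 2 : ℂ) * rayDir 5 = 1 + Complex.I := by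
    rw [show (5 : ℤ) = 4 + 1 by norm_num, rayDir_succ, e4, one_mul, ← mul_assoc,
      ← Complex.ofReal_mul, ← mul_div_assoc, Real.mul_self_sqrt (by norm_num)]
    simp
  have e6 : rayDir 6 = Complex.I := by
    rw [show (6 : ℤ) = 4 + 2 by norm_num, rayDir_add_two, e4, one_mul]
  have e7 : rayDir 7 = rayDir 5 * Complex.I := rayDir_add_two 5
  have e8 : rayDir 8 = rayDir 6 * Complex.I := rayDir_add_two 6
  have e9 : rayDir 9 = rayDir 7 * Complex.I := rayDir_add_two 7
  have e10 : rayDir 10 = rayDir 8 * Complex.I := rayDir_add_two 8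
  have e11 : rayDir 11 = rayDir 9 * Complex.I := rayDir_add_two 9
  have r4 : rayRate 4 = 2 := if_pos (by decide)
  have r5 : rayRate 5 = Real.sqrt 2 := if_neg (by decide)
  have r6 : rayRate 6 = 2 := if_pos (by decide)
  have r7 : rayRate 7 = Real.sqrt 2 := if_neg (by decide)
  have r8 : rayRate 8 = 2 := if_pos (by decide)
  have r9 : rayRate 9 = Real.sqrt 2 := if_neg (by decide)
  have r10 : rayRate 10 = 2 := if_pos (by decide)
  have r11 : rayRate 11 = Real.sqrt 2 := if_neg (by decide)
  have hI := Complex.I_mul_I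
  rw [r4, r5, r6, r7, r8, r9, r10, r11, e11, e10, e9, e8, e7, e6, e4]
  refine ⟨by simp, e5, by simp, ?_, ?_, ?_, ?_, ?_⟩
  · rw [← mul_assoc, e5]; linear_combination hI
  · push_cast; linear_combination 2 * hI
  · rw [← mul_assoc, ← mul_assoc, e5]; linear_combination (1 + Complex.I) * hI
  · push_cast; linear_combination 2 * Complex.I * hI
  · rw [← mul_assoc, ← mul_assoc, ← mul_assoc, e5]
    linear_combination (1 + Complex.I) * Complex.I * hI - hI

lemma rayRate_div_rayDir (m : ℤ) :
    (rayRate m : ℂ) * (rayDir m)⁻¹ = (starRingEnd ℂ) (rayRate m * rayDir m) := by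
  rw [map_mul, Complex.conj_ofReal, Complex.inv_def, Complex.normSq_eq_norm_sq, norm_rayDir]
  simp

lemma inv_d4 (i : Fin 4) : (d4 i)⁻¹ = (starRingEnd ℂ) (d4 i) := by
  rw [Complex.inv_def, Complex.normSq_eq_norm_sq, d4, norm_pow, Complex.norm_I]
  simp

/-- Two facts are extracted from the table of Stokes factors. The columns j, l avoid the rows i, k,
so the square vanishes; and all entries belong to the same difference of eigenvalues of d₄, so
conjugation by `expMat` multiplies the whole matrix by one scalar. -/
lemma nilPart_eq_single (s₁ s₂ : ℝ) (m : ℤ) : ∃ (i j k l : Fin 4) (α β : ℂ),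
    nilPart s₁ s₂ m = Matrix.single i j α + Matrix.single k l β ∧
      (j ≠ i ∧ j ≠ k ∧ l ≠ i ∧ l ≠ k) ∧
      (starRingEnd ℂ) (d4 j - d4 i) = rayRate m * rayDir m ∧
      (starRingEnd ℂ) (d4 l - d4 k) = rayRate m * rayDir m := by
  refine int_periodic_eight (P := fun m => ∃ (i j k l : Fin 4) (α β : ℂ),
    nilPart s₁ s₂ m = Matrix.single i j α + Matrix.single k l β ∧
      (j ≠ i ∧ j ≠ k ∧ l ≠ i ∧ l ≠ k) ∧
      (starRingEnd ℂ) (d4 j - d4 i) = rayRate m * rayDir m ∧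
      (starRingEnd ℂ) (d4 l - d4 k) = rayRate m * rayDir m) (fun m => ?_) (fun m hm => ?_) m
  · rw [nilPart_add_eight, rayRate_add_eight, show m + 8 = m + 8 * 1 by ring,
      rayDir_add_eight_mul m 1]
  obtain ⟨h4, h5, h6, h7, h8, h9, h10, h11⟩ := rayRate_mul_rayDir
  have d0 : d4 0 = 1 := by simp [d4]
  have d1 : d4 1 = Complex.I := by simp [d4]
  have d2 : d4 2 = -1 := by simp [d4]
  have d3 : d4 3 = -Complex.I := by
    rw [d4, show ((3 : Fin 4) : ℕ) = 3 by rfl, pow_succ, Complex.I_sq]; ring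
  set p : ℂ := omegaPow (3 / 2) * s₁ with hp
  set q : ℂ := omegaPow (1 / 2) * s₁ with hq
  set r : ℂ := omegaPow 3 * s₂ with hr
  rw [Finset.mem_Ico] at hm
  obtain ⟨hm1, hm2⟩ := hm
  interval_cases m
  -- A factor with a single entry is padded by a second matrix unit with coefficient 0, at the same
  -- position so that the other conditions hold.
  · refine ⟨2, 0, 2, 0, r, 0, ?_, by decide, ?_, ?_⟩
    · ext a b; fin_cases a <;> fin_cases b <;> simp [nilPart, stokesQ, Matrix.single, hr]
    all_goals rw [h4, d0, d2]; simp; norm_num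
  · refine ⟨1, 0, 2, 3, p, q, ?_, by decide, ?_, ?_⟩
    · ext a b; fin_cases a <;> fin_cases b <;> simp [nilPart, stokesQ, Matrix.single, hp, hq]
    · rw [h5, d0, d1]; simp
    · rw [h5, d3, d2]; simp; ring
  · refine ⟨1, 3, 1, 3, r, 0, ?_, by decide, ?_, ?_⟩
    · ext a b; fin_cases a <;> fin_cases b <;> simp [nilPart, stokesQ, Matrix.single, hr]
    all_goals rw [h6, d3, d1]; simp; ring
  · refine ⟨0, 3, 1, 2, p, q, ?_, by decide, ?_, ?_⟩
    · ext a b; fin_cases a <;> fin_cases b <;> simp [nilPart, stokesQ, Matrix.single, hp, hq]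
    · rw [h7, d3, d0]; simp; ring
    · rw [h7, d2, d1]; simp
  · refine ⟨0, 2, 0, 2, r, 0, ?_, by decide, ?_, ?_⟩
    · ext a b; fin_cases a <;> fin_cases b <;> simp [nilPart, stokesQ, Matrix.single, hr]
    all_goals rw [h8, d2, d0]; simp; norm_num
  · refine ⟨0, 1, 3, 2, q, p, ?_, by decide, ?_, ?_⟩
    · ext a b; fin_cases a <;> fin_cases b <;> simp [nilPart, stokesQ, Matrix.single, hp, hq]
    · rw [h9, d1, d0]; simp; ring
    · rw [h9, d2, d3]; simp; ring
  · refine ⟨3, 1, 3, 1, r, 0, ?_, by decide, ?_, ?_⟩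
    · ext a b; fin_cases a <;> fin_cases b <;> simp [nilPart, stokesQ, Matrix.single, hr]
    all_goals rw [h10, d1, d3]; simp; ring
  · refine ⟨2, 1, 3, 0, p, q, ?_, by decide, ?_, ?_⟩
    · ext a b; fin_cases a <;> fin_cases b <;> simp [nilPart, stokesQ, Matrix.single, hp, hq]
    · rw [h11, d1, d2]; simp; ring
    · rw [h11, d0, d3]; simp; ring

lemma diagonal_commutator_single (D : Fin 4 → ℂ) (i j : Fin 4) (α : ℂ) :
    Matrix.diagonal D * Matrix.single i j α - Matrix.single i j α * Matrix.diagonal D =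
      (D i - D j) • Matrix.single i j α := by
  ext a b
  simp only [Matrix.sub_apply, Matrix.diagonal_mul, Matrix.mul_diagonal, Matrix.smul_apply,
    Matrix.single_apply, smul_eq_mul]
  split_ifs with h
  · rw [h.1, h.2]; ring
  · ring

lemma nilPart_mul_self (s₁ s₂ : ℝ) (m : ℤ) : nilPart s₁ s₂ m * nilPart s₁ s₂ m = 0 := by
  obtain ⟨i, j, k, l, α, β, hN, ⟨h1, h2, h3, h4⟩, -, -⟩ := nilPart_eq_single s₁ s₂ m
  rw [hN, add_mul, mul_add, mul_add]
  simp [Matrix.single_mul_single_of_ne, h1, h2, h3, h4]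

lemma dMat_commutator_nilPart (s₁ s₂ : ℝ) (m : ℤ) :
    dMat * nilPart s₁ s₂ m - nilPart s₁ s₂ m * dMat =
      (-((rayRate m : ℂ) * (rayDir m)⁻¹)) • nilPart s₁ s₂ m := by
  obtain ⟨i, j, k, l, α, β, hN, -, h1, h2⟩ := nilPart_eq_single s₁ s₂ m
  have e1 : d4 i - d4 j = -((rayRate m : ℂ) * (rayDir m)⁻¹) := by
    rw [rayRate_div_rayDir, ← h1, Complex.conj_conj]; ring
  have e2 : d4 k - d4 l = -((rayRate m : ℂ) * (rayDir m)⁻¹) := by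
    rw [rayRate_div_rayDir, ← h2, Complex.conj_conj]; ring
  have c1 := diagonal_commutator_single d4 i j α
  have c2 := diagonal_commutator_single d4 k l β
  rw [e1] at c1
  rw [e2] at c2
  rw [hN, smul_add, ← c1, ← c2, dMat]
  noncomm_ring

lemma dInvMat_commutator_nilPart (s₁ s₂ : ℝ) (m : ℤ) :
    dInvMat * nilPart s₁ s₂ m - nilPart s₁ s₂ m * dInvMat =
      (-((rayRate m : ℂ) * rayDir m)) • nilPart s₁ s₂ m := by
  obtain ⟨i, j, k, l, α, β, hN, -, h1, h2⟩ := nilPart_eq_single s₁ s₂ m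
  have e1 : (d4 i)⁻¹ - (d4 j)⁻¹ = -((rayRate m : ℂ) * rayDir m) := by
    rw [inv_d4, inv_d4, ← h1, map_sub]; ring
  have e2 : (d4 k)⁻¹ - (d4 l)⁻¹ = -((rayRate m : ℂ) * rayDir m) := by
    rw [inv_d4, inv_d4, ← h2, map_sub]; ring
  have c1 := diagonal_commutator_single (fun i => (d4 i)⁻¹) i j α
  have c2 := diagonal_commutator_single (fun i => (d4 i)⁻¹) k l β
  rw [e1] at c1
  rw [e2] at c2
  rw [hN, smul_add, ← c1, ← c2, dInvMat]
  noncomm_ring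

/-- The scalar factor `exp (-lam (t₁ v + t₂ / v))` of the jump matrix on the ray of index `m`, in
terms of the rotated variable `v = ζ / rayDir m`. -/
def jumpExp (t₁ t₂ : ℝ) (m : ℤ) (ζ : ℂ) : ℂ :=
  Complex.exp (-(rayRate m * (t₁ * (ζ / rayDir m) + t₂ * (ζ / rayDir m)⁻¹)))

lemma isUnit_expMat (x : ℝ) (ζ : ℂ) : IsUnit (expMat x ζ) := by
  rw [expMat, Matrix.isUnit_diagonal, Pi.isUnit_iff]
  exact fun i => (Complex.exp_ne_zero _).isUnit

/-- Entry by entry, the two commutators with d₄ and d₄⁻¹ fix the differences of eigenvalues wherever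
the nilpotent part is nonzero, hence the exponential factor there. -/
lemma expMat_conj (s₁ s₂ x : ℝ) (m : ℤ) (ζ : ℂ) :
    expMat x ζ * stokesQ s₁ s₂ (m - 1) * (expMat x ζ)⁻¹ =
      1 + jumpExp (x ^ 2) 1 m ζ • nilPart s₁ s₂ m := by
  have hdet : IsUnit (expMat x ζ).det := (Matrix.isUnit_iff_isUnit_det _).1 (isUnit_expMat x ζ)
  have key : expMat x ζ * nilPart s₁ s₂ m =
      jumpExp (x ^ 2) 1 m ζ • (nilPart s₁ s₂ m * expMat x ζ) := by
    ext i j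
    have h1 := congrFun (congrFun (dMat_commutator_nilPart s₁ s₂ m) i) j
    have h2 := congrFun (congrFun (dInvMat_commutator_nilPart s₁ s₂ m) i) j
    simp only [dMat, dInvMat, expMat, Matrix.sub_apply, Matrix.diagonal_mul, Matrix.mul_diagonal,
      Matrix.smul_apply, smul_eq_mul] at h1 h2 ⊢
    set N := nilPart s₁ s₂ m i j
    by_cases hN : N = 0
    · simp [hN]
    have e1 : d4 i = d4 j - (rayRate m : ℂ) * (rayDir m)⁻¹ :=
      mul_right_cancel₀ hN (by linear_combination h1)
    have e2 : (d4 i)⁻¹ = (d4 j)⁻¹ - (rayRate m : ℂ) * rayDir m :=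
      mul_right_cancel₀ hN (by linear_combination h2)
    rw [mul_comm N, ← mul_assoc, jumpExp, ← Complex.exp_add, e2, e1]
    congr 2
    rw [inv_div, div_eq_mul_inv, div_eq_mul_inv]
    push_cast
    ring
  have hQ : stokesQ s₁ s₂ (m - 1) = 1 + nilPart s₁ s₂ m := by rw [nilPart]; abel
  rw [hQ, mul_add, mul_one, add_mul, Matrix.mul_nonsing_inv _ hdet, key, smul_mul_assoc,
    mul_assoc, Matrix.mul_nonsing_inv _ hdet, mul_one]

end Stokes

attribute [local instance] Matrix.linftyOpNormedRing Matrix.linftyOpNormedAlgebra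

/-! ### The coefficient R of the ∂̄-problem and its estimates -/

section Coefficient

/-- A smooth cutoff function, equal to `1` on `(-∞, 1/3]` and to `0` on `[2/3, ∞)`. -/
def cutoff (t : ℝ) : ℝ := Real.smoothTransition (2 - 3 * t)

lemma contDiff_cutoff : ContDiff ℝ ∞ cutoff :=
  Real.smoothTransition.contDiff.comp (by fun_prop)

lemma cutoff_eq_one {t : ℝ} (h : t ≤ 1 / 3) : cutoff t = 1 :=
  Real.smoothTransition.one_of_one_le (by linarith)

lemma cutoff_eq_zero {t : ℝ} (h : 2 / 3 ≤ t) : cutoff t = 0 :=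
  Real.smoothTransition.zero_of_nonpos (by linarith)

lemma cutoff_mem (t : ℝ) : 0 ≤ cutoff t ∧ cutoff t ≤ 1 :=
  ⟨Real.smoothTransition.nonneg _, Real.smoothTransition.le_one _⟩

lemma hasDerivAt_cutoff (t : ℝ) : HasDerivAt cutoff (deriv cutoff t) t :=
  (contDiff_cutoff.differentiable (by simp)).differentiableAt.hasDerivAt

lemma continuous_deriv_cutoff : Continuous (deriv cutoff) :=
  contDiff_cutoff.continuous_deriv (by simp)

lemma deriv_cutoff_of_lt {t : ℝ} (h : t < 1 / 3) : deriv cutoff t = 0 := by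
  have : cutoff =ᶠ[𝓝 t] fun _ => 1 := by
    filter_upwards [gt_mem_nhds h] with u hu using cutoff_eq_one hu.le
  rw [this.deriv_eq, deriv_const]

lemma deriv_cutoff_of_gt {t : ℝ} (h : 2 / 3 < t) : deriv cutoff t = 0 := by
  have : cutoff =ᶠ[𝓝 t] fun _ => 0 := by
    filter_upwards [lt_mem_nhds h] with u hu using cutoff_eq_zero hu.le
  rw [this.deriv_eq, deriv_const]

lemma exists_deriv_cutoff_bound : ∃ C : ℝ, 0 < C ∧ ∀ t ∈ Icc (0 : ℝ) 1, |deriv cutoff t| ≤ C := by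
  obtain ⟨C, hC⟩ := (isCompact_Icc (a := (0 : ℝ)) (b := 1)).exists_bound_of_continuousOn
    continuous_deriv_cutoff.continuousOn
  exact ⟨max C 1, by positivity, fun t ht => (hC t ht).trans (le_max_left _ _)⟩

/-- The slope `tan (arg v)` of the rotated variable `v = ζ / rayDir m`. -/
def slope (m : ℤ) (ζ : ℂ) : ℝ := (ζ / rayDir m).im / (ζ / rayDir m).re

lemma slope_mem {m : ℤ} {ζ : ℂ} (h : ζ ∈ sector m) : slope m ζ ∈ Icc (0 : ℝ) 1 := by
  rw [mem_sector_iff] at h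
  exact ⟨div_nonneg h.2.1 h.1.le, (div_le_one h.1).2 h.2.2⟩

lemma slope_of_mem_ray {m : ℤ} {ζ : ℂ} (h : ζ ∈ ray m) : slope m ζ = 0 := by
  rw [mem_ray_iff] at h
  rw [slope, h.2, zero_div]

lemma div_rayDir_pred (m : ℤ) (ζ : ℂ) : ζ / rayDir m =
    ζ / rayDir (m + 1) * ((Real.sqrt 2 / 2 : ℝ) * (1 + Complex.I)) := by
  have h : rayDir (m + 1) = rayDir m * _ := rayDir_succ m
  have h0 : ((Real.sqrt 2 / 2 : ℝ) * (1 + Complex.I) : ℂ) ≠ 0 := by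
    rw [← exp_pi_div_four_mul_I]; exact Complex.exp_ne_zero _
  rw [h, div_mul_eq_mul_div, mul_div_mul_right _ _ h0]

lemma div_rayDir_pred_re_im (m : ℤ) (ζ : ℂ) :
    (ζ / rayDir m).re = Real.sqrt 2 / 2 * ((ζ / rayDir (m + 1)).re - (ζ / rayDir (m + 1)).im) ∧
    (ζ / rayDir m).im = Real.sqrt 2 / 2 * ((ζ / rayDir (m + 1)).re + (ζ / rayDir (m + 1)).im) := by
  rw [div_rayDir_pred m ζ]
  set v := ζ / rayDir (m + 1)
  constructor <;> simp <;> ring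

lemma slope_of_mem_ray_succ {m : ℤ} {ζ : ℂ} (h : ζ ∈ ray (m + 1)) : slope m ζ = 1 := by
  rw [mem_ray_iff] at h
  obtain ⟨h1, h2⟩ := div_rayDir_pred_re_im m ζ
  rw [slope, h1, h2, h.2, sub_zero, add_zero]
  exact div_self (mul_pos (by positivity) h.1).ne'

/-- The scalar part, on the sector of index `m`, of the coefficient of the `∂̄`-problem. -/
def dbarScalar (t₁ t₂ : ℝ) (m : ℤ) (ζ : ℂ) : ℂ :=
  -(((deriv cutoff (slope m ζ) : ℝ) : ℂ) * (Complex.I * ζ / (2 * ((ζ / rayDir m).re : ℂ) ^ 2))) *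
    jumpExp t₁ t₂ m ζ

/-- The coefficient of the `∂̄`-problem equivalent to the Riemann–Hilbert problem. -/
def dbarCoeff (s₁ s₂ t₁ t₂ : ℝ) : ℂ → Matrix (Fin 4) (Fin 4) ℂ :=
  glue (fun m ζ => dbarScalar t₁ t₂ m ζ • nilPart s₁ s₂ m) 0

lemma rayDir_add_eight (m : ℤ) : rayDir (m + 8) = rayDir m := by
  simpa using rayDir_add_eight_mul m 1

lemma slope_add_eight (m : ℤ) : slope (m + 8) = slope m := by
  ext ζ; rw [slope, slope, rayDir_add_eight]

lemma jumpExp_add_eight (t₁ t₂ : ℝ) (m : ℤ) : jumpExp t₁ t₂ (m + 8) = jumpExp t₁ t₂ m := by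
  ext ζ; rw [jumpExp, jumpExp, rayDir_add_eight, rayRate_add_eight]

/-- The derivative of the cutoff vanishes near slopes 0 and 1, so the formulas of adjacent sectors
are both 0 on the common ray. -/
lemma dbarCoeff_eq (s₁ s₂ t₁ t₂ : ℝ) {m : ℤ} {ζ : ℂ} (h : ζ ∈ sector m) :
    dbarCoeff s₁ s₂ t₁ t₂ ζ = dbarScalar t₁ t₂ m ζ • nilPart s₁ s₂ m := by
  refine glue_eq (f := fun m ζ => dbarScalar t₁ t₂ m ζ • nilPart s₁ s₂ m) (fun m => ?_)
    (fun m ζ hζ => ?_) h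
  · ext1 ζ
    rw [nilPart_add_eight, dbarScalar, dbarScalar, slope_add_eight, jumpExp_add_eight,
      rayDir_add_eight]
  · simp only [dbarScalar]
    rw [slope_of_mem_ray hζ, slope_of_mem_ray_succ hζ, deriv_cutoff_of_lt (by norm_num),
      deriv_cutoff_of_gt (by norm_num)]
    simp

lemma dbarCoeff_zero (s₁ s₂ t₁ t₂ : ℝ) : dbarCoeff s₁ s₂ t₁ t₂ 0 = 0 := glue_zero _ _

lemma stronglyMeasurable_dbarCoeff (s₁ s₂ t₁ t₂ : ℝ) :
    StronglyMeasurable (dbarCoeff s₁ s₂ t₁ t₂) := by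
  refine stronglyMeasurable_glue fun m => ?_
  have h1 : Measurable (slope m) := by unfold slope; fun_prop
  have h2 : Measurable fun ζ => deriv cutoff (slope m ζ) :=
    continuous_deriv_cutoff.measurable.comp h1
  have h3 : Measurable (dbarScalar t₁ t₂ m) := by
    unfold dbarScalar jumpExp; fun_prop
  exact h3.stronglyMeasurable.smul_const _

lemma norm_le_of_mem_cone {v : ℂ} (h : v ∈ cone) : ‖v‖ ≤ Real.sqrt 2 * v.re := by
  have h1 := h.1
  have hsq : ‖v‖ ^ 2 = v.re ^ 2 + v.im ^ 2 := by
    rw [← Complex.normSq_eq_norm_sq, Complex.normSq_apply]; ring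
  refine le_of_sq_le_sq ?_ (by positivity)
  rw [mul_pow, Real.sq_sqrt (by norm_num), hsq]
  nlinarith [h.2.1, h.2.2]

/-- On the cone |v| ≤ √2 Re v, and every rate is at least √2; hence rate · Re v ≥ |v| and likewise
rate · Re(1/v) ≥ 1/|v|. -/
lemma norm_jumpExp_le {t₁ t₂ : ℝ} (h₁ : 0 ≤ t₁) (h₂ : 0 ≤ t₂) {m : ℤ} {ζ : ℂ}
    (h : ζ ∈ sector m) : ‖jumpExp t₁ t₂ m ζ‖ ≤ Real.exp (-(t₁ * ‖ζ‖ + t₂ * ‖ζ‖⁻¹)) := by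
  rw [mem_sector_iff] at h
  have hn := norm_div_rayDir m ζ
  rw [jumpExp, Complex.norm_exp, Real.exp_le_exp]
  set v := ζ / rayDir m
  have hv := norm_le_of_mem_cone h
  have hre := h.1
  have hv0 : 0 < ‖v‖ := norm_pos_iff.2 fun h0 => by rw [h0] at hre; simp at hre
  rw [← hn]
  have e : (-((rayRate m : ℂ) * (t₁ * v + t₂ * v⁻¹))).re =
      -(rayRate m * (t₁ * v.re + t₂ * (v.re / ‖v‖ ^ 2))) := by
    rw [Complex.neg_re, Complex.re_ofReal_mul, Complex.add_re, Complex.re_ofReal_mul,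
      Complex.re_ofReal_mul, Complex.inv_re, Complex.normSq_eq_norm_sq]
  rw [e, neg_le_neg_iff]
  have hr : ‖v‖ ≤ rayRate m * v.re :=
    hv.trans (mul_le_mul_of_nonneg_right (sqrt_two_le_rayRate m) hre.le)
  have hr' : ‖v‖⁻¹ ≤ rayRate m * (v.re / ‖v‖ ^ 2) := by
    rw [← mul_div_assoc, le_div_iff₀ (by positivity), pow_two, ← mul_assoc,
      inv_mul_cancel₀ hv0.ne', one_mul]
    exact hr
  calc t₁ * ‖v‖ + t₂ * ‖v‖⁻¹ ≤ t₁ * (rayRate m * v.re) + t₂ * (rayRate m * (v.re / ‖v‖ ^ 2)) := by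
        gcongr
    _ = _ := by ring

lemma norm_exp_add_sub_le (b z : ℂ) : ‖Complex.exp (b + z) - Complex.exp b - z * Complex.exp b‖ ≤
    ‖Complex.exp b‖ * (‖z‖ ^ 2 * Real.exp ‖z‖) := by
  have h := Complex.norm_exp_sub_sum_le_norm_mul_exp z 2
  have e : Complex.exp (b + z) - Complex.exp b - z * Complex.exp b =
      Complex.exp b * (Complex.exp z - ∑ m ∈ Finset.range 2, z ^ m / (m.factorial : ℂ)) := by
    rw [Complex.exp_add]; simp [Finset.sum_range_succ]; ring
  rw [e, norm_mul]
  gcongr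

/-- Second order Taylor estimate for `jumpExp` in the parameters. -/
lemma norm_jumpExp_taylor_le {t₁ t₂ u₁ u₂ : ℝ} (h₁ : 0 < t₁) (h₂ : 0 < t₂)
    (hu₁ : |u₁ - t₁| ≤ t₁ / 4) (hu₂ : |u₂ - t₂| ≤ t₂ / 4) {m : ℤ} {ζ : ℂ} (h : ζ ∈ sector m) :
    ‖jumpExp u₁ u₂ m ζ - jumpExp t₁ t₂ m ζ -
      (-(rayRate m * ((u₁ - t₁) * (ζ / rayDir m) + (u₂ - t₂) * (ζ / rayDir m)⁻¹))) *
        jumpExp t₁ t₂ m ζ‖ ≤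
    4 * (|u₁ - t₁| * ‖ζ‖ + |u₂ - t₂| * ‖ζ‖⁻¹) ^ 2 *
      Real.exp (-(t₁ / 2 * ‖ζ‖ + t₂ / 2 * ‖ζ‖⁻¹)) := by
  have hJ := norm_jumpExp_le h₁.le h₂.le h
  have hn := norm_div_rayDir m ζ
  set v := ζ / rayDir m with hv
  set r := ‖ζ‖
  have hr : 0 ≤ r := norm_nonneg _
  set z : ℂ := -(rayRate m * ((u₁ - t₁) * v + (u₂ - t₂) * v⁻¹)) with hz
  set A := |u₁ - t₁| * r + |u₂ - t₂| * r⁻¹ with hA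
  have hA0 : 0 ≤ A := by positivity
  have hzn : ‖z‖ ≤ 2 * A := by
    rw [hz, norm_neg, norm_mul, Complex.norm_real, Real.norm_of_nonneg (rayRate_pos m).le]
    refine mul_le_mul (rayRate_le_two m) ?_ (norm_nonneg _) (by norm_num)
    refine (norm_add_le _ _).trans (le_of_eq ?_)
    rw [norm_mul, norm_mul, norm_inv, hn, ← Complex.ofReal_sub, ← Complex.ofReal_sub,
      Complex.norm_real, Complex.norm_real, Real.norm_eq_abs, Real.norm_eq_abs]
  have hu : jumpExp u₁ u₂ m ζ =
      Complex.exp (-(rayRate m * (t₁ * v + t₂ * v⁻¹)) + z) := by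
    rw [jumpExp, hz, ← hv]; congr 1; ring
  have ht : jumpExp t₁ t₂ m ζ = Complex.exp (-(rayRate m * (t₁ * v + t₂ * v⁻¹))) := rfl
  rw [hu]
  have h3 := norm_exp_add_sub_le (-(rayRate m * (t₁ * v + t₂ * v⁻¹))) z
  rw [← ht] at h3
  refine h3.trans ?_
  -- With increments of at most a quarter of the parameters, the growth exp ‖z‖ of the remainder
  -- uses up only half of the decay of the exponential.
  have hA2 : 2 * A ≤ t₁ / 2 * r + t₂ / 2 * r⁻¹ := by
    have := mul_le_mul_of_nonneg_right hu₁ hr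
    have := mul_le_mul_of_nonneg_right hu₂ (inv_nonneg.2 hr)
    rw [hA]; linarith
  calc ‖jumpExp t₁ t₂ m ζ‖ * (‖z‖ ^ 2 * Real.exp ‖z‖)
      ≤ Real.exp (-(t₁ * r + t₂ * r⁻¹)) *
          ((2 * A) ^ 2 * Real.exp (t₁ / 2 * r + t₂ / 2 * r⁻¹)) := by
        gcongr
        exact hzn.trans hA2
    _ = 4 * A ^ 2 * (Real.exp (-(t₁ * r + t₂ * r⁻¹)) * Real.exp (t₁ / 2 * r + t₂ / 2 * r⁻¹)) := by
        ring
    _ = _ := by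
        rw [← Real.exp_add]; congr 2; ring

/-- Exponential decay at `0` and `∞` beats the powers that occur below. -/
lemma exists_exp_le_decay {δ : ℝ} (hδ : 0 < δ) : ∃ K : ℝ, 0 < K ∧ ∀ s : ℂ,
    (1 + ‖s‖) ^ 2 * (1 + ‖s‖⁻¹) ^ 3 * Real.exp (-(δ * ‖s‖ + δ * ‖s‖⁻¹)) ≤ K * decay 5 s := by
  have key : ∀ n : ℕ, ∀ r : ℝ, 0 ≤ r →
      (1 + r) ^ n * Real.exp (-(δ * r)) ≤ n.factorial * (δ ^ n)⁻¹ * Real.exp δ := by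
    intro n r hr
    have h := Real.pow_div_factorial_le_exp (δ * (1 + r)) (by positivity) n
    rw [div_le_iff₀ (by positivity), mul_pow] at h
    have h2 : (1 + r) ^ n ≤ n.factorial * (δ ^ n)⁻¹ * Real.exp (δ * (1 + r)) := by
      rw [← mul_le_mul_iff_right₀ (show 0 < δ ^ n by positivity)]
      refine h.trans (le_of_eq ?_)
      field_simp
    calc (1 + r) ^ n * Real.exp (-(δ * r))
        ≤ n.factorial * (δ ^ n)⁻¹ * Real.exp (δ * (1 + r)) * Real.exp (-(δ * r)) := by gcongr
      _ = n.factorial * (δ ^ n)⁻¹ * (Real.exp (δ * (1 + r)) * Real.exp (-(δ * r))) := by ring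
      _ = _ := by rw [← Real.exp_add]; congr 2; ring
  -- 7 is the weight 5 plus the power 2. The powers 2 and 3 in the statement come from the squared
  -- factor (1 + r)(1 + 1/r), which bounds the quadratic remainder, and from the prefactor of size
  -- 1/r.
  refine ⟨((7 : ℕ).factorial * (δ ^ 7)⁻¹ * Real.exp δ) *
    ((3 : ℕ).factorial * (δ ^ 3)⁻¹ * Real.exp δ), by positivity, fun s => ?_⟩
  have h1 := key 7 ‖s‖ (norm_nonneg s)
  have h2 := key 3 ‖s‖⁻¹ (inv_nonneg.2 (norm_nonneg s))
  rw [decay, ← div_eq_mul_inv (_ * _ : ℝ), le_div_iff₀ (by positivity)]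
  calc _ = ((1 + ‖s‖) ^ 7 * Real.exp (-(δ * ‖s‖))) *
        ((1 + ‖s‖⁻¹) ^ 3 * Real.exp (-(δ * ‖s‖⁻¹))) := by
        rw [neg_add, Real.exp_add]; ring
    _ ≤ _ := mul_le_mul h1 h2 (by positivity) (by positivity)

lemma exists_nilPart_bound (s₁ s₂ : ℝ) : ∃ B : ℝ, 0 < B ∧ ∀ m, ‖nilPart s₁ s₂ m‖ ≤ B := by
  refine ⟨∑ m ∈ Finset.Ico (4 : ℤ) 12, ‖nilPart s₁ s₂ m‖ + 1, by positivity,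
    int_periodic_eight (fun m => by rw [nilPart_add_eight]) fun m hm => ?_⟩
  have := Finset.single_le_sum (f := fun m => ‖nilPart s₁ s₂ m‖) (fun _ _ => norm_nonneg _) hm
  exact this.trans (by linarith)

/-- The prefactor of `dbarScalar`. -/
lemma exists_prefactor_bound : ∃ C : ℝ, 0 < C ∧ ∀ (m : ℤ) (ζ : ℂ), ζ ∈ sector m →
    ‖-(((deriv cutoff (slope m ζ) : ℝ) : ℂ) *
      (Complex.I * ζ / (2 * ((ζ / rayDir m).re : ℂ) ^ 2)))‖ ≤ C * ‖ζ‖⁻¹ := by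
  obtain ⟨C, hC, h⟩ := exists_deriv_cutoff_bound
  refine ⟨C, hC, fun m ζ hζ => ?_⟩
  have h1 := h _ (slope_mem hζ)
  have h0 : 0 < ‖ζ‖ := norm_pos_iff.2 (ne_zero_of_mem_sector hζ)
  rw [mem_sector_iff] at hζ
  have h2 := norm_le_of_mem_cone hζ
  rw [norm_div_rayDir] at h2
  rw [norm_neg, norm_mul, Complex.norm_real, Real.norm_eq_abs]
  refine mul_le_mul h1 ?_ (norm_nonneg _) hC.le
  rw [norm_div, norm_mul, norm_mul, norm_pow, Complex.norm_I, Complex.norm_real,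
    Real.norm_of_nonneg hζ.1.le, one_mul, Complex.norm_ofNat]
  have h3 := hζ.1
  rw [div_le_iff₀ (by positivity), inv_mul_eq_div, le_div_iff₀ h0]
  have h4 := mul_self_le_mul_self h0.le h2
  have h5 := Real.mul_self_sqrt (show (0 : ℝ) ≤ 2 by norm_num)
  nlinarith

/-- The right-hand sides are the derivatives of the coefficient in t₁ and t₂, since these parameters
enter only through `jumpExp`. Deforming the parameters is thus an infinitesimal conjugation by d₄ or
d₄⁻¹. -/
lemma dbarCoeff_commutator (s₁ s₂ t₁ t₂ : ℝ) {m : ℤ} {ζ : ℂ} (h : ζ ∈ sector m) :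
    ζ • (dMat * dbarCoeff s₁ s₂ t₁ t₂ ζ - dbarCoeff s₁ s₂ t₁ t₂ ζ * dMat) =
      (-(rayRate m * (ζ / rayDir m)) * dbarScalar t₁ t₂ m ζ) • nilPart s₁ s₂ m ∧
    ζ⁻¹ • (dInvMat * dbarCoeff s₁ s₂ t₁ t₂ ζ - dbarCoeff s₁ s₂ t₁ t₂ ζ * dInvMat) =
      (-(rayRate m * (ζ / rayDir m)⁻¹) * dbarScalar t₁ t₂ m ζ) • nilPart s₁ s₂ m := by
  rw [dbarCoeff_eq s₁ s₂ t₁ t₂ h, mul_smul_comm, smul_mul_assoc, ← smul_sub,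
    dMat_commutator_nilPart, mul_smul_comm, smul_mul_assoc, ← smul_sub,
    dInvMat_commutator_nilPart, smul_smul, smul_smul, smul_smul, smul_smul]
  constructor
  · congr 1; rw [div_eq_mul_inv]; ring
  · congr 1; rw [inv_div, div_eq_mul_inv]; ring

/-- Size of the coefficient and of its first and second differences in the parameters. -/
lemma exists_dbarCoeff_bounds (s₁ s₂ : ℝ) {t₁ t₂ : ℝ} (h₁ : 0 < t₁) (h₂ : 0 < t₂) :
    ∃ K : ℝ, 0 < K ∧
      (∀ ζ, ‖dbarCoeff s₁ s₂ t₁ t₂ ζ‖ ≤ K * decay 5 ζ) ∧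
      (∀ ζ, ‖ζ • (dMat * dbarCoeff s₁ s₂ t₁ t₂ ζ - dbarCoeff s₁ s₂ t₁ t₂ ζ * dMat)‖ ≤
        K * decay 5 ζ) ∧
      (∀ ζ, ‖ζ⁻¹ • (dInvMat * dbarCoeff s₁ s₂ t₁ t₂ ζ - dbarCoeff s₁ s₂ t₁ t₂ ζ * dInvMat)‖ ≤
        K * decay 5 ζ) ∧
      ∀ u₁ u₂ : ℝ, |u₁ - t₁| ≤ t₁ / 4 → |u₂ - t₂| ≤ t₂ / 4 → ∀ ζ,
        ‖dbarCoeff s₁ s₂ u₁ u₂ ζ - dbarCoeff s₁ s₂ t₁ t₂ ζ -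
          ((u₁ - t₁) •
            (ζ • (dMat * dbarCoeff s₁ s₂ t₁ t₂ ζ - dbarCoeff s₁ s₂ t₁ t₂ ζ * dMat)) +
          (u₂ - t₂) •
            (ζ⁻¹ • (dInvMat * dbarCoeff s₁ s₂ t₁ t₂ ζ - dbarCoeff s₁ s₂ t₁ t₂ ζ * dInvMat)))‖ ≤
        K * (|u₁ - t₁| + |u₂ - t₂|) ^ 2 * decay 5 ζ := by
  -- Half the rates, since this is the decay that survives in `norm_jumpExp_taylor_le`.
  set δ : ℝ := min t₁ t₂ / 2 with hδ
  have hδ0 : 0 < δ := by have := lt_min h₁ h₂; positivity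
  have hδ1 : δ ≤ t₁ / 2 := by rw [hδ]; linarith [min_le_left t₁ t₂]
  have hδ2 : δ ≤ t₂ / 2 := by rw [hδ]; linarith [min_le_right t₁ t₂]
  obtain ⟨K, hK, hexp⟩ := exists_exp_le_decay hδ0
  obtain ⟨C, hC, hpre⟩ := exists_prefactor_bound
  obtain ⟨B, hB, hN⟩ := exists_nilPart_bound s₁ s₂
  -- a common estimate for all terms
  have main : ∀ (m : ℤ) (ζ P c : ℂ) (A : ℝ) (hζ : ζ ∈ sector m) (hA : 0 ≤ A)
      (hP : ‖P‖ ≤ C * ‖ζ‖⁻¹) (hc : ‖c‖ ≤ 4 * A * ((1 + ‖ζ‖) * (1 + ‖ζ‖⁻¹)) ^ 2 *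
        Real.exp (-(δ * ‖ζ‖ + δ * ‖ζ‖⁻¹))),
      ‖(P * c) • nilPart s₁ s₂ m‖ ≤ 4 * C * B * K * A * decay 5 ζ := by
    intro m ζ P c A hζ hA hP hc
    have hr := norm_nonneg ζ
    rw [norm_smul, norm_mul]
    calc ‖P‖ * ‖c‖ * ‖nilPart s₁ s₂ m‖
        ≤ (C * (1 + ‖ζ‖⁻¹)) * (4 * A * ((1 + ‖ζ‖) * (1 + ‖ζ‖⁻¹)) ^ 2 *
            Real.exp (-(δ * ‖ζ‖ + δ * ‖ζ‖⁻¹))) * B := by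
          gcongr
          · refine hP.trans ?_
            gcongr
            linarith
          · exact hN m
      _ = 4 * C * B * A * ((1 + ‖ζ‖) ^ 2 * (1 + ‖ζ‖⁻¹) ^ 3 *
            Real.exp (-(δ * ‖ζ‖ + δ * ‖ζ‖⁻¹))) := by ring
      _ ≤ 4 * C * B * A * (K * decay 5 ζ) := mul_le_mul_of_nonneg_left (hexp ζ) (by positivity)
      _ = _ := by ring
  have hJ : ∀ (m : ℤ) (ζ : ℂ), ζ ∈ sector m →
      ‖jumpExp t₁ t₂ m ζ‖ ≤ Real.exp (-(δ * ‖ζ‖ + δ * ‖ζ‖⁻¹)) := by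
    intro m ζ hζ
    refine (norm_jumpExp_le h₁.le h₂.le hζ).trans ?_
    rw [Real.exp_le_exp, neg_le_neg_iff]
    gcongr <;> linarith
  have hone : ∀ ζ : ℂ, 1 ≤ (1 + ‖ζ‖) * (1 + ‖ζ‖⁻¹) ∧ ‖ζ‖ ≤ (1 + ‖ζ‖) * (1 + ‖ζ‖⁻¹) ∧
      ‖ζ‖⁻¹ ≤ (1 + ‖ζ‖) * (1 + ‖ζ‖⁻¹) := by
    intro ζ
    have h1 := norm_nonneg ζ
    have h2 := inv_nonneg.2 h1
    have h3 := mul_nonneg h1 h2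
    refine ⟨?_, ?_, ?_⟩ <;> nlinarith
  have hfac : ∀ (m : ℤ) (ζ a : ℂ), ζ ∈ sector m → ‖a‖ ≤ 2 * ((1 + ‖ζ‖) * (1 + ‖ζ‖⁻¹)) →
      ‖a * jumpExp t₁ t₂ m ζ‖ ≤ 4 * 1 * ((1 + ‖ζ‖) * (1 + ‖ζ‖⁻¹)) ^ 2 *
        Real.exp (-(δ * ‖ζ‖ + δ * ‖ζ‖⁻¹)) := by
    intro m ζ a hζ ha
    rw [norm_mul]
    refine mul_le_mul (ha.trans ?_) (hJ m ζ hζ) (norm_nonneg _) (by positivity)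
    nlinarith [(hone ζ).1]
  have hrate : ∀ m : ℤ, ‖(rayRate m : ℂ)‖ ≤ 2 := fun m => by
    rw [Complex.norm_real, Real.norm_of_nonneg (rayRate_pos m).le]; exact rayRate_le_two m
  refine ⟨4 * C * B * K, by positivity, fun ζ => ?_, fun ζ => ?_, fun ζ => ?_,
    fun u₁ u₂ hu₁ hu₂ ζ => ?_⟩
  all_goals
    have hd := decay_pos 5 ζ
    rcases eq_or_ne ζ 0 with rfl | hζ0
    · simp only [dbarCoeff_zero]
      simp
      positivity
    have hζ := mem_sector_sectorIndex hζ0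
    set m := sectorIndex ζ
    have hP := hpre m ζ hζ
  · rw [dbarCoeff_eq _ _ _ _ hζ, dbarScalar]
    have h := main m ζ _ (1 * jumpExp t₁ t₂ m ζ) 1 hζ zero_le_one hP
      (hfac m ζ 1 hζ (by rw [norm_one]; linarith [(hone ζ).1]))
    rwa [one_mul, mul_one] at h
  · rw [(dbarCoeff_commutator _ _ _ _ hζ).1, dbarScalar, mul_left_comm]
    have h := main m ζ _ (-(rayRate m * (ζ / rayDir m)) * jumpExp t₁ t₂ m ζ) 1 hζ zero_le_one hP
      (hfac m ζ _ hζ (by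
        rw [norm_neg, norm_mul, norm_div_rayDir]
        exact mul_le_mul (hrate m) (hone ζ).2.1 (norm_nonneg _) (by norm_num)))
    rwa [mul_one] at h
  · rw [(dbarCoeff_commutator _ _ _ _ hζ).2, dbarScalar, mul_left_comm]
    have h := main m ζ _ (-(rayRate m * (ζ / rayDir m)⁻¹) * jumpExp t₁ t₂ m ζ) 1 hζ zero_le_one hP
      (hfac m ζ _ hζ (by
        rw [norm_neg, norm_mul, norm_inv, norm_div_rayDir]
        exact mul_le_mul (hrate m) (hone ζ).2.2 (by positivity) (by norm_num)))
    rwa [mul_one] at h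
  · rw [(dbarCoeff_commutator _ _ _ _ hζ).2, (dbarCoeff_commutator _ _ _ _ hζ).1,
      dbarCoeff_eq _ _ _ _ hζ, dbarCoeff_eq _ _ _ _ hζ]
    set P : ℂ := -(((deriv cutoff (slope m ζ) : ℝ) : ℂ) *
      (Complex.I * ζ / (2 * ((ζ / rayDir m).re : ℂ) ^ 2))) with hPdef
    have h := main m ζ P (A := (|u₁ - t₁| + |u₂ - t₂|) ^ 2) (hζ := hζ) (hA := by positivity)
      (hP := hP) (c := jumpExp u₁ u₂ m ζ - jumpExp t₁ t₂ m ζ -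
        (-(rayRate m * ((u₁ - t₁) * (ζ / rayDir m) + (u₂ - t₂) * (ζ / rayDir m)⁻¹))) *
        jumpExp t₁ t₂ m ζ) (hc := by
        refine (norm_jumpExp_taylor_le h₁ h₂ hu₁ hu₂ hζ).trans ?_
        rw [mul_assoc 4 _ (_ ^ 2), ← mul_pow]
        have h3 : |u₁ - t₁| * ‖ζ‖ + |u₂ - t₂| * ‖ζ‖⁻¹ ≤
            (|u₁ - t₁| + |u₂ - t₂|) * ((1 + ‖ζ‖) * (1 + ‖ζ‖⁻¹)) := by
          rw [add_mul]
          exact add_le_add (mul_le_mul_of_nonneg_left (hone ζ).2.1 (abs_nonneg _))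
            (mul_le_mul_of_nonneg_left (hone ζ).2.2 (abs_nonneg _))
        gcongr)
    refine le_of_eq_of_le (congrArg norm ?_) h
    simp only [dbarScalar, ← hPdef]
    rw [← Complex.coe_smul, ← Complex.coe_smul, smul_smul, smul_smul, ← add_smul, ← sub_smul,
      ← sub_smul]
    congr 1
    push_cast
    ring

end Coefficient

/-! ### From the Riemann–Hilbert problem to the ∂̄-problem -/

section Transfer

lemma tendsto_glue {E : Type*} [TopologicalSpace E] {f : ℤ → ℂ → E} {a c : E} {l : Filter ℂ}
    (hf : ∀ m, Tendsto (f m) (l ⊓ 𝓟 (sector m)) (𝓝 c)) (h0 : ∀ᶠ ζ in l, ζ = 0 → a = c) :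
    Tendsto (glue f a) l (𝓝 c) := by
  rw [tendsto_def]
  intro U hU
  have h1 : ∀ᶠ ζ in l, ∀ m ∈ Finset.Ico (0 : ℤ) 9, ζ ∈ sector m → f m ζ ∈ U := by
    rw [Filter.eventually_all_finset]
    intro m _
    have := (hf m).eventually hU
    rwa [eventually_inf_principal] at this
  filter_upwards [h1, h0] with ζ hζ hζ0
  rw [mem_preimage, glue]
  split_ifs with h
  · rw [hζ0 h]; exact mem_of_mem_nhds hU
  · exact hζ _ (Finset.mem_Ico.2 (sectorIndex_mem ζ)) (mem_sector_sectorIndex h)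

lemma hasDbarAt_of_entries {A : ℂ → Matrix (Fin 4) (Fin 4) ℂ} {z : ℂ}
    (h : ∀ i j, DifferentiableAt ℂ (fun ζ => A ζ i j) z) : HasDbarAt A 0 z := by
  have e : A = fun ζ => ∑ i, ∑ j, A ζ i j • Matrix.single i j (1 : ℂ) := by
    ext1 ζ
    conv_lhs => rw [Matrix.matrix_eq_sum_single (A ζ)]
    simp [Matrix.smul_single]
  rw [e]
  exact hasDbarAt_of_hasDerivAt (HasDerivAt.fun_sum fun i _ => HasDerivAt.fun_sum fun j _ =>
    (h i j).hasDerivAt.smul_const _)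

lemma HasDbarAt.smul_const {E : Type*} [NormedAddCommGroup E] [NormedSpace ℂ E] {c : ℂ → ℂ}
    {a z : ℂ} (h : HasDbarAt c a z) (N : E) : HasDbarAt (fun ζ => c ζ • N) (a • N) z := by
  obtain ⟨L, hL, hLe⟩ := h
  refine ⟨_, hL.smul_const N, ?_⟩
  simp only [ContinuousLinearMap.smulRight_apply]
  rw [smul_smul, ← add_smul, smul_smul, ← smul_eq_mul, hLe, smul_eq_mul]

lemma HasDbarAt.const_sub {E : Type*} [NormedAddCommGroup E] [NormedSpace ℂ E] {c : ℂ → E}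
    {a : E} {z : ℂ} (h : HasDbarAt c a z) (b : E) : HasDbarAt (fun ζ => b - c ζ) (-a) z := by
  obtain ⟨L, hL, hLe⟩ := h
  refine ⟨_, hL.const_sub b, ?_⟩
  simp only [neg_apply]
  rw [smul_neg, ← neg_add, hLe, smul_neg]

/-- For v = ζ / `rayDir m` one has ∂(Im v / Re v)/∂v̄ = i v / (2 (Re v)²). The chain rule multiplies
by the conjugate of 1/`rayDir m`, which is `rayDir m` itself, and turns v into ζ. -/
lemma hasDbarAt_cutoff_slope {m : ℤ} {ζ : ℂ} (h : (ζ / rayDir m).re ≠ 0) :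
    HasDbarAt (fun ζ => ((cutoff (slope m ζ) : ℝ) : ℂ))
      (((deriv cutoff (slope m ζ) : ℝ) : ℂ) *
        (Complex.I * ζ / (2 * ((ζ / rayDir m).re : ℂ) ^ 2))) ζ := by
  have hv : HasFDerivAt (fun ζ : ℂ => ζ / rayDir m)
      (((rayDir m)⁻¹ : ℂ) • (ContinuousLinearMap.id ℝ ℂ)) ζ := by
    simp only [div_eq_mul_inv]
    exact (hasFDerivAt_id ζ).mul_const _
  have hre := (Complex.reCLM.hasFDerivAt (x := ζ / rayDir m)).comp ζ hv
  have him := (Complex.imCLM.hasFDerivAt (x := ζ / rayDir m)).comp ζ hv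
  have hdiv := him.mul ((hasDerivAt_inv h).comp_hasFDerivAt ζ hre)
  have hχ := Complex.ofRealCLM.hasFDerivAt.comp ζ
    ((hasDerivAt_cutoff (slope m ζ)).comp_hasFDerivAt ζ hdiv)
  refine ⟨_, hχ, ?_⟩
  have hε : rayDir m = (starRingEnd ℂ) (rayDir m)⁻¹ := by
    rw [Complex.inv_def, Complex.normSq_eq_norm_sq, norm_rayDir]; simp
  set w := (rayDir m)⁻¹ with hw
  have hζ : ζ = (ζ / rayDir m) * (starRingEnd ℂ) w := by
    rw [← hε, div_mul_cancel₀ _ (rayDir_ne_zero m)]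
  set v := ζ / rayDir m with hv'
  set χ := deriv cutoff (slope m ζ)
  have h' : (v.re : ℂ) ≠ 0 := by exact_mod_cast h
  have e1 : (Complex.I * ζ / (2 * (v.re : ℂ) ^ 2)) =
      ((v.re * w.im - v.im * w.re : ℝ) + Complex.I * (v.re * w.re + v.im * w.im : ℝ)) /
        (2 * (v.re : ℂ) ^ 2) := by
    congr 1
    conv_lhs => rw [hζ]
    apply Complex.ext
    · simp; ring
    · simp
  rw [e1]
  simp [← hv']
  field_simp
  ring

/-- The function that is glued from the solution of the Riemann–Hilbert problem. -/
def sectorFun (s₁ s₂ x : ℝ) (Y : ℤ → ℂ → Matrix (Fin 4) (Fin 4) ℂ) (m : ℤ) (ζ : ℂ) :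
    Matrix (Fin 4) (Fin 4) ℂ :=
  Y m ζ * (1 - (((cutoff (slope m ζ) : ℝ) : ℂ) * jumpExp (x ^ 2) 1 m ζ) • nilPart s₁ s₂ m)

lemma one_add_smul_nilPart_mul (s₁ s₂ : ℝ) (m : ℤ) (a b : ℂ) :
    (1 + a • nilPart s₁ s₂ m) * (1 - b • nilPart s₁ s₂ m) = 1 + (a - b) • nilPart s₁ s₂ m := by
  rw [add_mul, mul_sub, mul_sub, mul_smul_comm, smul_mul_assoc, smul_mul_assoc,
    mul_smul_comm, nilPart_mul_self, sub_smul]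
  simp
  abel

lemma isUnit_one_sub_smul_nilPart (s₁ s₂ : ℝ) (m : ℤ) (a : ℂ) :
    IsUnit (1 - a • nilPart s₁ s₂ m) := by
  refine ⟨⟨1 - a • nilPart s₁ s₂ m, 1 + a • nilPart s₁ s₂ m, ?_, ?_⟩, rfl⟩
  · have := one_add_smul_nilPart_mul s₁ s₂ m (-a) (-a)
    simpa [sub_eq_add_neg] using this
  · have := one_add_smul_nilPart_mul s₁ s₂ m a a
    simpa using this

variable {s₁ s₂ x : ℝ} {Y : ℤ → ℂ → Matrix (Fin 4) (Fin 4) ℂ} {M : Matrix (Fin 4) (Fin 4) ℂ}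

lemma sectorFun_add_eight (hY : IsRHSolution s₁ s₂ x Y) (m : ℤ) :
    sectorFun s₁ s₂ x Y (m + 8) = sectorFun s₁ s₂ x Y m := by
  ext1 ζ
  rw [sectorFun, sectorFun, hY.periodic, slope_add_eight, jumpExp_add_eight, nilPart_add_eight]

lemma ray_subset_sector (m : ℤ) : ray m ⊆ sector m := by
  intro ζ h
  rw [mem_ray_iff] at h
  rw [mem_sector_iff]
  exact ⟨h.1, h.2.ge, by rw [h.2]; exact h.1.le⟩

/-- Where the cutoff is 1, the factor 1 - E N is the inverse of the jump 1 + E N, so the glued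
function continues holomorphically across the ray. -/
lemma sectorFun_of_jump {m : ℤ} {ζ : ℂ} (hc : cutoff (slope m ζ) = 1)
    (hj : Y m ζ = Y (m - 1) ζ * (expMat x ζ * stokesQ s₁ s₂ (m - 1) * (expMat x ζ)⁻¹)) :
    sectorFun s₁ s₂ x Y m ζ = Y (m - 1) ζ := by
  rw [sectorFun, hj, expMat_conj, hc, Complex.ofReal_one, one_mul, mul_assoc,
    one_add_smul_nilPart_mul, sub_self, zero_smul, add_zero, mul_one]

lemma sectorFun_of_cutoff {m : ℤ} {ζ : ℂ} (hc : cutoff (slope m ζ) = 0) :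
    sectorFun s₁ s₂ x Y m ζ = Y m ζ := by
  rw [sectorFun, hc, Complex.ofReal_zero, zero_mul, zero_smul, sub_zero, mul_one]

lemma glue_sectorFun (hY : IsRHSolution s₁ s₂ x Y) {m : ℤ} {ζ : ℂ} (h : ζ ∈ sector m) :
    glue (sectorFun s₁ s₂ x Y) M ζ = sectorFun s₁ s₂ x Y m ζ := by
  refine glue_eq (sectorFun_add_eight hY) (fun m ζ hζ => ?_) h
  obtain ⟨D, -, hN⟩ := hY.holomorphic_jump
  obtain ⟨N, -, hr, -, hj⟩ := hN (m + 1)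
  rw [sectorFun_of_jump (by rw [slope_of_mem_ray hζ]; exact cutoff_eq_one (by norm_num))
    (hj ζ (hr hζ)), sectorFun_of_cutoff
    (by rw [slope_of_mem_ray_succ hζ]; exact cutoff_eq_zero (by norm_num)), add_sub_cancel_right]

lemma continuous_div_rayDir (m : ℤ) : Continuous fun ζ : ℂ => ζ / rayDir m := by fun_prop

/-- The `∂̄`-equation at interior points of a sector. -/
lemma hasDbarAt_glue_interior (hY : IsRHSolution s₁ s₂ x Y) {m : ℤ} {ζ : ℂ}
    (h1 : 0 < (ζ / rayDir m).im) (h2 : (ζ / rayDir m).im < (ζ / rayDir m).re) :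
    HasDbarAt (glue (sectorFun s₁ s₂ x Y) M)
      (glue (sectorFun s₁ s₂ x Y) M ζ * dbarCoeff s₁ s₂ (x ^ 2) 1 ζ) ζ := by
  have hsec : ζ ∈ sector m := (mem_sector_iff m ζ).2 ⟨h1.trans h2, h1.le, h2.le⟩
  have hev : glue (sectorFun s₁ s₂ x Y) M =ᶠ[𝓝 ζ] sectorFun s₁ s₂ x Y m := by
    have hc := continuous_div_rayDir m
    have o1 : IsOpen {ζ : ℂ | 0 < (ζ / rayDir m).im} :=
      isOpen_lt continuous_const (Complex.continuous_im.comp hc)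
    have o2 : IsOpen {ζ : ℂ | (ζ / rayDir m).im < (ζ / rayDir m).re} :=
      isOpen_lt (Complex.continuous_im.comp hc) (Complex.continuous_re.comp hc)
    filter_upwards [o1.mem_nhds h1, o2.mem_nhds h2] with ξ hξ1 hξ2
    have hξ1' : 0 < (ξ / rayDir m).im := hξ1
    have hξ2' : (ξ / rayDir m).im < (ξ / rayDir m).re := hξ2
    exact glue_sectorFun hY ((mem_sector_iff m ξ).2 ⟨hξ1'.trans hξ2', hξ1'.le, hξ2'.le⟩)
  refine HasDbarAt.congr_of_eventuallyEq ?_ hev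
  obtain ⟨D, hD, -⟩ := hY.holomorphic_jump
  obtain ⟨hDo, -, hDs, hDd, -⟩ := hD m
  have hYm : HasDbarAt (Y m) 0 ζ := hasDbarAt_of_entries fun i j =>
    (hDd i j).differentiableAt (hDo.mem_nhds (hDs hsec))
  have hE : HasDbarAt (jumpExp (x ^ 2) 1 m) 0 ζ := by
    have hv0 : ζ / rayDir m ≠ 0 := fun h0 => by rw [h0] at h1; simp at h1
    have hdiv : DifferentiableAt ℂ (fun ζ : ℂ => ζ / rayDir m) ζ :=
      differentiableAt_id.div_const _
    have hd : DifferentiableAt ℂ (jumpExp (x ^ 2) 1 m) ζ := by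
      unfold jumpExp
      refine DifferentiableAt.cexp (DifferentiableAt.neg (DifferentiableAt.const_mul ?_ _))
      exact (DifferentiableAt.const_mul hdiv _).add
        (DifferentiableAt.const_mul (DifferentiableAt.inv hdiv hv0) _)
    exact hasDbarAt_of_hasDerivAt hd.hasDerivAt
  have hc := (hasDbarAt_cutoff_slope (m := m) (h1.trans h2).ne').mul hE
  have hB := (hc.smul_const (nilPart s₁ s₂ m)).const_sub 1
  have hprod : HasDbarAt (sectorFun s₁ s₂ x Y m) _ ζ := hYm.mul hB
  convert hprod using 1
  -- Since N² = 0, the factor 1 - χ E N acts trivially on the coefficient; this puts the equation in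
  -- the form F R.
  rw [glue_sectorFun hY hsec, dbarCoeff_eq _ _ _ _ hsec, sectorFun, mul_assoc, sub_mul, one_mul,
    smul_mul_assoc, mul_smul_comm, nilPart_mul_self, smul_zero, smul_zero, sub_zero, zero_mul,
    zero_add, mul_zero, add_zero, ← neg_smul, dbarScalar, neg_mul]

/-- The `∂̄`-equation on the rays. -/
lemma hasDbarAt_glue_ray (hY : IsRHSolution s₁ s₂ x Y) {m : ℤ} {ζ : ℂ} (h : ζ ∈ ray m) :
    HasDbarAt (glue (sectorFun s₁ s₂ x Y) M)
      (glue (sectorFun s₁ s₂ x Y) M ζ * dbarCoeff s₁ s₂ (x ^ 2) 1 ζ) ζ := by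
  obtain ⟨D, hD, hN⟩ := hY.holomorphic_jump
  obtain ⟨N, hNo, hNr, hND, hj⟩ := hN m
  have hray := (mem_ray_iff m ζ).1 h
  have hR : dbarCoeff s₁ s₂ (x ^ 2) 1 ζ = 0 := by
    rw [dbarCoeff_eq _ _ _ _ (ray_subset_sector m h), dbarScalar, slope_of_mem_ray h,
      deriv_cutoff_of_lt (by norm_num)]
    simp
  rw [hR, mul_zero]
  have hYm : HasDbarAt (Y (m - 1)) 0 ζ := hasDbarAt_of_entries fun i j =>
    ((hD (m - 1)).2.2.2.1 i j).differentiableAt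
      ((hD (m - 1)).1.mem_nhds (hND (hNr h)).2)
  refine hYm.congr_of_eventuallyEq ?_
  have hc := continuous_div_rayDir m
  -- In this neighbourhood of the ray the glued function is Y_{m-1} on both sides. Above the ray the
  -- slope is below 1/3. Below it, with respect to sector m - 1, the slope is (re + im)/(re - im),
  -- and this is at least 2/3 exactly when re ≥ -5 im.
  have o1 : IsOpen {ζ : ℂ | 5 * |(ζ / rayDir m).im| < (ζ / rayDir m).re} :=
    isOpen_lt (continuous_const.mul (Complex.continuous_im.comp hc).abs)
      (Complex.continuous_re.comp hc)
  have m1 : ζ ∈ {ζ : ℂ | 5 * |(ζ / rayDir m).im| < (ζ / rayDir m).re} := by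
    change 5 * |(ζ / rayDir m).im| < (ζ / rayDir m).re
    rw [hray.2]; simpa using hray.1
  filter_upwards [o1.mem_nhds m1, hNo.mem_nhds (hNr h)] with ξ hξ hξN
  have hξ' : 5 * |(ξ / rayDir m).im| < (ξ / rayDir m).re := hξ
  have hre : 0 < (ξ / rayDir m).re := lt_of_le_of_lt (by positivity) hξ'
  rcases le_total 0 (ξ / rayDir m).im with him | him
  · rw [abs_of_nonneg him] at hξ'
    rw [glue_sectorFun hY ((mem_sector_iff m ξ).2 ⟨hre, him, by linarith⟩)]
    refine sectorFun_of_jump (cutoff_eq_one ?_) (hj ξ hξN)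
    rw [slope, div_le_iff₀ hre]
    linarith
  · rw [abs_of_nonpos him] at hξ'
    obtain ⟨e1, e2⟩ := div_rayDir_pred_re_im (m - 1) ξ
    rw [sub_add_cancel] at e1 e2
    have hs : 0 < Real.sqrt 2 / 2 := by positivity
    have hre' : 0 < (ξ / rayDir (m - 1)).re := by rw [e1]; exact mul_pos hs (by linarith)
    rw [glue_sectorFun hY ((mem_sector_iff (m - 1) ξ).2 ⟨hre',
      by rw [e2]; exact mul_nonneg hs.le (by linarith),
      by rw [e1, e2]; exact mul_le_mul_of_nonneg_left (by linarith) hs.le⟩)]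
    refine sectorFun_of_cutoff (cutoff_eq_zero ?_)
    rw [slope, le_div_iff₀ hre', e1, e2]
    nlinarith

lemma hasDbarAt_glue (hY : IsRHSolution s₁ s₂ x Y) {ζ : ℂ} (hζ : ζ ≠ 0) :
    HasDbarAt (glue (sectorFun s₁ s₂ x Y) M)
      (glue (sectorFun s₁ s₂ x Y) M ζ * dbarCoeff s₁ s₂ (x ^ 2) 1 ζ) ζ := by
  have h := mem_sector_sectorIndex hζ
  set m := sectorIndex ζ
  obtain ⟨h1, h2, h3⟩ := (mem_sector_iff m ζ).1 h
  rcases h2.eq_or_lt with h2 | h2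
  · exact hasDbarAt_glue_ray hY ((mem_ray_iff m ζ).2 ⟨h1, h2.symm⟩)
  rcases h3.eq_or_lt with h3 | h3
  · obtain ⟨e1, e2⟩ := div_rayDir_pred_re_im m ζ
    have hs : 0 < Real.sqrt 2 / 2 := by positivity
    refine hasDbarAt_glue_ray hY ((mem_ray_iff (m + 1) ζ).2 ?_)
    rw [e1, e2] at h3
    have h4 := mul_left_cancel₀ hs.ne' h3
    have h5 : (ζ / rayDir (m + 1)).im = 0 := by linarith
    rw [e1, h5, sub_zero] at h1
    exact ⟨pos_of_mul_pos_right h1 hs.le, h5⟩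
  · exact hasDbarAt_glue_interior hY h2 h3

/-- From exp u ≥ 1 + u, keeping one of the two terms of u. The first bound makes the correction
vanish at 0, the second at infinity. -/
lemma norm_cutoff_mul_jumpExp_le (hx : 0 < x) {m : ℤ} {ζ : ℂ} (h : ζ ∈ sector m) :
    ‖((cutoff (slope m ζ) : ℝ) : ℂ) * jumpExp (x ^ 2) 1 m ζ‖ ≤ ‖ζ‖ ∧
    ‖((cutoff (slope m ζ) : ℝ) : ℂ) * jumpExp (x ^ 2) 1 m ζ‖ ≤ (x ^ 2)⁻¹ * ‖ζ‖⁻¹ := by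
  have hn : 0 < ‖ζ‖ := norm_pos_iff.2 (ne_zero_of_mem_sector h)
  have hJ := norm_jumpExp_le (sq_nonneg x) zero_le_one h
  have hle : ‖((cutoff (slope m ζ) : ℝ) : ℂ) * jumpExp (x ^ 2) 1 m ζ‖ ≤
      (Real.exp (x ^ 2 * ‖ζ‖ + 1 * ‖ζ‖⁻¹))⁻¹ := by
    rw [norm_mul, Complex.norm_real, Real.norm_of_nonneg (cutoff_mem _).1, ← Real.exp_neg]
    exact (mul_le_of_le_one_left (norm_nonneg _) (cutoff_mem _).2).trans hJ
  have hexp := Real.add_one_le_exp (x ^ 2 * ‖ζ‖ + 1 * ‖ζ‖⁻¹)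
  have p1 : 0 < x ^ 2 * ‖ζ‖ := by positivity
  have p2 : 0 < ‖ζ‖⁻¹ := by positivity
  constructor
  · refine hle.trans ?_
    rw [inv_le_comm₀ (Real.exp_pos _) hn]
    linarith
  · refine hle.trans ?_
    rw [← mul_inv]
    exact inv_anti₀ p1 (by linarith)

lemma tendsto_sectorFun {l : Filter ℂ} {m : ℤ} {c : Matrix (Fin 4) (Fin 4) ℂ}
    (hY : Tendsto (Y m) (l ⊓ 𝓟 (sector m)) (𝓝 c))
    (hJ : Tendsto (fun ζ => ((cutoff (slope m ζ) : ℝ) : ℂ) * jumpExp (x ^ 2) 1 m ζ)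
      (l ⊓ 𝓟 (sector m)) (𝓝 0)) :
    Tendsto (fun ζ => sectorFun s₁ s₂ x Y m ζ) (l ⊓ 𝓟 (sector m)) (𝓝 c) := by
  have h := hY.mul ((hJ.smul_const (nilPart s₁ s₂ m)).const_sub 1)
  simpa [sectorFun] using h

lemma tendsto_glue_cobounded (hx : 0 < x) (hY : IsRHSolution s₁ s₂ x Y) :
    Tendsto (glue (sectorFun s₁ s₂ x Y) M) (Bornology.cobounded ℂ) (𝓝 1) := by
  refine tendsto_glue (fun m => tendsto_sectorFun (hY.tendsto_infty m) ?_)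
    ((Bornology.eventually_ne_cobounded (0 : ℂ)).mono fun ζ h h' => absurd h' h)
  have hb : ∀ᶠ ζ in Bornology.cobounded ℂ ⊓ 𝓟 (sector m),
      ‖((cutoff (slope m ζ) : ℝ) : ℂ) * jumpExp (x ^ 2) 1 m ζ‖ ≤ (x ^ 2)⁻¹ * ‖ζ‖⁻¹ :=
    eventually_inf_principal.2 (Eventually.of_forall fun ζ h => (norm_cutoff_mul_jumpExp_le hx h).2)
  refine squeeze_zero_norm' hb ?_
  have h := (tendsto_inv_atTop_zero.comp (tendsto_norm_cobounded_atTop (E := ℂ))).const_mul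
    (x ^ 2)⁻¹
  rw [mul_zero] at h
  exact h.mono_left inf_le_left

lemma tendsto_glue_zero (hx : 0 < x) (h0 : HasValueAtZero Y M) :
    Tendsto (glue (sectorFun s₁ s₂ x Y) M) (𝓝 0) (𝓝 M) := by
  refine tendsto_glue (fun m => tendsto_sectorFun (h0 m) ?_)
    (Eventually.of_forall fun ζ _ => rfl)
  have hb : ∀ᶠ ζ in 𝓝 0 ⊓ 𝓟 (sector m),
      ‖((cutoff (slope m ζ) : ℝ) : ℂ) * jumpExp (x ^ 2) 1 m ζ‖ ≤ ‖ζ‖ :=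
    eventually_inf_principal.2 (Eventually.of_forall fun ζ h => (norm_cutoff_mul_jumpExp_le hx h).1)
  refine squeeze_zero_norm' hb ?_
  have h := (continuous_norm (E := ℂ)).tendsto 0
  rw [norm_zero] at h
  exact h.mono_left inf_le_left

lemma isUnit_glue (hY : IsRHSolution s₁ s₂ x Y) (hM : IsUnit M) (ζ : ℂ) :
    IsUnit (glue (sectorFun s₁ s₂ x Y) M ζ) := by
  rcases eq_or_ne ζ 0 with rfl | hζ
  · rwa [glue_zero]
  · have h := mem_sector_sectorIndex hζ
    rw [glue_sectorFun hY h, sectorFun]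
    obtain ⟨D, hD, -⟩ := hY.holomorphic_jump
    exact ((hD _).2.2.2.2 ζ ((hD _).2.2.1 h)).mul (isUnit_one_sub_smul_nilPart _ _ _ _)

/-- A solution of the Riemann–Hilbert problem with a value at `0` gives a solution of the
`∂̄`-problem. -/
theorem exists_isDbarSolution (hx : 0 < x) (hY : IsRHSolution s₁ s₂ x Y)
    (h0 : HasValueAtZero Y M) (hM : IsUnit M) :
    ∃ F G, IsDbarSolution (dbarCoeff s₁ s₂ (x ^ 2) 1) F G ∧ F 0 = M := by
  set F := glue (sectorFun s₁ s₂ x Y) M with hF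
  have hu := isUnit_glue hY hM
  have hc : Continuous F := by
    rw [continuous_iff_continuousAt]
    intro ζ
    rcases eq_or_ne ζ 0 with rfl | hζ
    · rw [ContinuousAt, hF, glue_zero]
      exact tendsto_glue_zero hx h0
    · obtain ⟨L, hL, -⟩ := hasDbarAt_glue (M := M) hY hζ
      exact hL.continuousAt
  refine ⟨F, fun ζ => Ring.inverse (F ζ), ⟨hc, ?_, fun ζ => Ring.mul_inverse_cancel _ (hu ζ),
    fun ζ => Ring.inverse_mul_cancel _ (hu ζ), tendsto_glue_cobounded hx hY,
    fun ζ hζ => hasDbarAt_glue hY hζ⟩, glue_zero _ _⟩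
  rw [continuous_iff_continuousAt]
  intro ζ
  obtain ⟨u, hu'⟩ := hu ζ
  have h1 := NormedRing.inverse_continuousAt u
  rw [hu'] at h1
  exact ContinuousAt.comp (f := F) h1 hc.continuousAt

end Transfer

/-! ### The two deformation equations -/

section Deformation

section Scaling

variable {𝔸 : Type*} [NormedRing 𝔸] [NormedAlgebra ℂ 𝔸]

lemma tendsto_div_cobounded {τ : ℝ} (hτ : 0 < τ) :
    Tendsto (fun ζ : ℂ => ζ / τ) (Bornology.cobounded ℂ) (Bornology.cobounded ℂ) := by
  rw [← tendsto_norm_atTop_iff_cobounded]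
  have h := (tendsto_norm_cobounded_atTop (E := ℂ)).atTop_div_const hτ
  refine h.congr fun ζ => ?_
  rw [norm_div, Complex.norm_real, Real.norm_of_nonneg hτ.le]

lemma IsDbarSolution.scale {R F G : ℂ → 𝔸} (S : IsDbarSolution R F G) {τ : ℝ} (hτ : 0 < τ) :
    IsDbarSolution (fun ζ => (τ : ℂ)⁻¹ • R (ζ / τ)) (fun ζ => F (ζ / τ)) fun ζ => G (ζ / τ) where
  continuous := S.continuous.comp (by fun_prop)
  continuous_inv := S.continuous_inv.comp (by fun_prop)
  mul_inv ζ := S.mul_inv _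
  inv_mul ζ := S.inv_mul _
  tendsto := S.tendsto.comp (tendsto_div_cobounded hτ)
  dbar ζ hζ := by
    have hτ' : (τ : ℂ) ≠ 0 := by exact_mod_cast hτ.ne'
    obtain ⟨L, hL, hLe⟩ := S.dbar (ζ / τ) (div_ne_zero hζ hτ')
    have hv : HasFDerivAt (fun ζ : ℂ => ζ / τ) (τ⁻¹ • (ContinuousLinearMap.id ℝ ℂ)) ζ := by
      have h := (hasFDerivAt_id (𝕜 := ℝ) ζ).const_smul τ⁻¹
      refine h.congr_of_eventuallyEq (Eventually.of_forall fun ξ => ?_)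
      simp only [Pi.smul_apply, id_eq, Complex.real_smul]
      push_cast
      rw [div_eq_mul_inv, mul_comm]
    refine ⟨_, hL.comp ζ hv, ?_⟩
    simp only [ContinuousLinearMap.comp_apply, smul_apply, ContinuousLinearMap.id_apply, map_smul]
    rw [smul_comm Complex.I, ← smul_add, hLe, mul_smul_comm, ← Complex.coe_smul, smul_comm]
    push_cast
    rfl

lemma HasLeadingCoeff.scale {F : ℂ → 𝔸} {y : 𝔸} (h : HasLeadingCoeff F y) {τ : ℝ} (hτ : 0 < τ) :
    HasLeadingCoeff (fun ζ => F (ζ / τ)) (τ • y) := by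
  have hτ' : (τ : ℂ) ≠ 0 := by exact_mod_cast hτ.ne'
  have h1 := (h.comp (tendsto_div_cobounded hτ)).const_smul τ
  refine h1.congr fun ζ => ?_
  simp only [Function.comp_apply]
  rw [← Complex.coe_smul, smul_smul, mul_div_cancel₀ _ hτ']

end Scaling

/-- The slope is invariant under positive scaling, and ζ ↦ ζ/τ turns the exponent with parameters
(tτ, 1) into the one with (t, τ). The parameter can therefore be moved from the pole at infinity to
the pole at 0. -/
lemma dbarCoeff_scale (s₁ s₂ t : ℝ) {τ : ℝ} (hτ : 0 < τ) (ζ : ℂ) :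
    (τ : ℂ)⁻¹ • dbarCoeff s₁ s₂ (t * τ) 1 (ζ / τ) = dbarCoeff s₁ s₂ t τ ζ := by
  have hτ' : (τ : ℂ) ≠ 0 := by exact_mod_cast hτ.ne'
  rcases eq_or_ne ζ 0 with rfl | hζ
  · simp [dbarCoeff_zero]
  have h := mem_sector_sectorIndex hζ
  set m := sectorIndex ζ
  have hdiv : ζ / τ / rayDir m = ζ / rayDir m / τ := div_right_comm _ _ _
  have h' : ζ / τ ∈ sector m := by
    rw [mem_sector_iff] at h ⊢
    rw [hdiv]
    refine ⟨?_, ?_, ?_⟩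
    · rw [Complex.div_ofReal_re]; exact div_pos h.1 hτ
    · rw [Complex.div_ofReal_im]; exact div_nonneg h.2.1 hτ.le
    · rw [Complex.div_ofReal_re, Complex.div_ofReal_im]
      exact div_le_div_of_nonneg_right h.2.2 hτ.le
  have hs : slope m (ζ / τ) = slope m ζ := by
    rw [slope, slope, hdiv, Complex.div_ofReal_re, Complex.div_ofReal_im,
      div_div_div_cancel_right₀ hτ.ne']
  have hJ : jumpExp (t * τ) 1 m (ζ / τ) = jumpExp t τ m ζ := by
    rw [jumpExp, jumpExp, hdiv, inv_div]
    congr 3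
    push_cast
    field_simp
  rw [dbarCoeff_eq _ _ _ _ h, dbarCoeff_eq _ _ _ _ h', smul_smul, dbarScalar, dbarScalar, hs, hJ,
    hdiv, Complex.div_ofReal_re]
  congr 1
  have hre : ((ζ / rayDir m).re : ℂ) ≠ 0 := by
    exact_mod_cast ((mem_sector_iff m ζ).1 h).1.ne'
  push_cast
  field_simp

variable {s₁ s₂ : ℝ} {S : Set ℝ} {F G : ℝ → ℂ → Matrix (Fin 4) (Fin 4) ℂ}
  {y : ℝ → Matrix (Fin 4) (Fin 4) ℂ}

/-- The first deformation equation. -/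
theorem hasDerivAt_value (hS : IsOpen S) (hpos : ∀ t ∈ S, 0 < t)
    (hF : ∀ t ∈ S, IsDbarSolution (dbarCoeff s₁ s₂ t 1) (F t) (G t))
    (hy : ∀ t ∈ S, HasLeadingCoeff (F t) (y t)) {t : ℝ} (ht : t ∈ S) :
    HasDerivAt (fun t => F t 0) ((y t * dMat - dMat * y t) * F t 0) t := by
  have ht0 := hpos t ht
  obtain ⟨K, hK, hb, hb', -, hT⟩ := exists_dbarCoeff_bounds s₁ s₂ ht0 one_pos
  have hm := stronglyMeasurable_dbarCoeff s₁ s₂ t 1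
  refine DbarFamily.hasDerivAt_apply_zero (R := fun u => dbarCoeff s₁ s₂ u 1) (G := G)
    (K := K)
    ⟨fun u => stronglyMeasurable_dbarCoeff s₁ s₂ u 1, ?_, hb, hb', ?_, ?_⟩ (hy t ht)
  · exact stronglyMeasurable_id.smul ((stronglyMeasurable_const.mul hm).sub
      (hm.mul stronglyMeasurable_const))
  · filter_upwards [Metric.closedBall_mem_nhds t (show 0 < t / 4 by positivity)] with u hu ζ
    rw [Metric.mem_closedBall, Real.dist_eq] at hu
    have h := hT u 1 hu (by norm_num) ζ
    rw [sub_self, zero_smul, add_zero, abs_zero, add_zero, sq_abs] at h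
    exact h
  · filter_upwards [hS.mem_nhds ht] with u hu using hF u hu

/-- The second deformation equation. -/
theorem hasDerivAt_smul_leadingCoeff (hS : IsOpen S) (hpos : ∀ t ∈ S, 0 < t)
    (hF : ∀ t ∈ S, IsDbarSolution (dbarCoeff s₁ s₂ t 1) (F t) (G t))
    (hy : ∀ t ∈ S, HasLeadingCoeff (F t) (y t)) {t : ℝ} (ht : t ∈ S) :
    HasDerivAt (fun t => t • y t) (F t 0 * dInvMat * G t 0 - dInvMat) t := by
  have ht0 := hpos t ht
  obtain ⟨K, hK, hb, -, hb', hT⟩ := exists_dbarCoeff_bounds s₁ s₂ ht0 one_pos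
  have hm := stronglyMeasurable_dbarCoeff s₁ s₂ t 1
  have hcont : Tendsto (fun τ : ℝ => t * τ) (𝓝 1) (𝓝 t) := by
    simpa using (continuous_const_mul t).tendsto 1
  have hev : ∀ᶠ τ : ℝ in 𝓝 1, 0 < τ ∧ t * τ ∈ S :=
    (lt_mem_nhds one_pos).and (hcont.eventually (hS.mem_nhds ht))
  -- The family in τ near 1 at fixed t: the rescaled solution at tτ solves the problem with
  -- parameters (t, τ), and its leading coefficient is τ y(tτ).
  have hD : DbarFamily (1 : ℝ) (fun τ => dbarCoeff s₁ s₂ t τ) (fun τ ζ => F (t * τ) (ζ / τ))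
      (fun τ ζ => G (t * τ) (ζ / τ))
      (fun ζ => ζ⁻¹ • (dInvMat * dbarCoeff s₁ s₂ t 1 ζ - dbarCoeff s₁ s₂ t 1 ζ * dInvMat)) K := by
    refine ⟨fun u => stronglyMeasurable_dbarCoeff s₁ s₂ t u, ?_, hb, hb', ?_, ?_⟩
    · exact (measurable_inv (G := ℂ)).stronglyMeasurable.smul
        ((stronglyMeasurable_const.mul hm).sub (hm.mul stronglyMeasurable_const))
    · filter_upwards [Metric.closedBall_mem_nhds (1 : ℝ) (show (0 : ℝ) < 1 / 4 by positivity)]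
        with u hu ζ
      rw [Metric.mem_closedBall, Real.dist_eq] at hu
      have h := hT t u (by rw [sub_self, abs_zero]; positivity) hu ζ
      rw [sub_self, zero_smul, zero_add, abs_zero, zero_add, sq_abs] at h
      exact h
    · filter_upwards [hev] with τ hτ
      have h := (hF _ hτ.2).scale hτ.1
      have e : (fun ζ : ℂ => (τ : ℂ)⁻¹ • dbarCoeff s₁ s₂ (t * τ) 1 (ζ / τ)) =
          dbarCoeff s₁ s₂ t τ := funext (dbarCoeff_scale s₁ s₂ t hτ.1)
      rwa [e] at h
  have h1 := hD.hasDerivAt_leadingCoeff' (y := fun τ => τ • y (t * τ))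
    (hev.mono fun τ hτ => (hy _ hτ.2).scale hτ.1)
  simp only [mul_one, zero_div] at h1
  -- Substituting τ = u/t and multiplying by t turns τ y(tτ) into u y(u).
  have h2 : HasDerivAt (fun u : ℝ => u / t) (1 / t) t := (hasDerivAt_id t).div_const t
  have h1' : HasDerivAt (fun τ : ℝ => τ • y (t * τ)) (F t 0 * dInvMat * G t 0 - dInvMat)
      (t / t) := by
    rwa [div_self ht0.ne']
  have h3 := (HasDerivAt.scomp (h := fun u : ℝ => u / t) t h1' h2).const_smul t
  have e3 : t • (1 / t) • (F t 0 * dInvMat * G t 0 - dInvMat) =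
      F t 0 * dInvMat * G t 0 - dInvMat := by
    rw [smul_smul, mul_one_div_cancel ht0.ne', one_smul]
  rw [e3] at h3
  refine h3.congr_of_eventuallyEq (Eventually.of_forall fun u => ?_)
  simp only [Pi.smul_apply, Function.comp_apply]
  rw [smul_smul, mul_div_cancel₀ _ ht0.ne']

end Deformation

/-! ### Conjugation by Ω -/

section Diagonalisation

/-- The inverse of `Ω`. -/
def OmegaInv : Matrix (Fin 4) (Fin 4) ℂ :=
  Matrix.of fun i j => (4 : ℂ)⁻¹ * (-Complex.I) ^ ((i : ℕ) * (j : ℕ))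

lemma I_pow_six : Complex.I ^ 6 = -1 := by
  rw [show 6 = 2 * 3 by norm_num, pow_mul, Complex.I_sq]; norm_num

lemma I_pow_nine : Complex.I ^ 9 = Complex.I := by
  rw [show 9 = 4 * 2 + 1 by norm_num, pow_add, pow_mul, Complex.I_pow_four]; simp

lemma OmegaInv_mul_Omega : OmegaInv * Omega = 1 := by
  have hI := Complex.I_mul_I
  ext i j
  fin_cases i <;> fin_cases j <;>
  simp [OmegaInv, Omega, Matrix.mul_apply, Fin.sum_univ_four, neg_pow Complex.I, I_pow_six,
    I_pow_nine] <;> ring_nf <;> simp <;> norm_num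

lemma Omega_mul_OmegaInv : Omega * OmegaInv = 1 :=
  mul_eq_one_comm.1 OmegaInv_mul_Omega

lemma inv_Omega : Omega⁻¹ = OmegaInv := Matrix.inv_eq_right_inv Omega_mul_OmegaInv

/-- The cyclic shift. -/
def shiftMat : Matrix (Fin 4) (Fin 4) ℂ := Matrix.of fun i j => if i = j + 1 then 1 else 0

/-- The inverse of the cyclic shift. -/
def shiftInvMat : Matrix (Fin 4) (Fin 4) ℂ := Matrix.of fun i j => if j = i + 1 then 1 else 0

/-- Multiplying row i of Ω by ω^i sends ω^(ij) to ω^(i(j+1)), which shifts the columns cyclically.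
-/
lemma dMat_mul_Omega : dMat * Omega = Omega * shiftMat := by
  ext i j
  fin_cases i <;> fin_cases j <;>
  simp [dMat, Omega, shiftMat, d4, Matrix.mul_apply, Fin.sum_univ_four, I_pow_six, I_pow_nine]

lemma shift_mul_shiftInv : shiftMat * shiftInvMat = 1 := by
  ext i j
  fin_cases i <;> fin_cases j <;>
  simp [shiftMat, shiftInvMat, Matrix.mul_apply, Fin.sum_univ_four]

lemma dInvMat_mul_dMat : dInvMat * dMat = 1 := by
  rw [dInvMat, dMat, Matrix.diagonal_mul_diagonal, ← Matrix.diagonal_one]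
  congr 1
  ext i
  exact inv_mul_cancel₀ (pow_ne_zero _ Complex.I_ne_zero)

lemma dMat_mul_dInvMat : dMat * dInvMat = 1 := mul_eq_one_comm.1 dInvMat_mul_dMat

lemma conj_dMat : OmegaInv * dMat * Omega = shiftMat := by
  rw [mul_assoc, dMat_mul_Omega, ← mul_assoc, OmegaInv_mul_Omega, one_mul]

lemma conj_dInvMat : OmegaInv * dInvMat * Omega = shiftInvMat := by
  have h1 : (OmegaInv * dInvMat * Omega) * shiftMat = 1 := by
    rw [← conj_dMat]
    calc _ = OmegaInv * dInvMat * (Omega * OmegaInv) * dMat * Omega := by noncomm_ring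
      _ = OmegaInv * (dInvMat * dMat) * Omega := by rw [Omega_mul_OmegaInv]; noncomm_ring
      _ = 1 := by rw [dInvMat_mul_dMat, mul_one, OmegaInv_mul_Omega]
  calc _ = (OmegaInv * dInvMat * Omega) * (shiftMat * shiftInvMat) := by
        rw [shift_mul_shiftInv, mul_one]
    _ = _ := by rw [← mul_assoc, h1, one_mul]

/-- The diagonal of the commutator that drives the second deformation equation. -/
lemma conj_commutator_apply {μ : Fin 4 → ℂ} (hμ : ∀ i, μ i ≠ 0)
    {M N : Matrix (Fin 4) (Fin 4) ℂ}
    (hM : M = Omega * Matrix.diagonal μ * OmegaInv) (hMN : M * N = 1) (i : Fin 4) :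
    (OmegaInv * ((M * dInvMat * N - dInvMat) * dMat - dMat * (M * dInvMat * N - dInvMat)) *
      Omega) i i = μ i / μ (i + 1) - μ (i - 1) / μ i := by
  set D := Matrix.diagonal μ with hD
  set D' := Matrix.diagonal fun i => (μ i)⁻¹ with hD'
  have hDD : D * D' = 1 := by
    rw [hD, hD', Matrix.diagonal_mul_diagonal, ← Matrix.diagonal_one]
    congr 1
    ext i
    exact mul_inv_cancel₀ (hμ i)
  have hN : N = Omega * D' * OmegaInv := by
    have h1 : M * (Omega * D' * OmegaInv) = 1 := by
      rw [hM]
      calc _ = Omega * D * (OmegaInv * Omega) * D' * OmegaInv := by noncomm_ring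
        _ = Omega * (D * D') * OmegaInv := by rw [OmegaInv_mul_Omega]; noncomm_ring
        _ = 1 := by rw [hDD, mul_one, Omega_mul_OmegaInv]
    calc N = N * (M * (Omega * D' * OmegaInv)) := by rw [h1, mul_one]
      _ = _ := by rw [← mul_assoc, mul_eq_one_comm.1 hMN, one_mul]
  have hW : M * dInvMat * N = Omega * (D * shiftInvMat * D') * OmegaInv := by
    rw [hM, hN, ← conj_dInvMat]
    noncomm_ring
  -- The subtracted d₄⁻¹ commutes with d₄ and drops out; what remains is a commutator of a weighted
  -- inverse shift with the shift.
  have e : OmegaInv * ((M * dInvMat * N - dInvMat) * dMat - dMat * (M * dInvMat * N - dInvMat)) *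
      Omega = (D * shiftInvMat * D') * shiftMat - shiftMat * (D * shiftInvMat * D') := by
    rw [sub_mul (M * dInvMat * N), mul_sub dMat, dInvMat_mul_dMat, dMat_mul_dInvMat,
      sub_sub_sub_cancel_right, hW, ← conj_dMat]
    calc _ = (OmegaInv * Omega) * (D * shiftInvMat * D') * OmegaInv * dMat * Omega -
          OmegaInv * dMat * Omega * (D * shiftInvMat * D') * (OmegaInv * Omega) := by noncomm_ring
      _ = _ := by rw [OmegaInv_mul_Omega]; noncomm_ring
  rw [e, Matrix.sub_apply, Matrix.mul_apply, Matrix.mul_apply]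
  simp only [hD, hD', Matrix.diagonal_mul, Matrix.mul_diagonal, shiftMat, shiftInvMat,
    Matrix.of_apply]
  rw [Finset.sum_eq_single (i + 1), Finset.sum_eq_single (i - 1)]
  · simp [div_eq_mul_inv]
  · intro j _ hj
    rw [if_neg (fun h => hj (by rw [h, add_sub_cancel_right]))]
    simp
  · simp
  · intro j _ hj
    rw [if_neg hj]
    simp
  · simp

lemma hasDerivAt_conj_entry {A : ℝ → Matrix (Fin 4) (Fin 4) ℂ} {A' : Matrix (Fin 4) (Fin 4) ℂ}
    {t : ℝ} (h : HasDerivAt A A' t) (B C : Matrix (Fin 4) (Fin 4) ℂ) (i j : Fin 4) :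
    HasDerivAt (fun u => ((B * A u * C) i j).re) ((B * A' * C) i j).re t := by
  have h1 := (h.const_mul B).mul_const C
  let L : Matrix (Fin 4) (Fin 4) ℂ →ₗ[ℝ] ℝ :=
    { toFun := fun M => (M i j).re
      map_add' := fun _ _ => rfl
      map_smul' := fun c M => by simp }
  exact (L.toContinuousLinearMap.hasFDerivAt).comp_hasDerivAt t h1

end Diagonalisation

/-! ### The radial form of the Toda system -/

section RadialToda

variable {S : Set ℝ} {W c : Fin 4 → ℝ → ℝ}

/-- The tt*-Toda system as a first order system in the variable `t = |z|²`. -/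
structure IsRadialSystem (S : Set ℝ) (W c : Fin 4 → ℝ → ℝ) : Prop where
  isOpen : IsOpen S
  pos : ∀ t ∈ S, 0 < t
  deriv_W : ∀ i, ∀ t ∈ S, HasDerivAt (W i) (-(c i t) / 2) t
  deriv_c : ∀ i, ∀ t ∈ S, HasDerivAt (fun u => u * c i u)
    (Real.exp (2 * (W (i + 1) t - W i t)) - Real.exp (2 * (W i t - W (i - 1) t))) t

namespace IsRadialSystem

lemma hasDerivAt_c (h : IsRadialSystem S W c) (i : Fin 4) {t : ℝ} (ht : t ∈ S) :
    HasDerivAt (c i) ((Real.exp (2 * (W (i + 1) t - W i t)) -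
      Real.exp (2 * (W i t - W (i - 1) t)) - c i t) / t) t := by
  have ht0 := (h.pos t ht).ne'
  have h1 := (h.deriv_c i t ht).div (hasDerivAt_id t) ht0
  have h2 : c i =ᶠ[𝓝 t] (fun u => u * c i u) / id := by
    filter_upwards [h.isOpen.mem_nhds ht] with u hu
    simp only [Pi.div_apply, id_eq]
    rw [mul_div_cancel_left₀ _ (h.pos u hu).ne']
  refine (h1.congr_of_eventuallyEq h2).congr_deriv ?_
  simp only [id_eq]
  field_simp

/-- Bootstrapping: the derivatives of W and c are smooth expressions in W, c and 1/t, and t is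
positive on S. -/
lemma contDiffOn_nat (h : IsRadialSystem S W c) (n : ℕ) :
    ∀ i, ContDiffOn ℝ n (W i) S ∧ ContDiffOn ℝ n (c i) S := by
  have dW : ∀ i, DifferentiableOn ℝ (W i) S := fun i t ht =>
    (h.deriv_W i t ht).differentiableAt.differentiableWithinAt
  have dc : ∀ i, DifferentiableOn ℝ (c i) S := fun i t ht =>
    (h.hasDerivAt_c i ht).differentiableAt.differentiableWithinAt
  induction n with
  | zero =>
    intro i
    simp only [Nat.cast_zero, contDiffOn_zero]
    exact ⟨(dW i).continuousOn, (dc i).continuousOn⟩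
  | succ n ih =>
    intro i
    push_cast
    rw [contDiffOn_succ_iff_deriv_of_isOpen h.isOpen, contDiffOn_succ_iff_deriv_of_isOpen h.isOpen]
    refine ⟨⟨dW i, by simp, ?_⟩, dc i, by simp, ?_⟩
    · refine ContDiffOn.congr ?_ fun t ht => (h.deriv_W i t ht).deriv
      exact (ih i).2.neg.div_const 2
    · refine ContDiffOn.congr ?_ fun t ht => (h.hasDerivAt_c i ht).deriv
      refine ContDiffOn.div ?_ contDiffOn_id fun t ht => (h.pos t ht).ne'
      exact (((contDiffOn_const.mul ((ih (i + 1)).1.sub (ih i).1)).exp).sub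
        ((contDiffOn_const.mul ((ih i).1.sub (ih (i - 1)).1)).exp)).sub (ih i).2

lemma contDiffOn (h : IsRadialSystem S W c) (i : Fin 4) : ContDiffOn ℝ ∞ (W i) S :=
  contDiffOn_infty.2 fun n => (h.contDiffOn_nat n i).1

lemma hasFDerivAt_normSq (z : ℂ) : ∃ L : ℂ →L[ℝ] ℝ, HasFDerivAt (fun z : ℂ => ‖z‖ ^ 2) L z ∧
    L 1 = 2 * z.re ∧ L Complex.I = 2 * z.im := by
  have h : (fun z : ℂ => ‖z‖ ^ 2) = fun z => z.re * z.re + z.im * z.im := by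
    ext z; rw [← Complex.normSq_eq_norm_sq, Complex.normSq_apply]
  have h1 := Complex.reCLM.hasFDerivAt (x := z)
  have h2 := Complex.imCLM.hasFDerivAt (x := z)
  rw [h]
  refine ⟨_, (h1.mul h1).add (h2.mul h2), ?_, ?_⟩
  · simp; ring
  · simp; ring

lemma wirtingerBar_eq (h : IsRadialSystem S W c) (i : Fin 4) {z : ℂ} (hz : ‖z‖ ^ 2 ∈ S) :
    wirtingerBar (fun z' => ((W i (‖z'‖ ^ 2) : ℝ) : ℂ)) z =
      ((-(c i (‖z‖ ^ 2)) / 2 : ℝ) : ℂ) * z := by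
  obtain ⟨L, hL, h1, hI⟩ := hasFDerivAt_normSq z
  have hd := Complex.ofRealCLM.hasFDerivAt.comp z
    (HasDerivAt.comp_hasFDerivAt (f := fun z : ℂ => ‖z‖ ^ 2) z (h.deriv_W i _ hz) hL)
  have hd' : HasFDerivAt (fun z' : ℂ => ((W i (‖z'‖ ^ 2) : ℝ) : ℂ)) _ z := hd
  rw [wirtingerBar, hd'.fderiv]
  simp only [ContinuousLinearMap.comp_apply, smul_apply, h1, hI, Complex.ofRealCLM_apply,
    smul_eq_mul]
  set γ := c i (‖z‖ ^ 2)
  push_cast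
  conv_rhs => rw [← Complex.re_add_im z]
  ring

/-- For a function of t = |z|², ∂_z̄ gives W' z, and then ∂_z gives W' + t W'' = (t W')' = -(t
c)'/2. -/
lemma wirtinger_wirtingerBar (h : IsRadialSystem S W c) (i : Fin 4) {z : ℂ} (hz : ‖z‖ ^ 2 ∈ S) :
    2 * wirtinger (wirtingerBar (fun z' => ((W i (‖z'‖ ^ 2) : ℝ) : ℂ))) z =
      ((-Real.exp (2 * (W (i + 1) (‖z‖ ^ 2) - W i (‖z‖ ^ 2))) +
        Real.exp (2 * (W i (‖z‖ ^ 2) - W (i - 1) (‖z‖ ^ 2))) : ℝ) : ℂ) := by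
  have hopen : IsOpen {z : ℂ | ‖z‖ ^ 2 ∈ S} := h.isOpen.preimage (by fun_prop)
  have hev : wirtingerBar (fun z' => ((W i (‖z'‖ ^ 2) : ℝ) : ℂ)) =ᶠ[𝓝 z]
      fun z => ((-(c i (‖z‖ ^ 2)) / 2 : ℝ) : ℂ) * z := by
    filter_upwards [hopen.mem_nhds hz] with ξ hξ using h.wirtingerBar_eq i hξ
  obtain ⟨L, hL, h1, hI⟩ := hasFDerivAt_normSq z
  have hc : HasDerivAt (fun u => -(c i u) / 2) _ (‖z‖ ^ 2) := (h.hasDerivAt_c i hz).neg.div_const 2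
  have hd := Complex.ofRealCLM.hasFDerivAt.comp z
    (HasDerivAt.comp_hasFDerivAt (f := fun z : ℂ => ‖z‖ ^ 2) z hc hL)
  have hd' : HasFDerivAt (fun z : ℂ => ((-(c i (‖z‖ ^ 2)) / 2 : ℝ) : ℂ) * z) _ z :=
    hd.mul (hasFDerivAt_id z)
  rw [wirtinger, hev.fderiv_eq, hd'.fderiv]
  simp only [ContinuousLinearMap.comp_apply, add_apply, smul_apply, h1, hI,
    Complex.ofRealCLM_apply, smul_eq_mul, Function.comp_apply, ContinuousLinearMap.id_apply]
  set A := Real.exp (2 * (W (i + 1) (‖z‖ ^ 2) - W i (‖z‖ ^ 2)))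
  set B := Real.exp (2 * (W i (‖z‖ ^ 2) - W (i - 1) (‖z‖ ^ 2)))
  set γ := c i (‖z‖ ^ 2)
  have ht : ‖z‖ ^ 2 ≠ 0 := (h.pos _ hz).ne'
  set δ := (A - B - γ) / ‖z‖ ^ 2 with hδ
  have hδ' : δ * ‖z‖ ^ 2 = A - B - γ := div_mul_cancel₀ _ ht
  have hz2 : (z.re : ℂ) * z - Complex.I * z.im * z = ((‖z‖ ^ 2 : ℝ) : ℂ) := by
    rw [← Complex.normSq_eq_norm_sq, Complex.normSq_eq_conj_mul_self]
    conv_rhs => rw [← Complex.re_add_im ((starRingEnd ℂ) z)]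
    rw [Complex.conj_re, Complex.conj_im]
    push_cast
    ring
  have hδc : (δ : ℂ) * ((‖z‖ ^ 2 : ℝ) : ℂ) = A - B - γ := by exact_mod_cast hδ'
  push_cast at hz2 hδc ⊢
  have hII := Complex.I_mul_I
  linear_combination (-(δ : ℂ)) * hz2 - hδc + (γ / 2 : ℂ) * hII

end IsRadialSystem

end RadialToda

/-! ### From the ∂̄-problem to the radial system -/

section Assembly

lemma exists_leadingCoeff_family {s₁ s₂ : ℝ} {S : Set ℝ} (hpos : ∀ t ∈ S, 0 < t)
    {F G : ℝ → ℂ → Matrix (Fin 4) (Fin 4) ℂ}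
    (hF : ∀ t ∈ S, IsDbarSolution (dbarCoeff s₁ s₂ t 1) (F t) (G t)) :
    ∃ y : ℝ → Matrix (Fin 4) (Fin 4) ℂ, ∀ t ∈ S, HasLeadingCoeff (F t) (y t) := by
  have h : ∀ t, ∃ y, t ∈ S → HasLeadingCoeff (F t) y := by
    intro t
    by_cases ht : t ∈ S
    · obtain ⟨K, -, hb, -⟩ := exists_dbarCoeff_bounds s₁ s₂ (hpos t ht) one_pos
      obtain ⟨y, hy⟩ := (hF t ht).exists_hasLeadingCoeff
        (stronglyMeasurable_dbarCoeff s₁ s₂ t 1) hb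
      exact ⟨y, fun _ => hy⟩
    · exact ⟨0, fun h => absurd h ht⟩
  choose y hy using h
  exact ⟨y, hy⟩

/-- Solutions of the `∂̄`-problem whose values at `0` are diagonalised by `Ω` give solutions of the
radial Toda system. -/
theorem exists_isRadialSystem {s₁ s₂ : ℝ} {S : Set ℝ} (hS : IsOpen S) (hpos : ∀ t ∈ S, 0 < t)
    {F G : ℝ → ℂ → Matrix (Fin 4) (Fin 4) ℂ} {W : Fin 4 → ℝ → ℝ}
    (hF : ∀ t ∈ S, IsDbarSolution (dbarCoeff s₁ s₂ t 1) (F t) (G t))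
    (hW : ∀ t ∈ S, F t 0 = Omega *
      Matrix.diagonal (fun i => ((Real.exp (-2 * W i t) : ℝ) : ℂ)) * OmegaInv) :
    ∃ c, IsRadialSystem S W c := by
  obtain ⟨y, hy⟩ := exists_leadingCoeff_family hpos hF
  refine ⟨fun i t => ((OmegaInv * (y t * dMat - dMat * y t) * Omega) i i).re,
    hS, hpos, fun i t ht => ?_, fun i t ht => ?_⟩
  · have h1 := hasDerivAt_conj_entry (hasDerivAt_value hS hpos hF hy ht) OmegaInv Omega i i
    have hval : ∀ u ∈ S, ((OmegaInv * F u 0 * Omega) i i).re = Real.exp (-2 * W i u) := by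
      intro u hu
      have : OmegaInv * F u 0 * Omega =
          Matrix.diagonal (fun i => ((Real.exp (-2 * W i u) : ℝ) : ℂ)) := by
        rw [hW u hu]
        calc _ = (OmegaInv * Omega) * Matrix.diagonal (fun i => ((Real.exp (-2 * W i u) : ℝ) : ℂ)) *
              (OmegaInv * Omega) := by noncomm_ring
          _ = _ := by rw [OmegaInv_mul_Omega, one_mul, mul_one]
      rw [this, Matrix.diagonal_apply_eq, Complex.ofReal_re]
    -- F(0) stands on the right and becomes diagonal, so each diagonal entry of the product is that
    -- of [y, d] times an eigenvalue; the logarithmic derivative of exp(-2 W_i) is thus the i-th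
    -- diagonal entry of the conjugated commutator.
    have hder : ((OmegaInv * ((y t * dMat - dMat * y t) * F t 0) * Omega) i i).re =
        ((OmegaInv * (y t * dMat - dMat * y t) * Omega) i i).re * Real.exp (-2 * W i t) := by
      have : OmegaInv * ((y t * dMat - dMat * y t) * F t 0) * Omega =
          (OmegaInv * (y t * dMat - dMat * y t) * Omega) *
            Matrix.diagonal (fun i => ((Real.exp (-2 * W i t) : ℝ) : ℂ)) := by
        rw [hW t ht]
        generalize y t * dMat - dMat * y t = A
        calc _ = OmegaInv * A * Omega *
              Matrix.diagonal (fun i => ((Real.exp (-2 * W i t) : ℝ) : ℂ)) *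
              (OmegaInv * Omega) := by noncomm_ring
          _ = _ := by rw [OmegaInv_mul_Omega, mul_one]
      rw [this, Matrix.mul_diagonal, Complex.re_mul_ofReal]
    rw [hder] at h1
    have h2 : HasDerivAt (fun u => Real.exp (-2 * W i u)) _ t := h1.congr_of_eventuallyEq (by
      filter_upwards [hS.mem_nhds ht] with u hu using (hval u hu).symm)
    have h3 := (h2.log (Real.exp_pos _).ne').div_const (-2)
    simp only [Real.log_exp] at h3
    have e : (fun u => -2 * W i u / -2) = W i := by ext u; ring
    rw [e, mul_div_cancel_right₀ _ (Real.exp_pos _).ne'] at h3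
    refine h3.congr_deriv ?_
    rw [div_neg, neg_div]
  · have h1 := hasDerivAt_smul_leadingCoeff hS hpos hF hy ht
    -- Commuting the second deformation equation with d₄ gives the derivative of t [y, d], whose
    -- diagonal after conjugation is t c.
    have h2 : HasDerivAt
        (fun u => ((OmegaInv * (u • y u * dMat - dMat * u • y u) * Omega) i i).re) _ t :=
      hasDerivAt_conj_entry ((h1.mul_const dMat).sub (h1.const_mul dMat)) OmegaInv Omega i i
    rw [conj_commutator_apply (fun i => by exact_mod_cast (Real.exp_pos _).ne') (hW t ht)
      ((hF t ht).mul_inv 0)] at h2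
    have e1 : ∀ a b : ℝ, Real.exp (2 * (a - b)) = Real.exp (-2 * b) / Real.exp (-2 * a) := by
      intro a b
      rw [← Real.exp_sub]; congr 1; ring
    rw [e1, e1]
    have e2 : ∀ u : ℝ, u * ((OmegaInv * (y u * dMat - dMat * y u) * Omega) i i).re =
        ((OmegaInv * (u • y u * dMat - dMat * u • y u) * Omega) i i).re := by
      intro u
      rw [smul_mul_assoc, mul_smul_comm, ← smul_sub, mul_smul_comm, smul_mul_assoc,
        Matrix.smul_apply, Complex.smul_re, smul_eq_mul]
    simp only [e2]
    refine h2.congr_deriv ?_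
    rw [← Complex.ofReal_div, ← Complex.ofReal_div, ← Complex.ofReal_sub, Complex.ofReal_re]

/-- Solutions of the Riemann–Hilbert problem whose value at `0` is diagonalised by `Ω` give
solutions of the radial Toda system. -/
theorem exists_isRadialSystem_of_isRHSolution (s₁ s₂ : ℝ) (X : Set ℝ) (hXopen : IsOpen X)
    (hXpos : ∀ x ∈ X, 0 < x) (Y : ℝ → ℤ → ℂ → Matrix (Fin 4) (Fin 4) ℂ)
    (hY : ∀ x ∈ X, IsRHSolution s₁ s₂ x (Y x)) (a b : ℝ → ℝ)
    (hY0 : ∀ x ∈ X, HasValueAtZero (Y x)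
      (Omega * Matrix.diagonal ![(a x : ℂ), (b x : ℂ), (b x : ℂ)⁻¹, (a x : ℂ)⁻¹] * Omega⁻¹))
    (w : Fin 4 → ℝ → ℝ)
    (hw0 : ∀ x ∈ X, a x = Real.exp (-2 * w 0 x)) (hw1 : ∀ x ∈ X, b x = Real.exp (-2 * w 1 x))
    (hw2 : ∀ x ∈ X, w 2 x = -w 1 x) (hw3 : ∀ x ∈ X, w 3 x = -w 0 x) :
    ∃ c, IsRadialSystem {t | 0 < t ∧ √t ∈ X} (fun i t => w i √t) c := by
  set S : Set ℝ := {t | 0 < t ∧ √t ∈ X} with hS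
  have hSo : IsOpen S :=
    isOpen_Ioi.inter (hXopen.preimage Real.continuous_sqrt)
  have hex : ∀ t, ∃ F G : ℂ → Matrix (Fin 4) (Fin 4) ℂ, t ∈ S →
      IsDbarSolution (dbarCoeff s₁ s₂ t 1) F G ∧ F 0 = Omega *
        Matrix.diagonal (fun i => ((Real.exp (-2 * w i √t) : ℝ) : ℂ)) * OmegaInv := by
    intro t
    by_cases ht : t ∈ S
    swap
    · exact ⟨0, 0, fun h => absurd h ht⟩
    obtain ⟨ht0, htX⟩ := ht
    have hdiag : Matrix.diagonal ![(a √t : ℂ), (b √t : ℂ), (b √t : ℂ)⁻¹, (a √t : ℂ)⁻¹] =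
        Matrix.diagonal (fun i => ((Real.exp (-2 * w i √t) : ℝ) : ℂ)) := by
      congr 1
      ext i
      fin_cases i
      · simp [hw0 _ htX]
      · simp [hw1 _ htX]
      · simp [hw1 _ htX, hw2 _ htX, ← Complex.exp_neg]
      · simp [hw0 _ htX, hw3 _ htX, ← Complex.exp_neg]
    have h0 := hY0 _ htX
    rw [hdiag, inv_Omega] at h0
    have hu : IsUnit (Omega * Matrix.diagonal
        (fun i => ((Real.exp (-2 * w i √t) : ℝ) : ℂ)) * OmegaInv) := by
      refine ((IsUnit.of_mul_eq_one _ Omega_mul_OmegaInv).mul ?_).mul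
        (IsUnit.of_mul_eq_one _ OmegaInv_mul_Omega)
      rw [Matrix.isUnit_diagonal, Pi.isUnit_iff]
      exact fun i => IsUnit.mk0 _ (by exact_mod_cast (Real.exp_pos _).ne')
    obtain ⟨F, G, hFG, hF0⟩ := exists_isDbarSolution (hXpos _ htX) (hY _ htX) h0 hu
    rw [Real.sq_sqrt ht0.le] at hFG
    exact ⟨F, G, fun _ => ⟨hFG, hF0⟩⟩
  choose F G hFG using hex
  exact exists_isRadialSystem (W := fun i t => w i √t) hSo (fun t ht => ht.1)
    (fun t ht => (hFG t ht).1) (fun t ht => (hFG t ht).2)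

end Assembly

end TtStar

end

/-! ### The tt*-Toda equations -/

theorem proposition3p4 (s₁ s₂ : ℝ) (X : Set ℝ) (hXopen : IsOpen X) (hXpos : ∀ x ∈ X, 0 < x)
    (Y : ℝ → ℤ → ℂ → Matrix (Fin 4) (Fin 4) ℂ)
    (hY : ∀ x ∈ X, TtStar.IsRHSolution s₁ s₂ x (Y x))
    (a b : ℝ → ℝ) (ha : ∀ x ∈ X, 0 < a x) (hb : ∀ x ∈ X, 0 < b x)
    (hY0 : ∀ x ∈ X, TtStar.HasValueAtZero (Y x)
      (TtStar.Omega *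
        Matrix.diagonal ![(a x : ℂ), (b x : ℂ), (b x : ℂ)⁻¹, (a x : ℂ)⁻¹] * TtStar.Omega⁻¹))
    (w : Fin 4 → ℝ → ℝ)
    (hw0 : ∀ x ∈ X, a x = Real.exp (-2 * w 0 x)) (hw1 : ∀ x ∈ X, b x = Real.exp (-2 * w 1 x))
    (hw2 : ∀ x ∈ X, w 2 x = -w 1 x) (hw3 : ∀ x ∈ X, w 3 x = -w 0 x) :
    TtStar.IsTodaSolution 3 4 {z : ℂ | ‖z‖ ∈ X} (fun i z => w i ‖z‖) := by
  obtain ⟨c, hc⟩ := TtStar.exists_isRadialSystem_of_isRHSolution s₁ s₂ X hXopen hXpos Y hY a b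
    hY0 w hw0 hw1 hw2 hw3
  have hmem : ∀ z : ℂ, ‖z‖ ∈ X → ‖z‖ ^ 2 ∈ {t | 0 < t ∧ √t ∈ X} := fun z hz =>
    ⟨pow_pos (hXpos _ hz) 2, by rwa [Real.sqrt_sq (norm_nonneg z)]⟩
  have hsq : ∀ (i : Fin 4) (z : ℂ), w i √(‖z‖ ^ 2) = w i ‖z‖ := fun i z => by
    rw [Real.sqrt_sq (norm_nonneg z)]
  refine ⟨hXopen.preimage continuous_norm, fun i => ?_, fun i z hz => ?_, fun z hz => ?_,
    fun i j hij z hz => ?_, fun i z _ z' _ h => by simp only [h]⟩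
  · have h1 := (hc.contDiffOn i).comp (g := fun t => w i √t) (f := fun z : ℂ => ‖z‖ ^ 2)
      (contDiff_norm_sq ℝ).contDiffOn (fun z hz => hmem z hz)
    refine h1.congr fun z _ => ?_
    simp only [Function.comp_apply, hsq]
  · have h1 := hc.wirtinger_wirtingerBar i (hmem z hz)
    simp only [hsq] at h1
    exact h1
  · rw [Fin.sum_univ_four]
    rw [hw2 _ hz, hw3 _ hz]
    ring
  · have h2 := hw2 _ hz
    have h3 := hw3 _ hz
    -- With n = 3 and l = 4 the second alternative i + j = 7 cannot occur for indices at most 3, so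
    -- only i + j = 3 remains.
    have hj : j = 3 - i := by
      ext
      revert hij
      revert i j
      decide
    subst hj
    show w i ‖z‖ + w (3 - i) ‖z‖ = 0
    fin_cases i
    · show w 0 ‖z‖ + w 3 ‖z‖ = 0
      linarith
    · show w 1 ‖z‖ + w 2 ‖z‖ = 0
      linarith
    · show w 2 ‖z‖ + w 1 ‖z‖ = 0
      linarith
    · show w 3 ‖z‖ + w 0 ‖z‖ = 0
      linarith
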